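/- **Setting.** Fix a period $T>0$; all loops are smooth and $T$-periodic in $x$, $D=d/dx$, and $S^1=\mathbb R/T\mathbb Z$. Let $J=\begin{pmatrix}0&0&0&-1\\0&1&0&0\\0&0&1&0\\-1&0&0&0\end{pmatrix}$, $\mathfrak g=\mathfrak o(3,1)=\{X\in\mathfrak{gl}(4,\mathbb R): X^TJ+JX=0\}$, with $\mathfrak g^*$ identified with $\mathfrak g$ through $(A,B)\mapsto\mathrm{tr}(AB)$, and let $G$ be the identity component of $O(3,1)$. Let $H_L\subset G$ be the isotropy group of the vector $e_4$ of the light cone, and $H_M\supset H_L$ the isotropy group of the ray of $e_4$, so that $G/H_L$ is the (upper) light cone and $G/H_M$ the Möbius $2$-sphere. Loops $g$ in $H=H_L$ or $H_M$ act on $\mathcal L\mathfrak g^*$ by the gauge action $L\mapsto g^{-1}g_x+g^{-1}Lg$. Put $$K_L(k)=\begin{pmatrix}0&-k_0&0&0\\-k_1&0&0&-k_0\\-k_2&0&0&0\\0&-k_1&-k_2&0\end{pmatrix}\ (k_0>0),\qquad K_M(\kappa)=K_L(1,\kappa_1,\kappa_2),\qquad L_0=\begin{pmatrix}0&0&0&0\\1&0&0&0\\0&0&0&0\\0&1&0&0\end{pmatrix}.$$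 Fix a sign $\varepsilon\in\{1,-1\}$ ($\varepsilon=1$ gives the displayed matrices; $\varepsilon=-1$ gives their negatives, the Maurer–Cartan matrices of the left moving frames), and let $\mathcal K_L=\{\varepsilon K_L(k)\}$, $\mathcal K_M=\{\varepsilon K_M(\kappa)\}$, where $k$ runs over loops with $k_0>0$ and $\kappa$ over all loops in $\mathbb R^2$. A *smooth functional* is a functional with a smoothly varying variational derivative. The second bracket on $\mathcal L\mathfrak g^*$ is $$\{\mathcal H,\mathcal F\}_2(L)=\int_{S^1}\mathrm{tr}\Big(\Big[L_0,\tfrac{\delta\mathcal H}{\delta L}(L)\Big]\tfrac{\delta\mathcal F}{\delta L}(L)\Big)dx .$$ It is called *reducible* to a section $\mathcal K$ of the gauge action of $\mathcal LH$, with reduced bracket $\{\cdot,\cdot\}$ on $\mathcal K$, if every smooth functional on $\mathcal K$ extends to a smooth functional on the union of the gauge leaves through $\mathcal K$ that is constant on these leaves; if $\{\mathcal H,\mathcal F\}_2|_{\mathcal K}=\{h,f\}$ for all smooth $h,f$ on $\mathcal K$ and all such extensions $\mathcal H,\mathcal F$; and if $\{\cdot,\cdot\}$ is a Poisson bracket on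 the smooth functionals on $\mathcal K$. **Theorem.** 1. The bracket $\{\cdot,\cdot\}_2$ is reducible to $\mathcal K_L$ (for the gauge action of $\mathcal LH_L$), and the reduced bracket is $$\{h,f\}(k)=\frac{\varepsilon}{2}\int_{S^1}\Big(\frac{\delta f}{\delta k}\Big)^{T}P_0\,\frac{\delta h}{\delta k}\,dx,\qquad P_0=\mathrm{diag}\Big(0,\ -D\tfrac1{k_0}-\tfrac1{k_0}D,\ D\tfrac1{k_0}+\tfrac1{k_0}D\Big).$$ 2. The bracket $\{\cdot,\cdot\}_2$ is reducible to $\mathcal K_M$ (for the gauge action of $\mathcal LH_M$), and the reduced bracket is $\{h,f\}(\kappa)=\varepsilon\int_{S^1}\big(\frac{\delta f}{\delta\kappa}\big)^T\mathrm{diag}(-D,D)\frac{\delta h}{\delta\kappa}\,dx$. 3. The reduced bracket on $\mathcal K_L$ foliates by the values of $k_0$: for every smooth $T$-periodic $c>0$, in particular every constant $c>0$, the level set $\{k_0=c\}$, parametrized by $(k_1,k_2)$, is a Poisson submanifold, with Poisson bracket given by the operator $\frac{\varepsilon}{2}\,\mathrm{diag}\big(-D\frac1c-\frac1cD,\ D\frac1c+\frac1cD\big)$.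 Here a Poisson submanifold is one on which the smooth functionals are exactly the restrictions of smooth functionals on $\mathcal K_L$ and on which $\{h,f\}$ restricts to a Poisson bracket of the restrictions of $h$ and $f$. 4. For $c=1$ the submanifold $\mathcal K_L^1=\{k_0=1\}$ coincides with $\mathcal K_M$ (through $\kappa_i=k_i$), and the restricted bracket is the reduced bracket of part 2, with operator $\varepsilon\,\mathrm{diag}(-D,D)$. 5. The operator $\mathrm{diag}(-D,D)$ is the second Hamiltonian structure of the complexly coupled KdV system $$(k_1)_t=-k_1'''+3k_1k_1'-3k_2k_2',\qquad (k_2)_t=-k_2'''+3(k_1k_2)' .$$ That is, with $P=\begin{pmatrix}-D^3+k_1D+Dk_1&Dk_2+k_2D\\Dk_2+k_2D&D^3-Dk_1-k_1D\end{pmatrix}$, the right-hand side of the system equals both $P\,\frac{\delta h_1}{\delta k}$ and $\mathrm{diag}(-D,D)\,\frac{\delta h_2}{\delta k}$, where $h_1=\frac12\int_{S^1}(k_1^2-k_2^2)\,dx$ and $h_2=-\frac12\int_{S^1}\big((k_1')^2-(k_2')^2+k_1^3-3k_1k_2^2\big)dx$ are smooth functionals, and for all real $a,b$ the operator $aP+b\,\mathrm{diag}(-D,D)$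 defines a Poisson bracket (so the two structures are Poisson and compatible). -/

import Mathlib

open scoped ContDiff Matrix

attribute [local instance] Matrix.normedAddCommGroup Matrix.normedSpace

noncomputable section

namespace LightCone

/-! ### Loop spaces, smooth functionals and variational derivatives -/

section Functionals

variable {V : Type*} [NormedAddCommGroup V] [NormedSpace ℝ V]

/-- Smooth `T`-periodic functions with values in `S`, i.e. smooth maps from the circle
`ℝ / Tℤ` to `S`. -/
def loops (T : ℝ) (S : Set V) : Set (ℝ → V) :=
  {f | ContDiff ℝ ∞ f ∧ Function.Periodic f T ∧ ∀ x, f x ∈ S}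

/-- A smooth family `s ↦ p s` of elements of a function space `S`: it is jointly smooth in the
parameter and in the loop variable. -/
def IsSmoothFamily {E : Type*} [NormedAddCommGroup E] [NormedSpace ℝ E]
    (S : Set (ℝ → V)) (p : E → ℝ → V) : Prop :=
  ContDiff ℝ ∞ (fun q : E × ℝ => p q.1 q.2) ∧ ∀ s, p s ∈ S

/-- A set `carrier` of `V`-valued loops of period `T`, with a pairing that identifies variational
derivatives with loops whose values lie in `cov`. -/
structure LoopSpace (V : Type*) [NormedAddCommGroup V] [NormedSpace ℝ V] where
  T : ℝ
  carrier : Set (ℝ → V)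
  cov : Set V
  pairing : V → V → ℝ

/-- `δ` is the variational derivative of the functional `h` on `M`: it depends smoothly on the
point, and `d/ds h(γ_s) = ∫ ⟨δ(γ_s), ∂γ_s/∂s⟩ dx` along every smooth curve `γ` in `M`. -/
structure LoopSpace.HasVarDeriv (M : LoopSpace V) (h : (ℝ → V) → ℝ)
    (δ : (ℝ → V) → ℝ → V) : Prop where
  smooth : ∀ (n : ℕ) (p : (Fin n → ℝ) → ℝ → V), IsSmoothFamily M.carrier p →
    IsSmoothFamily (loops M.T M.cov) (fun s => δ (p s))
  hasDerivAt : ∀ γ : ℝ → ℝ → V, IsSmoothFamily M.carrier γ → ∀ s : ℝ,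
    HasDerivAt (fun r => h (γ r))
      (∫ x in (0 : ℝ)..M.T, M.pairing (δ (γ s) x) (deriv (fun r => γ r x) s)) s

/-- Smooth functionals: those that have a variational derivative. -/
def LoopSpace.IsSmooth (M : LoopSpace V) (h : (ℝ → V) → ℝ) : Prop :=
  ∃ δ, M.HasVarDeriv h δ

open Classical in
/-- The variational derivative of a smooth functional (`0` if the functional is not smooth). -/
def LoopSpace.varDeriv (M : LoopSpace V) (h : (ℝ → V) → ℝ) : (ℝ → V) → ℝ → V :=
  if hs : M.IsSmooth h then Classical.choose hs else 0

/-- The bracket `{h, f}(k) = ∫ ⟨δf(k), 𝒫(k) δh(k)⟩ dx` with operator `𝒫`. -/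
def LoopSpace.opBracket (M : LoopSpace V) (P : (ℝ → V) → (ℝ → V) → ℝ → V)
    (h f : (ℝ → V) → ℝ) (k : ℝ → V) : ℝ :=
  ∫ x in (0 : ℝ)..M.T, M.pairing (M.varDeriv f k x) (P k (M.varDeriv h k) x)

/-- Poisson brackets on the algebra of smooth functionals on `M`. -/
structure LoopSpace.IsPoisson (M : LoopSpace V)
    (b : ((ℝ → V) → ℝ) → ((ℝ → V) → ℝ) → (ℝ → V) → ℝ) : Prop where
  smooth : ∀ h f, M.IsSmooth h → M.IsSmooth f → M.IsSmooth (b h f)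
  skew : ∀ h f, M.IsSmooth h → M.IsSmooth f → ∀ k ∈ M.carrier, b h f k = -b f h k
  linear : ∀ (a : ℝ) (h h' f), M.IsSmooth h → M.IsSmooth h' → M.IsSmooth f → ∀ k ∈ M.carrier,
    b (a • h + h') f k = a * b h f k + b h' f k
  leibniz : ∀ h h' f, M.IsSmooth h → M.IsSmooth h' → M.IsSmooth f → ∀ k ∈ M.carrier,
    b (h * h') f k = h k * b h' f k + h' k * b h f k
  jacobi : ∀ h f g, M.IsSmooth h → M.IsSmooth f → M.IsSmooth g → ∀ k ∈ M.carrier,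
    b (b h f) g k + b (b f g) h k + b (b g h) f k = 0

/-- `ι` embeds `(N, bN)` as a Poisson submanifold of `(M, bM)`: smooth functionals on `N` are
exactly the restrictions of smooth functionals on `M`, and `{h, f}_M` restricts to
`{h|_N, f|_N}_N`. -/
structure IsPoissonSubmanifold {V' : Type*} [NormedAddCommGroup V'] [NormedSpace ℝ V']
    (M : LoopSpace V) (bM : ((ℝ → V) → ℝ) → ((ℝ → V) → ℝ) → (ℝ → V) → ℝ)
    (N : LoopSpace V') (bN : ((ℝ → V') → ℝ) → ((ℝ → V') → ℝ) → (ℝ → V') → ℝ)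
    (ι : (ℝ → V') → ℝ → V) : Prop where
  mapsTo : Set.MapsTo ι N.carrier M.carrier
  injOn : Set.InjOn ι N.carrier
  smooth_restrict : ∀ h, M.IsSmooth h → N.IsSmooth (fun κ => h (ι κ))
  exists_extend : ∀ h, N.IsSmooth h → ∃ h', M.IsSmooth h' ∧ ∀ κ ∈ N.carrier, h' (ι κ) = h κ
  poisson : N.IsPoisson bN
  restrict : ∀ h f, M.IsSmooth h → M.IsSmooth f → ∀ κ ∈ N.carrier,
    bM h f (ι κ) = bN (fun κ => h (ι κ)) (fun κ => f (ι κ)) κ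

end Functionals

/-! ### The Lorentz algebra, the isotropy groups and the gauge action -/

/-- Real `4 × 4` matrices. -/
abbrev Mat : Type := Matrix (Fin 4) (Fin 4) ℝ

/-- The Minkowski form in light-cone coordinates. -/
def J : Mat := !![0, 0, 0, -1; 0, 1, 0, 0; 0, 0, 1, 0; -1, 0, 0, 0]

/-- The Lie algebra `𝔬(3,1)` of matrices `X` with `Xᵀ J + J X = 0`. -/
def o31 : Set Mat := {X | X ∈ skewAdjointMatricesLieSubalgebra J}

/-- The base point `e₄` of the light cone. -/
def e4 : Fin 4 → ℝ := ![0, 0, 0, 1]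

/-- The isotropy group of `e₄` in the identity component of `O(3,1)`; the cone is `G / H_L`. -/
def HL : Set Mat := {g | gᵀ * J * g = J ∧ g.det = 1 ∧ g *ᵥ e4 = e4}

/-- The isotropy group of the ray of `e₄` in the identity component of `O(3,1)`; the Möbius sphere
is `G / H_M`. -/
def HM : Set Mat := {g | gᵀ * J * g = J ∧ g.det = 1 ∧ ∃ r : ℝ, 0 < r ∧ g *ᵥ e4 = r • e4}

/-- The gauge action of a loop `g` of group elements, `g⁻¹ g_x + g⁻¹ L g`. -/
def gauge (g L : ℝ → Mat) : ℝ → Mat :=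
  fun x => (g x)⁻¹ * deriv g x + (g x)⁻¹ * L x * g x

section Reduction

variable {V : Type*} [NormedAddCommGroup V] [NormedSpace ℝ V]

/-- The union of the `𝓛H`-gauge leaves through the section `K` parametrized by `M`, as a subset of
`𝓛𝔤* = 𝓛𝔤`, where `𝔤 = 𝔬(3,1)` is identified with its dual by the trace of the product. -/
def gaugeDomain (H : Set Mat) (M : LoopSpace V) (K : (ℝ → V) → ℝ → Mat) : LoopSpace Mat where
  T := M.T
  carrier := {L | ∃ k ∈ M.carrier, ∃ g ∈ loops M.T H, L = gauge g (K k)}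
  cov := o31
  pairing := fun A B => (A * B).trace

/-- The constant-coefficient bracket
`{𝓗, 𝓕}₂(L) = ∫ ⟨ad*(δ𝓗)(L₀), δ𝓕⟩ dx = ∫ tr([L₀, δ𝓗(L)] δ𝓕(L)) dx`. -/
def secondBracket (L₀ : Mat) (U : LoopSpace Mat) (H F : (ℝ → Mat) → ℝ) (L : ℝ → Mat) : ℝ :=
  ∫ x in (0 : ℝ)..U.T, (⁅L₀, U.varDeriv H L x⁆ * U.varDeriv F L x).trace

/-- `𝓗` is a smooth extension of `h`, from the section to the union of the gauge leaves through
it, that is constant on these leaves. -/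
structure IsGaugeExtension (H : Set Mat) (M : LoopSpace V) (K : (ℝ → V) → ℝ → Mat)
    (h : (ℝ → V) → ℝ) (Hext : (ℝ → Mat) → ℝ) : Prop where
  smooth : (gaugeDomain H M K).IsSmooth Hext
  const : ∀ L ∈ (gaugeDomain H M K).carrier, ∀ g ∈ loops M.T H, Hext (gauge g L) = Hext L
  extend : ∀ k ∈ M.carrier, Hext (K k) = h k

/-- The bracket `{·,·}₂` defined by `L₀` is reducible to the section `K`, with reduced bracket `b`:
functionals have extensions constant on the leaves, the bracket of two such extensions takes the
value `b` on the section whatever the extensions are, and `b` is a Poisson bracket. -/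
structure ReducesTo (L₀ : Mat) (H : Set Mat) (M : LoopSpace V) (K : (ℝ → V) → ℝ → Mat)
    (b : ((ℝ → V) → ℝ) → ((ℝ → V) → ℝ) → (ℝ → V) → ℝ) : Prop where
  exists_extension : ∀ h, M.IsSmooth h → ∃ Hext, IsGaugeExtension H M K h Hext
  bracket_eq : ∀ h f, M.IsSmooth h → M.IsSmooth f → ∀ Hext Fext,
    IsGaugeExtension H M K h Hext → IsGaugeExtension H M K f Fext →
    ∀ k ∈ M.carrier, secondBracket L₀ (gaugeDomain H M K) Hext Fext (K k) = b h f k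
  poisson : M.IsPoisson b

end Reduction

/-! ### The two spaces of invariants and the operators -/

/-- The invariants `(k₀, k₁, k₂)` of curves in the cone, `k₀ > 0`. -/
def coneInvariants (T : ℝ) : LoopSpace (Fin 3 → ℝ) where
  T := T
  carrier := loops T {v | 0 < v 0}
  cov := Set.univ
  pairing := fun v w => v ⬝ᵥ w

/-- The invariants `(κ₁, κ₂)` of curves in the Möbius sphere. -/
def sphereInvariants (T : ℝ) : LoopSpace (Fin 2 → ℝ) where
  T := T
  carrier := loops T Set.univ
  cov := Set.univ
  pairing := fun v w => v ⬝ᵥ w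

/-- The Maurer–Cartan matrix `K_L` of curves in the cone. -/
def KL (k : Fin 3 → ℝ) : Mat :=
  !![0, -k 0, 0, 0; -k 1, 0, 0, -k 0; -k 2, 0, 0, 0; 0, -k 1, -k 2, 0]

/-- The Maurer–Cartan matrix `K_M` of curves in the Möbius sphere. -/
def KM (κ : Fin 2 → ℝ) : Mat :=
  !![0, -1, 0, 0; -κ 0, 0, 0, -1; -κ 1, 0, 0, 0; 0, -κ 0, -κ 1, 0]

/-- The constant element that defines the second bracket. -/
def L0 : Mat := !![0, 0, 0, 0; 1, 0, 0, 0; 0, 0, 0, 0; 0, 1, 0, 0]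

/-- `P₀ = diag(0, -D(1/k₀) - (1/k₀)D, D(1/k₀) + (1/k₀)D)`. -/
def P0 (k v : ℝ → Fin 3 → ℝ) (x : ℝ) : Fin 3 → ℝ :=
  ![0,
    -deriv (fun y => 1 / k y 0 * v y 1) x - 1 / k x 0 * deriv (fun y => v y 1) x,
    deriv (fun y => 1 / k y 0 * v y 2) x + 1 / k x 0 * deriv (fun y => v y 2) x]

/-- The lower right block of `P₀` for a given `k₀ = c`. -/
def leafOp (c : ℝ → ℝ) (v : ℝ → Fin 2 → ℝ) (x : ℝ) : Fin 2 → ℝ :=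
  ![-deriv (fun y => 1 / c y * v y 0) x - 1 / c x * deriv (fun y => v y 0) x,
    deriv (fun y => 1 / c y * v y 1) x + 1 / c x * deriv (fun y => v y 1) x]

/-- The operator `diag(-D, D)`. -/
def diagD (v : ℝ → Fin 2 → ℝ) (x : ℝ) : Fin 2 → ℝ :=
  ![-deriv (fun y => v y 0) x, deriv (fun y => v y 1) x]

/-- The inclusion `(κ₁, κ₂) ↦ (c, κ₁, κ₂)` of the leaf `k₀ = c`. -/
def leaf (c : ℝ → ℝ) (κ : ℝ → Fin 2 → ℝ) : ℝ → Fin 3 → ℝ :=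
  fun x => ![c x, κ x 0, κ x 1]

/-! ### The complexly coupled KdV system -/

/-- The complexly coupled KdV system
`(k₁)_t = -k₁''' + 3 k₁ k₁' - 3 k₂ k₂'`, `(k₂)_t = -k₂''' + 3 (k₁ k₂)'`,
i.e. `q_t = -q''' + 3 q q'` for `q = k₁ + i k₂`. -/
def coupledKdV (κ : ℝ → Fin 2 → ℝ) (x : ℝ) : Fin 2 → ℝ :=
  ![-iteratedDeriv 3 (fun y => κ y 0) x + 3 * κ x 0 * deriv (fun y => κ y 0) x
      - 3 * κ x 1 * deriv (fun y => κ y 1) x,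
    -iteratedDeriv 3 (fun y => κ y 1) x + 3 * deriv (fun y => κ y 0 * κ y 1) x]

/-- The first Hamiltonian structure
`((-D³ + k₁D + Dk₁, Dk₂ + k₂D), (Dk₂ + k₂D, D³ - Dk₁ - k₁D))`. -/
def kdvP (κ v : ℝ → Fin 2 → ℝ) (x : ℝ) : Fin 2 → ℝ :=
  ![-iteratedDeriv 3 (fun y => v y 0) x + κ x 0 * deriv (fun y => v y 0) x
      + deriv (fun y => κ y 0 * v y 0) x
      + deriv (fun y => κ y 1 * v y 1) x + κ x 1 * deriv (fun y => v y 1) x,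
    deriv (fun y => κ y 1 * v y 0) x + κ x 1 * deriv (fun y => v y 0) x
      + iteratedDeriv 3 (fun y => v y 1) x - deriv (fun y => κ y 0 * v y 1) x
      - κ x 0 * deriv (fun y => v y 1) x]

/-- `½ ∫ (k₁² - k₂²) dx`. -/
def kdvH1 (T : ℝ) (κ : ℝ → Fin 2 → ℝ) : ℝ :=
  1 / 2 * ∫ x in (0 : ℝ)..T, (κ x 0 ^ 2 - κ x 1 ^ 2)

/-- `-½ ∫ ((k₁')² - (k₂')² + k₁³ - 3 k₁ k₂²) dx`. -/
def kdvH2 (T : ℝ) (κ : ℝ → Fin 2 → ℝ) : ℝ :=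
  -(1 / 2) * ∫ x in (0 : ℝ)..T,
    (deriv (fun y => κ y 0) x ^ 2 - deriv (fun y => κ y 1) x ^ 2
      + κ x 0 ^ 3 - 3 * κ x 0 * κ x 1 ^ 2)

end LightCone

end

noncomputable section

namespace LightCone

/-! ### Parameter integrals and mixed partial derivatives. -/

section Calculus

variable {E F : Type} [NormedAddCommGroup E] [NormedSpace ℝ E]
  [NormedAddCommGroup F] [NormedSpace ℝ F]

/-! An element of `𝔬(3,1)` is written in components `(α, β₁, β₂, γ₁, γ₂, ρ)`; then `𝔥_M` is `β = 0`,
`𝔥_L` is `α = β = 0`, and `L0` is the unit vector of `γ₁`. Let `D` be the variational derivative, at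
`ε K`, of a leafwise constant extension of `h`. Pairing `D` with variations of `k₁, k₂` inside the
section gives `β = -(ε/2) (δh/δk₁, δh/δk₂)`. Invariance in the gauge directions `γ` gives `β₁' = -ε
k₀ α` and `β₂' = -ε k₀ ρ`. The trace of `[L0, D] D̃` contains only `α, β, ρ`; it equals `2 (α β̃₁ -
β₁ α̃ + β₂ ρ̃ - ρ β̃₂)`. So the components of `D` that remain undetermined do not matter, the
bracket does not depend on the extension, and one integration by parts turns it into `D (1/k₀) +
(1/k₀) D` with opposite signs in the two slots. The gradient in `k₀` never enters, so `k₀` is a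
Casimir. Cone and sphere share this computation (`isRestriction_of`, `integral_lie_L0`); the sphere
is the case `k₀ = 1`.

Extensions exist because the normal form is unique and explicit. The equation `g L = g_x + ε K g` is
triangular: once `g₃₃` and `k₀` are known, it gives the entries of `g` and then `k₁, k₂` one after
another from `L` and its derivatives (`isFrame_gauge`). The first step gives `g₃₃ k₀ = √(L₀₁² +
L₀₂²)`, which yields `k₀` for `H_L`, where `g₃₃ = 1`, and `g₃₃` for `H_M`, where `k₀ = 1`. The
extension is `L ↦ h(k(L))`. Its variational derivative is `g⁻¹ Q g`, with an explicit `Q` (`coAdj`)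
for which `Q_x + [K, Q]` annihilates the isotropy algebra (`IsSection.exists_gaugeExtension`).

That the operators define Poisson brackets follows from one criterion (`IsHamiltonian.isPoisson`):
in the Jacobi sum the second variations cancel by their symmetry, and what remains is a trilinear
identity for the operator and its derivative. For `P₀` this identity is trivial, since the operator
depends only on `k₀` and does not move it. On a level set of `k₀` the operator does not depend on
the point at all. The KdV pencil is the scalar KdV pencil over the complex numbers, with real parts
taken. -/

theorem hasFDerivAt_intervalIntegral [FiniteDimensional ℝ E] {f : E × ℝ → F}
    (hf : ContDiff ℝ 1 f) (a b : ℝ) (s : E) :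
    HasFDerivAt (fun s => ∫ x in a..b, f (s, x))
      (∫ x in a..b, (fderiv ℝ f (s, x)).comp (ContinuousLinearMap.inl ℝ E ℝ)) s := by
  have hc : Continuous fun q : E × ℝ =>
      (fderiv ℝ f q).comp (ContinuousLinearMap.inl ℝ E ℝ) :=
    (hf.continuous_fderiv one_ne_zero).clm_comp continuous_const
  have : ProperSpace E := FiniteDimensional.proper ℝ E
  obtain ⟨C, hC⟩ := ((isCompact_closedBall s 1).prod (isCompact_uIcc (a := a) (b := b))).exists_bound_of_continuousOn
    hc.continuousOn
  refine intervalIntegral.hasFDerivAt_integral_of_dominated_of_fderiv_le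
    (F := fun s x => f (s, x)) (bound := fun _ => C)
    (F' := fun s x => (fderiv ℝ f (s, x)).comp (ContinuousLinearMap.inl ℝ E ℝ))
    (Metric.closedBall_mem_nhds s one_pos) ?_ ?_ ?_ ?_ ?_ ?_
  · exact Filter.Eventually.of_forall fun r =>
      (hf.continuous.comp (by fun_prop : Continuous fun x : ℝ => (r, x))).aestronglyMeasurable
  · exact (hf.continuous.comp (by fun_prop : Continuous fun x : ℝ => (s, x))).intervalIntegrable _ _
  · exact (hc.comp (by fun_prop : Continuous fun x : ℝ => (s, x))).aestronglyMeasurable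
  · refine Filter.Eventually.of_forall fun x hx r hr => hC (r, x) ⟨hr, ?_⟩
    exact Set.uIoc_subset_uIcc hx
  · simp
  · refine Filter.Eventually.of_forall fun x _ r _ => ?_
    exact (hf.differentiable one_ne_zero (r, x)).hasFDerivAt.comp r (hasFDerivAt_prodMk_left r x)

/-- The derivative is again an integral of the same kind, with values in `E →L[ℝ] F`, so the order
of differentiability goes up by induction with `F` generalized. -/
theorem contDiff_intervalIntegral [FiniteDimensional ℝ E] {f : E × ℝ → F}
    (hf : ContDiff ℝ ∞ f) (a b : ℝ) :
    ContDiff ℝ ∞ (fun s => ∫ x in a..b, f (s, x)) := by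
  rw [contDiff_infty]
  intro n
  induction n generalizing F with
  | zero =>
    exact contDiff_zero.2 <| continuous_iff_continuousAt.2 fun s =>
      (hasFDerivAt_intervalIntegral (hf.of_le (by simp)) a b s).continuousAt
  | succ n ih =>
    refine contDiff_succ_iff_hasFDerivAt.2
      ⟨_, ih (f := fun q => (fderiv ℝ f q).comp (ContinuousLinearMap.inl ℝ E ℝ)) ?_,
        hasFDerivAt_intervalIntegral (hf.of_le (by simp)) a b⟩
    exact (hf.fderiv_right le_rfl).clm_comp contDiff_const

theorem hasDerivAt_curry {f : E → ℝ → F} (hf : ContDiff ℝ ∞ (fun q : E × ℝ => f q.1 q.2))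
    (s : E) (x : ℝ) :
    HasDerivAt (f s) (fderiv ℝ (fun q : E × ℝ => f q.1 q.2) (s, x) (0, 1)) x := by
  have h := (hf.differentiable (by simp) (s, x)).hasFDerivAt.comp_hasDerivAt x
    ((hasDerivAt_const x s).prodMk (hasDerivAt_id x))
  exact h

theorem contDiff_deriv_curry {f : E → ℝ → F} (hf : ContDiff ℝ ∞ (fun q : E × ℝ => f q.1 q.2)) :
    ContDiff ℝ ∞ (fun q : E × ℝ => deriv (f q.1) q.2) := by
  simp_rw [(hasDerivAt_curry hf _ _).deriv]
  exact (hf.fderiv_right le_rfl).clm_apply contDiff_const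

theorem contDiff_swap {f : ℝ → ℝ → F} (hf : ContDiff ℝ ∞ (fun q : ℝ × ℝ => f q.1 q.2)) :
    ContDiff ℝ ∞ (fun q : ℝ × ℝ => f q.2 q.1) :=
  hf.comp (contDiff_snd.prodMk contDiff_fst)

theorem hasDerivAt_curry' {f : ℝ → ℝ → F} (hf : ContDiff ℝ ∞ (fun q : ℝ × ℝ => f q.1 q.2))
    (s x : ℝ) : HasDerivAt (fun r => f r x) (deriv (fun r => f r x) s) s :=
  (hasDerivAt_curry (f := fun x r => f r x) (contDiff_swap hf) x s).differentiableAt.hasDerivAt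

theorem deriv_curry_eq {f : ℝ → ℝ → F} (hf : ContDiff ℝ ∞ (fun q : ℝ × ℝ => f q.1 q.2))
    (s x : ℝ) : deriv (fun r => f r x) s = fderiv ℝ (fun q : ℝ × ℝ => f q.1 q.2) (s, x) (1, 0) := by
  have h := (hf.differentiable (by simp) (s, x)).hasFDerivAt.comp_hasDerivAt s
    ((hasDerivAt_id s).prodMk (hasDerivAt_const s x))
  exact h.deriv

theorem deriv_deriv_comm {f : ℝ → ℝ → F} (hf : ContDiff ℝ ∞ (fun q : ℝ × ℝ => f q.1 q.2))
    (s x : ℝ) :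
    deriv (fun r => deriv (f r) x) s = deriv (fun y => deriv (fun r => f r y) s) x := by
  set Φ : ℝ × ℝ → F := fun q : ℝ × ℝ => f q.1 q.2 with hΦ
  have hf' : ContDiff ℝ ∞ (fderiv ℝ Φ) := hf.fderiv_right le_rfl
  have h1 : (fun r => deriv (f r) x) = fun r => fderiv ℝ Φ (r, x) (0, 1) :=
    funext fun r => (hasDerivAt_curry hf r x).deriv
  have h2 : (fun y => deriv (fun r => f r y) s) = fun y => fderiv ℝ Φ (s, y) (1, 0) :=
    funext fun y => deriv_curry_eq hf s y
  rw [h1, h2]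
  have hd : HasFDerivAt (fderiv ℝ Φ) (fderiv ℝ (fderiv ℝ Φ) (s, x)) (s, x) :=
    (hf'.differentiable (by simp) (s, x)).hasFDerivAt
  have c1 : HasDerivAt (fun r => fderiv ℝ Φ (r, x)) (fderiv ℝ (fderiv ℝ Φ) (s, x) (1, 0)) s :=
    hd.comp_hasDerivAt s ((hasDerivAt_id s).prodMk (hasDerivAt_const s x))
  have c2 : HasDerivAt (fun y => fderiv ℝ Φ (s, y)) (fderiv ℝ (fderiv ℝ Φ) (s, x) (0, 1)) x :=
    hd.comp_hasDerivAt x ((hasDerivAt_const x s).prodMk (hasDerivAt_id x))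
  have e1 := (c1.clm_apply (hasDerivAt_const s ((0 : ℝ), (1 : ℝ)))).deriv
  have e2 := (c2.clm_apply (hasDerivAt_const x ((1 : ℝ), (0 : ℝ)))).deriv
  rw [e1, e2, map_zero, add_zero, add_zero]
  exact (hf.contDiffAt.isSymmSndFDerivAt (by simpa using ENat.LEInfty.out)).eq _ _

theorem hasDerivAt_intervalIntegral {f : ℝ → ℝ → F}
    (hf : ContDiff ℝ ∞ (fun q : ℝ × ℝ => f q.1 q.2)) (a b s : ℝ) :
    HasDerivAt (fun r => ∫ x in a..b, f r x) (∫ x in a..b, deriv (fun r => f r x) s) s := by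
  have h := (hasFDerivAt_intervalIntegral (hf.of_le (by simp)) a b s).hasDerivAt
  convert h using 1
  rw [ContinuousLinearMap.intervalIntegral_apply]
  · refine intervalIntegral.integral_congr fun x _ => ?_
    exact deriv_curry_eq hf s x
  · refine Continuous.intervalIntegrable ?_ _ _
    refine Continuous.clm_comp ?_ continuous_const
    exact (hf.continuous_fderiv (by simp)).comp (by fun_prop)

theorem periodic_deriv {T : ℝ} {f : ℝ → F} (hp : Function.Periodic f T) :
    Function.Periodic (deriv f) T := fun x => by
  rw [← deriv_comp_add_const]
  congr 1
  exact funext hp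

theorem eq_zero_of_integral_eq_zero {T : ℝ} (hT : 0 < T) {f : ℝ → ℝ} (hf : Continuous f)
    (hp : Function.Periodic f T) (hn : ∀ x, 0 ≤ f x) (h : ∫ x in (0 : ℝ)..T, f x = 0) (x : ℝ) :
    f x = 0 := by
  have h0 : ∀ y ∈ Set.Icc 0 T, f y = 0 := by
    intro y hy
    by_contra hne
    have := intervalIntegral.integral_pos hT hf.continuousOn (fun y _ => hn y)
      ⟨y, hy, lt_of_le_of_ne (hn y) (Ne.symm hne)⟩
    exact this.ne' h
  obtain ⟨y, hy, hxy⟩ := hp.exists_mem_Ico₀ hT x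
  rw [hxy]
  exact h0 y ⟨hy.1, hy.2.le⟩

end Calculus

/-! ### Smooth families of periodic functions. -/

section SmoothPeriodic

variable {E E' F : Type} [NormedAddCommGroup E] [NormedSpace ℝ E]
  [NormedAddCommGroup E'] [NormedSpace ℝ E'] [NormedAddCommGroup F] [NormedSpace ℝ F]

/-- Jointly smooth families of `T`-periodic functions. -/
structure SmoothPeriodic (T : ℝ) (p : E → ℝ → F) : Prop where
  contDiff : ContDiff ℝ ∞ (fun q : E × ℝ => p q.1 q.2)
  periodic : ∀ s, Function.Periodic (p s) T

namespace SmoothPeriodic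

variable {T : ℝ}

theorem loop {p : E → ℝ → F} (hp : SmoothPeriodic T p) (s : E) : ContDiff ℝ ∞ (p s) :=
  hp.contDiff.comp (contDiff_const.prodMk contDiff_id)

theorem mem_loops {p : E → ℝ → F} (hp : SmoothPeriodic T p) (s : E) :
    p s ∈ loops T Set.univ :=
  ⟨hp.loop s, hp.periodic s, fun _ => trivial⟩

theorem of_loop {k : ℝ → F} {S : Set F} (hk : k ∈ loops T S) :
    SmoothPeriodic T (fun _ : E => k) :=
  ⟨hk.1.comp contDiff_snd, fun _ => hk.2.1⟩

theorem comp {p : E → ℝ → F} (hp : SmoothPeriodic T p) {φ : E' → E} (hφ : ContDiff ℝ ∞ φ) :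
    SmoothPeriodic T (fun s => p (φ s)) :=
  ⟨hp.contDiff.comp ((hφ.comp contDiff_fst).prodMk contDiff_snd), fun s => hp.periodic (φ s)⟩

theorem const (c : F) : SmoothPeriodic T (fun (_ : E) (_ : ℝ) => c) :=
  ⟨contDiff_const, fun _ _ => rfl⟩

theorem param {φ : E → F} (hφ : ContDiff ℝ ∞ φ) : SmoothPeriodic T (fun s (_ : ℝ) => φ s) :=
  ⟨hφ.comp contDiff_fst, fun _ _ => rfl⟩

theorem add {p q : E → ℝ → F} (hp : SmoothPeriodic T p) (hq : SmoothPeriodic T q) :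
    SmoothPeriodic T (fun s x => p s x + q s x) :=
  ⟨hp.contDiff.add hq.contDiff, fun s x => by simp only [hp.periodic s x, hq.periodic s x]⟩

theorem sub {p q : E → ℝ → F} (hp : SmoothPeriodic T p) (hq : SmoothPeriodic T q) :
    SmoothPeriodic T (fun s x => p s x - q s x) :=
  ⟨hp.contDiff.sub hq.contDiff, fun s x => by simp only [hp.periodic s x, hq.periodic s x]⟩

theorem neg {p : E → ℝ → F} (hp : SmoothPeriodic T p) : SmoothPeriodic T (fun s x => -p s x) :=
  ⟨hp.contDiff.neg, fun s x => by simp only [hp.periodic s x]⟩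

theorem smul {p : E → ℝ → ℝ} {q : E → ℝ → F} (hp : SmoothPeriodic T p)
    (hq : SmoothPeriodic T q) : SmoothPeriodic T (fun s x => p s x • q s x) :=
  ⟨hp.contDiff.smul hq.contDiff, fun s x => by simp only [hp.periodic s x, hq.periodic s x]⟩

theorem mul {p q : E → ℝ → ℝ} (hp : SmoothPeriodic T p) (hq : SmoothPeriodic T q) :
    SmoothPeriodic T (fun s x => p s x * q s x) :=
  hp.smul hq

theorem const_mul {q : E → ℝ → ℝ} (c : ℝ) (hq : SmoothPeriodic T q) :
    SmoothPeriodic T (fun s x => c * q s x) :=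
  (const c).mul hq

theorem const_smul {q : E → ℝ → F} (c : ℝ) (hq : SmoothPeriodic T q) :
    SmoothPeriodic T (fun s x => c • q s x) :=
  (const c).smul hq

theorem inv {p : E → ℝ → ℝ} (hp : SmoothPeriodic T p) (h0 : ∀ s x, p s x ≠ 0) :
    SmoothPeriodic T (fun s x => (p s x)⁻¹) :=
  ⟨hp.contDiff.inv fun q => h0 q.1 q.2, fun s x => by simp only [hp.periodic s x]⟩

theorem div {p q : E → ℝ → ℝ} (hp : SmoothPeriodic T p) (hq : SmoothPeriodic T q)
    (h0 : ∀ s x, q s x ≠ 0) : SmoothPeriodic T (fun s x => p s x / q s x) := by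
  simpa only [div_eq_mul_inv] using hp.mul (hq.inv h0)

theorem sqrt {p : E → ℝ → ℝ} (hp : SmoothPeriodic T p) (h0 : ∀ s x, p s x ≠ 0) :
    SmoothPeriodic T (fun s x => Real.sqrt (p s x)) :=
  ⟨hp.contDiff.sqrt fun q => h0 q.1 q.2, fun s x => by simp only [hp.periodic s x]⟩

theorem deriv {p : E → ℝ → F} (hp : SmoothPeriodic T p) :
    SmoothPeriodic T (fun s x => deriv (p s) x) :=
  ⟨contDiff_deriv_curry hp.contDiff, fun s => periodic_deriv (hp.periodic s)⟩

/-- Covers both derivatives in an auxiliary parameter that occur later: at a fixed value (second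
variations) and at a value that varies with the family (velocities along rays). -/
theorem paramDeriv {p : E → ℝ → ℝ → F}
    (hp : SmoothPeriodic T (fun (q : E × ℝ) x => p q.1 q.2 x)) {φ : E → ℝ} (hφ : ContDiff ℝ ∞ φ) :
    SmoothPeriodic T (fun s x => _root_.deriv (fun t => p s t x) (φ s)) := by
  constructor
  · have h : ContDiff ℝ ∞ (fun q : (E × ℝ) × ℝ => p q.1.1 q.2 q.1.2) :=
      hp.contDiff.comp (((contDiff_fst.comp contDiff_fst).prodMk contDiff_snd).prodMk
        (contDiff_snd.comp contDiff_fst))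
    exact (contDiff_deriv_curry (f := fun (q : E × ℝ) t => p q.1 t q.2) h).comp
      (contDiff_id.prodMk (hφ.comp contDiff_fst))
  · intro s x
    have h : ∀ t, p s t (x + T) = p s t x := fun t => hp.periodic (s, t) x
    simp only [h]

theorem derivParam {p : ℝ → ℝ → F} (hp : SmoothPeriodic T p) :
    SmoothPeriodic T (fun s x => _root_.deriv (fun r => p r x) s) :=
  paramDeriv (p := fun _ : ℝ => p) (hp.comp contDiff_snd) contDiff_id

theorem pi {ι : Type} [Fintype ι] {p : E → ℝ → ι → F}
    (hp : ∀ i, SmoothPeriodic T (fun s x => p s x i)) : SmoothPeriodic T p :=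
  ⟨contDiff_pi.2 fun i => (hp i).contDiff, fun s x => funext fun i => (hp i).periodic s x⟩

theorem apply {ι : Type} [Fintype ι] {p : E → ℝ → ι → F} (hp : SmoothPeriodic T p) (i : ι) :
    SmoothPeriodic T (fun s x => p s x i) :=
  ⟨contDiff_pi.1 hp.contDiff i, fun s x => congrFun (hp.periodic s x) i⟩

theorem sum {ι : Type} {A : Finset ι} {p : ι → E → ℝ → F}
    (hp : ∀ i, SmoothPeriodic T (p i)) : SmoothPeriodic T (fun s x => ∑ i ∈ A, p i s x) :=
  ⟨ContDiff.sum fun i _ => (hp i).contDiff, fun s x =>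
    Finset.sum_congr rfl fun i _ => (hp i).periodic s x⟩

theorem dot {m : ℕ} {u v : E → ℝ → Fin m → ℝ} (hu : SmoothPeriodic T u)
    (hv : SmoothPeriodic T v) : SmoothPeriodic T (fun s x => u s x ⬝ᵥ v s x) :=
  sum fun i => (hu.apply i).mul (hv.apply i)

theorem hasDerivAt {p : ℝ → ℝ → F} (hp : SmoothPeriodic T p) (s x : ℝ) :
    HasDerivAt (fun r => p r x) (_root_.deriv (fun r => p r x) s) s :=
  hasDerivAt_curry' hp.contDiff s x

theorem hasDerivAt_loop {p : E → ℝ → F} (hp : SmoothPeriodic T p) (s : E) (x : ℝ) :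
    HasDerivAt (p s) (_root_.deriv (p s) x) x :=
  (hasDerivAt_curry hp.contDiff s x).differentiableAt.hasDerivAt

theorem intervalIntegrable {p : E → ℝ → F} (hp : SmoothPeriodic T p) (s : E) (a b : ℝ) :
    IntervalIntegrable (p s) MeasureTheory.volume a b :=
  (hp.loop s).continuous.intervalIntegrable _ _

theorem hasDerivAt_integral {p : ℝ → ℝ → F} (hp : SmoothPeriodic T p) (s : ℝ) :
    HasDerivAt (fun r => ∫ x in (0 : ℝ)..T, p r x)
      (∫ x in (0 : ℝ)..T, _root_.deriv (fun r => p r x) s) s :=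
  hasDerivAt_intervalIntegral hp.contDiff 0 T s

end SmoothPeriodic

theorem isSmoothFamily_loops_iff {T : ℝ} {S : Set F} {p : E → ℝ → F} :
    IsSmoothFamily (loops T S) p ↔ SmoothPeriodic T p ∧ ∀ s x, p s x ∈ S :=
  ⟨fun h => ⟨⟨h.1, fun s => (h.2 s).2.1⟩, fun s => (h.2 s).2.2⟩,
    fun h => ⟨h.1.contDiff, fun s => ⟨h.1.loop s, h.1.periodic s, h.2 s⟩⟩⟩

theorem hasDerivAt_dotProduct {m : ℕ} {u v : ℝ → Fin m → ℝ} {u' v' : Fin m → ℝ} {s : ℝ}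
    (hu : HasDerivAt u u' s) (hv : HasDerivAt v v' s) :
    HasDerivAt (fun r => u r ⬝ᵥ v r) (u' ⬝ᵥ v s + u s ⬝ᵥ v') s := by
  simp only [dotProduct, ← Finset.sum_add_distrib]
  exact HasDerivAt.fun_sum fun i _ => (hasDerivAt_pi.1 hu i).mul (hasDerivAt_pi.1 hv i)

theorem deriv_apply {m : ℕ} {u : ℝ → Fin m → ℝ} {s : ℝ} (hu : DifferentiableAt ℝ u s) (i : Fin m) :
    deriv u s i = deriv (fun r => u r i) s :=
  (hasDerivAt_pi.1 hu.hasDerivAt i).deriv.symm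

/-- `HasVarDeriv` tests smoothness only on the parameter spaces `Fin n → ℝ`. A linear isomorphism
extends it to all finite-dimensional ones, in particular to products `E × ℝ`, where a parameter is
added. -/
theorem LoopSpace.HasVarDeriv.isSmoothFamily [FiniteDimensional ℝ E] {V : Type}
    [NormedAddCommGroup V] [NormedSpace ℝ V]
    {M : LoopSpace V} {h : (ℝ → V) → ℝ} {δ : (ℝ → V) → ℝ → V} (hδ : M.HasVarDeriv h δ)
    {p : E → ℝ → V} (hp : IsSmoothFamily M.carrier p) :
    IsSmoothFamily (loops M.T M.cov) (fun s => δ (p s)) := by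
  let e : E ≃L[ℝ] (Fin (Module.finrank ℝ E) → ℝ) :=
    ContinuousLinearEquiv.ofFinrankEq (by simp)
  have h1 := hδ.smooth _ (fun t => p (e.symm t))
    ⟨hp.1.comp ((e.symm.contDiff.comp contDiff_fst).prodMk contDiff_snd), fun s => hp.2 _⟩
  refine ⟨?_, fun s => by simpa using h1.2 (e s)⟩
  have := h1.1.comp ((e.contDiff.comp contDiff_fst).prodMk contDiff_snd :
    ContDiff ℝ ∞ fun q : E × ℝ => (e q.1, q.2))
  simpa [Function.comp_def] using this

theorem LoopSpace.IsSmooth.hasVarDeriv {V : Type} [NormedAddCommGroup V] [NormedSpace ℝ V]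
    {M : LoopSpace V} {h : (ℝ → V) → ℝ} (hs : M.IsSmooth h) : M.HasVarDeriv h (M.varDeriv h) := by
  rw [LoopSpace.varDeriv, dif_pos hs]
  exact Classical.choose_spec hs

end SmoothPeriodic

/-! ### Hamiltonian operators and their Poisson brackets. -/

section Poisson

variable {m : ℕ} {T : ℝ} {S : Set (Fin m → ℝ)}

/-- Loops with values in `S`, with the `L²` pairing. -/
def dotLoopSpace (T : ℝ) (S : Set (Fin m → ℝ)) : LoopSpace (Fin m → ℝ) where
  T := T
  carrier := loops T S
  cov := Set.univ
  pairing := fun v w => v ⬝ᵥ w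

/-- The directions `w` along which a loop in `S` can be moved arbitrarily far. -/
def IsAdmissible (S : Set (Fin m → ℝ)) (w : ℝ → Fin m → ℝ) : Prop :=
  ∀ y ∈ S, ∀ t x : ℝ, y + t • w x ∈ S

/-- The derivative at `k` in the direction `w` of a map `δ` between function spaces. -/
def hess (δ : (ℝ → Fin m → ℝ) → ℝ → Fin m → ℝ) (k w : ℝ → Fin m → ℝ) (x : ℝ) : Fin m → ℝ :=
  deriv (fun t : ℝ => δ (fun y => k y + t • w y) x) 0

theorem deriv_smul_const_right {F : Type*} [NormedAddCommGroup F] [NormedSpace ℝ F] (c : F)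
    (s : ℝ) : deriv (fun t : ℝ => t • c) s = c := by
  simpa using ((hasDerivAt_id s).smul_const c).deriv

theorem intervalIntegrable_dot {u v : ℝ → Fin m → ℝ} (hu : u ∈ loops T Set.univ)
    (hv : v ∈ loops T Set.univ) (a b : ℝ) :
    IntervalIntegrable (fun x => u x ⬝ᵥ v x) MeasureTheory.volume a b :=
  ((SmoothPeriodic.of_loop (E := ℝ) hu).dot (SmoothPeriodic.of_loop hv)).intervalIntegrable 0 a b

section Functional

variable {h : (ℝ → Fin m → ℝ) → ℝ} {δ : (ℝ → Fin m → ℝ) → ℝ → Fin m → ℝ}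
  {E : Type} [NormedAddCommGroup E] [NormedSpace ℝ E] [FiniteDimensional ℝ E]

theorem smoothPeriodic_varDeriv (hδ : (dotLoopSpace T S).HasVarDeriv h δ) {p : E → ℝ → Fin m → ℝ}
    (hp : SmoothPeriodic T p) (hS : ∀ s x, p s x ∈ S) :
    SmoothPeriodic T (fun s => δ (p s)) :=
  (isSmoothFamily_loops_iff.1 (hδ.isSmoothFamily (isSmoothFamily_loops_iff.2 ⟨hp, hS⟩))).1

theorem varDeriv_mem_loops (hδ : (dotLoopSpace T S).HasVarDeriv h δ) {k : ℝ → Fin m → ℝ}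
    (hk : k ∈ loops T S) : δ k ∈ loops T Set.univ :=
  (smoothPeriodic_varDeriv hδ (SmoothPeriodic.of_loop (E := ℝ) hk) fun _ => hk.2.2).mem_loops 0

theorem hasDerivAt_functional (hδ : (dotLoopSpace T S).HasVarDeriv h δ) {γ : ℝ → ℝ → Fin m → ℝ}
    (hγ : SmoothPeriodic T γ) (hS : ∀ s x, γ s x ∈ S) (s : ℝ) :
    HasDerivAt (fun r => h (γ r))
      (∫ x in (0 : ℝ)..T, δ (γ s) x ⬝ᵥ deriv (fun r => γ r x) s) s :=
  hδ.hasDerivAt γ (isSmoothFamily_loops_iff.2 ⟨hγ, hS⟩) s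

theorem hasVarDeriv_of (h1 : ∀ (n : ℕ) (p : (Fin n → ℝ) → ℝ → Fin m → ℝ), SmoothPeriodic T p →
      (∀ s x, p s x ∈ S) → SmoothPeriodic T (fun s => δ (p s)))
    (h2 : ∀ γ : ℝ → ℝ → Fin m → ℝ, SmoothPeriodic T γ → (∀ s x, γ s x ∈ S) → ∀ s,
      HasDerivAt (fun r => h (γ r))
        (∫ x in (0 : ℝ)..T, δ (γ s) x ⬝ᵥ deriv (fun r => γ r x) s) s) :
    (dotLoopSpace T S).HasVarDeriv h δ where
  smooth n p hp := by
    obtain ⟨hp, hS⟩ := isSmoothFamily_loops_iff.1 hp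
    exact isSmoothFamily_loops_iff.2 ⟨h1 n p hp hS, fun _ _ => trivial⟩
  hasDerivAt γ hγ := by
    obtain ⟨hγ, hS⟩ := isSmoothFamily_loops_iff.1 hγ
    exact h2 γ hγ hS

/-- A variational derivative gives only derivatives along curves. Integrating along the ray `t ↦ p
(t • s)` expresses `h (p s) - h (p 0)` as a double integral of a jointly smooth function, hence
joint smoothness in `s`. -/
theorem contDiff_functional (hδ : (dotLoopSpace T S).HasVarDeriv h δ) {p : E → ℝ → Fin m → ℝ}
    (hp : SmoothPeriodic T p) (hS : ∀ s x, p s x ∈ S) : ContDiff ℝ ∞ (fun s => h (p s)) := by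
  have hq : SmoothPeriodic T (fun (q : E × ℝ) => p (q.2 • q.1)) :=
    hp.comp (contDiff_snd.smul contDiff_fst)
  have h1 : SmoothPeriodic T (fun (q : E × ℝ) => δ (p (q.2 • q.1))) :=
    smoothPeriodic_varDeriv hδ hq fun _ => hS _
  have h2 : SmoothPeriodic T (fun (q : E × ℝ) x => deriv (fun r : ℝ => p (r • q.1) x) q.2) :=
    SmoothPeriodic.paramDeriv (p := fun (q : E × ℝ) t => p (t • q.1))
      (hp.comp (contDiff_snd.smul (contDiff_fst.comp contDiff_fst))) contDiff_snd
  have h3 := contDiff_intervalIntegral (h1.dot h2).contDiff 0 T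
  have h4 := contDiff_intervalIntegral h3 0 1
  have key : (fun s => h (p s)) = fun s => h (p 0) + ∫ t in (0 : ℝ)..1, ∫ x in (0 : ℝ)..T,
      δ (p (t • s)) x ⬝ᵥ deriv (fun r : ℝ => p (r • s) x) t := by
    funext s
    have hd : ∀ t ∈ Set.uIcc (0 : ℝ) 1, HasDerivAt (fun r : ℝ => h (p (r • s)))
        (∫ x in (0 : ℝ)..T, δ (p (t • s)) x ⬝ᵥ deriv (fun r : ℝ => p (r • s) x) t) t :=
      fun t _ => hasDerivAt_functional hδ
        (hp.comp (contDiff_id.smul contDiff_const)) (fun _ => hS _) t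
    rw [intervalIntegral.integral_eq_sub_of_hasDerivAt hd]
    · simp
    · exact (h3.continuous.comp (by fun_prop : Continuous fun t : ℝ => (s, t))).intervalIntegrable _ _
  rw [key]
  exact contDiff_const.add h4

theorem smoothPeriodic_hess {p w : E → ℝ → Fin m → ℝ} (hδ : (dotLoopSpace T S).HasVarDeriv h δ)
    (hp : SmoothPeriodic T p) (hS : ∀ s x, p s x ∈ S) (hw : SmoothPeriodic T w)
    (hwS : ∀ s, IsAdmissible S (w s)) : SmoothPeriodic T (fun s => hess δ (p s) (w s)) :=
  SmoothPeriodic.paramDeriv (p := fun s t => δ (fun y => p s y + t • w s y))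
    (smoothPeriodic_varDeriv hδ (E := E × ℝ)
      ((hp.comp contDiff_fst).add ((SmoothPeriodic.param contDiff_snd).smul (hw.comp contDiff_fst)))
      fun q x => hwS q.1 _ (hS q.1 x) _ _) contDiff_const

theorem hasDerivAt_line (hδ : (dotLoopSpace T S).HasVarDeriv h δ) {k w : ℝ → Fin m → ℝ}
    (hk : k ∈ loops T S) (hw : w ∈ loops T Set.univ) (hwS : IsAdmissible S w) :
    HasDerivAt (fun t : ℝ => h (fun x => k x + t • w x)) (∫ x in (0 : ℝ)..T, δ k x ⬝ᵥ w x) 0 := by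
  have := hasDerivAt_functional hδ (γ := fun t x => k x + t • w x)
    ((SmoothPeriodic.of_loop hk).add ((SmoothPeriodic.param contDiff_id).smul
      (SmoothPeriodic.of_loop hw))) (fun s x => hwS _ (hk.2.2 x) _ _) 0
  simpa [deriv_smul_const_right] using this

/-- Both sides are the mixed second derivative of `(r, t) ↦ h (γ r + t w)` at `(s, 0)`, taken in the
two orders. Only `w` must be admissible; the velocity of `γ` is arbitrary, as is needed for
differentiating a bracket along an arbitrary curve. -/
theorem hess_symm (hδ : (dotLoopSpace T S).HasVarDeriv h δ) {γ : ℝ → ℝ → Fin m → ℝ}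
    (hγ : SmoothPeriodic T γ) (hS : ∀ s x, γ s x ∈ S) {w : ℝ → Fin m → ℝ}
    (hw : w ∈ loops T Set.univ) (hwS : IsAdmissible S w) (s : ℝ) :
    ∫ x in (0 : ℝ)..T, deriv (fun r => δ (γ r) x) s ⬝ᵥ w x =
      ∫ x in (0 : ℝ)..T, hess δ (γ s) w x ⬝ᵥ deriv (fun r => γ r x) s := by
  have hp : SmoothPeriodic T (fun (q : ℝ × ℝ) x => γ q.1 x + q.2 • w x) :=
    (hγ.comp contDiff_fst).add ((SmoothPeriodic.param contDiff_snd).smul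
      (SmoothPeriodic.of_loop hw))
  have hpS : ∀ (q : ℝ × ℝ) x, γ q.1 x + q.2 • w x ∈ S := fun q x => hwS _ (hS q.1 x) _ _
  have hc := deriv_deriv_comm (f := fun r t => h (fun x => γ r x + t • w x))
    (contDiff_functional hδ hp hpS) s 0
  have e1 : (fun r => deriv (fun t : ℝ => h (fun x => γ r x + t • w x)) 0) =
      fun r => ∫ x in (0 : ℝ)..T, δ (γ r) x ⬝ᵥ w x :=
    funext fun r => (hasDerivAt_line hδ ⟨hγ.loop r, hγ.periodic r, hS r⟩ hw hwS).deriv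
  have e2 : (fun t : ℝ => deriv (fun r => h (fun x => γ r x + t • w x)) s) =
      fun t => ∫ x in (0 : ℝ)..T, δ (fun x => γ s x + t • w x) x ⬝ᵥ deriv (fun r => γ r x) s := by
    funext t
    have := hasDerivAt_functional hδ (γ := fun r x => γ r x + t • w x)
      (hp.comp (contDiff_id.prodMk contDiff_const)) (fun r x => hpS (r, t) x) s
    simpa using this.deriv
  rw [e1, e2] at hc
  have hδγ := smoothPeriodic_varDeriv hδ hγ hS
  have hδt : SmoothPeriodic T (fun t : ℝ => δ (fun x => γ s x + t • w x)) :=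
    smoothPeriodic_varDeriv hδ (hp.comp (contDiff_const.prodMk contDiff_id)) fun t x => hpS (s, t) x
  rw [((hδγ.dot (SmoothPeriodic.of_loop hw)).hasDerivAt_integral s).deriv,
    ((hδt.dot
      (SmoothPeriodic.of_loop (hγ.derivParam.mem_loops s))).hasDerivAt_integral 0).deriv] at hc
  convert hc using 3 with x x
  · rw [(hasDerivAt_dotProduct (hδγ.hasDerivAt s x) (hasDerivAt_const s (w x))).deriv]
    simp
  · rw [(hasDerivAt_dotProduct (hδt.hasDerivAt 0 x) (hasDerivAt_const 0 _)).deriv]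
    simp [hess]

theorem hess_symm_line (hδ : (dotLoopSpace T S).HasVarDeriv h δ) {k v w : ℝ → Fin m → ℝ}
    (hk : k ∈ loops T S) (hv : v ∈ loops T Set.univ) (hvS : IsAdmissible S v)
    (hw : w ∈ loops T Set.univ) (hwS : IsAdmissible S w) :
    ∫ x in (0 : ℝ)..T, hess δ k v x ⬝ᵥ w x = ∫ x in (0 : ℝ)..T, hess δ k w x ⬝ᵥ v x := by
  have := hess_symm hδ (γ := fun t x => k x + t • v x)
    ((SmoothPeriodic.of_loop hk).add ((SmoothPeriodic.param contDiff_id).smul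
      (SmoothPeriodic.of_loop hv))) (fun s x => hvS _ (hk.2.2 x) _ _) hw hwS 0
  simpa [hess, deriv_smul_const_right] using this

theorem hasVarDeriv_smul_add {h h' : (ℝ → Fin m → ℝ) → ℝ} {δ δ' : (ℝ → Fin m → ℝ) → ℝ → Fin m → ℝ}
    (a : ℝ) (hδ : (dotLoopSpace T S).HasVarDeriv h δ) (hδ' : (dotLoopSpace T S).HasVarDeriv h' δ') :
    (dotLoopSpace T S).HasVarDeriv (a • h + h') (fun k x => a • δ k x + δ' k x) := by
  refine hasVarDeriv_of (fun n p hp hS => ?_) fun γ hγ hS s => ?_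
  · exact ((smoothPeriodic_varDeriv hδ hp hS).const_smul a).add
      (smoothPeriodic_varDeriv hδ' hp hS)
  · have d := (smoothPeriodic_varDeriv hδ hγ hS).mem_loops s
    have d' := (smoothPeriodic_varDeriv hδ' hγ hS).mem_loops s
    have l' := hγ.derivParam.mem_loops s
    refine HasDerivAt.congr_deriv (((hasDerivAt_functional hδ hγ hS s).const_mul a).add
      (hasDerivAt_functional hδ' hγ hS s)) (Eq.symm ?_)
    simp only [add_dotProduct, smul_dotProduct, smul_eq_mul]
    rw [intervalIntegral.integral_add ((intervalIntegrable_dot d l' _ _).const_mul a)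
      (intervalIntegrable_dot d' l' _ _), intervalIntegral.integral_const_mul]

theorem hasVarDeriv_mul {h h' : (ℝ → Fin m → ℝ) → ℝ} {δ δ' : (ℝ → Fin m → ℝ) → ℝ → Fin m → ℝ}
    (hδ : (dotLoopSpace T S).HasVarDeriv h δ) (hδ' : (dotLoopSpace T S).HasVarDeriv h' δ') :
    (dotLoopSpace T S).HasVarDeriv (h * h') (fun k x => h' k • δ k x + h k • δ' k x) := by
  refine hasVarDeriv_of (fun n p hp hS => ?_) fun γ hγ hS s => ?_
  · exact ((SmoothPeriodic.param (contDiff_functional hδ' hp hS)).smul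
        (smoothPeriodic_varDeriv hδ hp hS)).add
        ((SmoothPeriodic.param (contDiff_functional hδ hp hS)).smul
        (smoothPeriodic_varDeriv hδ' hp hS))
  · have d := (smoothPeriodic_varDeriv hδ hγ hS).mem_loops s
    have d' := (smoothPeriodic_varDeriv hδ' hγ hS).mem_loops s
    have l' := hγ.derivParam.mem_loops s
    refine HasDerivAt.congr_deriv ((hasDerivAt_functional hδ hγ hS s).mul
      (hasDerivAt_functional hδ' hγ hS s)) (Eq.symm ?_)
    simp only [add_dotProduct, smul_dotProduct, smul_eq_mul]
    rw [intervalIntegral.integral_add ((intervalIntegrable_dot d l' _ _).const_mul _)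
      ((intervalIntegrable_dot d' l' _ _).const_mul _), intervalIntegral.integral_const_mul,
      intervalIntegral.integral_const_mul]
    ring

end Functional

/-- Skew-adjoint operators `P k`, depending smoothly on `k` with derivative `P'` and with `R` the
adjoint of this derivative, that satisfy the Jacobi identity. -/
structure IsHamiltonian (T : ℝ) (S : Set (Fin m → ℝ))
    (P : (ℝ → Fin m → ℝ) → (ℝ → Fin m → ℝ) → ℝ → Fin m → ℝ)
    (P' R : (ℝ → Fin m → ℝ) → (ℝ → Fin m → ℝ) → (ℝ → Fin m → ℝ) → ℝ → Fin m → ℝ) : Prop where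
  smooth : ∀ {E : Type} [NormedAddCommGroup E] [NormedSpace ℝ E] [FiniteDimensional ℝ E]
    (p v : E → ℝ → Fin m → ℝ), SmoothPeriodic T p → (∀ s x, p s x ∈ S) → SmoothPeriodic T v →
    SmoothPeriodic T (fun s => P (p s) (v s))
  smooth_adj : ∀ {E : Type} [NormedAddCommGroup E] [NormedSpace ℝ E] [FiniteDimensional ℝ E]
    (p u v : E → ℝ → Fin m → ℝ), SmoothPeriodic T p → (∀ s x, p s x ∈ S) → SmoothPeriodic T u →
    SmoothPeriodic T v → SmoothPeriodic T (fun s => R (p s) (u s) (v s))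
  admissible : ∀ k ∈ loops T S, ∀ v ∈ loops T Set.univ, IsAdmissible S (P k v)
  skew : ∀ k ∈ loops T S, ∀ u ∈ loops T Set.univ, ∀ v ∈ loops T Set.univ,
    ∫ x in (0 : ℝ)..T, u x ⬝ᵥ P k v x = -∫ x in (0 : ℝ)..T, v x ⬝ᵥ P k u x
  hasDerivAt : ∀ γ v : ℝ → ℝ → Fin m → ℝ, SmoothPeriodic T γ → (∀ s x, γ s x ∈ S) →
    SmoothPeriodic T v → ∀ s x, HasDerivAt (fun r => P (γ r) (v r) x)
      (P (γ s) (fun y => deriv (fun r => v r y) s) x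
        + P' (γ s) (v s) (fun y => deriv (fun r => γ r y) s) x) s
  adj : ∀ k ∈ loops T S, ∀ u ∈ loops T Set.univ, ∀ v ∈ loops T Set.univ, ∀ w ∈ loops T Set.univ,
    ∫ x in (0 : ℝ)..T, u x ⬝ᵥ P' k v w x = ∫ x in (0 : ℝ)..T, R k u v x ⬝ᵥ w x
  jacobi : ∀ k ∈ loops T S, ∀ u ∈ loops T Set.univ, ∀ v ∈ loops T Set.univ,
    ∀ w ∈ loops T Set.univ, ∫ x in (0 : ℝ)..T,
      (R k u v x ⬝ᵥ P k w x + R k v w x ⬝ᵥ P k u x + R k w u x ⬝ᵥ P k v x) = 0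

namespace IsHamiltonian

variable {P : (ℝ → Fin m → ℝ) → (ℝ → Fin m → ℝ) → ℝ → Fin m → ℝ}
  {P' R : (ℝ → Fin m → ℝ) → (ℝ → Fin m → ℝ) → (ℝ → Fin m → ℝ) → ℝ → Fin m → ℝ}

theorem mem_loops (hP : IsHamiltonian T S P P' R) {k v : ℝ → Fin m → ℝ} (hk : k ∈ loops T S)
    (hv : v ∈ loops T Set.univ) : P k v ∈ loops T Set.univ :=
  (hP.smooth (E := ℝ) _ _ (SmoothPeriodic.of_loop hk) (fun _ => hk.2.2)
    (SmoothPeriodic.of_loop hv)).mem_loops 0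

theorem adj_mem_loops (hP : IsHamiltonian T S P P' R) {k u v : ℝ → Fin m → ℝ}
    (hk : k ∈ loops T S) (hu : u ∈ loops T Set.univ) (hv : v ∈ loops T Set.univ) :
    R k u v ∈ loops T Set.univ :=
  (hP.smooth_adj (E := ℝ) _ _ _ (SmoothPeriodic.of_loop hk) (fun _ => hk.2.2)
    (SmoothPeriodic.of_loop hu) (SmoothPeriodic.of_loop hv)).mem_loops 0

variable {h f : (ℝ → Fin m → ℝ) → ℝ}

/-- Along a curve, `∫ δf · P δh` changes in three ways. The change of `δf` is turned around by
symmetry of the second variation; that of `δh` likewise after skew-adjointness of `P`, which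
produces the minus sign; that of `P` is rewritten with the adjoint `R`. -/
theorem hasVarDeriv_opBracket (hP : IsHamiltonian T S P P' R)
    (hh : (dotLoopSpace T S).IsSmooth h) (hf : (dotLoopSpace T S).IsSmooth f) :
    (dotLoopSpace T S).HasVarDeriv ((dotLoopSpace T S).opBracket P h f)
      (fun k x =>
        hess ((dotLoopSpace T S).varDeriv f) k (P k ((dotLoopSpace T S).varDeriv h k)) x
        - hess ((dotLoopSpace T S).varDeriv h) k (P k ((dotLoopSpace T S).varDeriv f k)) x
        + R k ((dotLoopSpace T S).varDeriv f k) ((dotLoopSpace T S).varDeriv h k) x) := by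
  have dh := hh.hasVarDeriv
  have df := hf.hasVarDeriv
  refine hasVarDeriv_of (fun n p hp hS => ?_) fun γ hγ hS s => ?_
  · have sh := smoothPeriodic_varDeriv dh hp hS
    have sf := smoothPeriodic_varDeriv df hp hS
    refine ((smoothPeriodic_hess df hp hS (hP.smooth _ _ hp hS sh) fun s => ?_).sub
      (smoothPeriodic_hess dh hp hS (hP.smooth _ _ hp hS sf) fun s => ?_)).add
      (hP.smooth_adj _ _ _ hp hS sf sh)
    · exact hP.admissible _ ⟨hp.loop s, hp.periodic s, hS s⟩ _ (sh.mem_loops s)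
    · exact hP.admissible _ ⟨hp.loop s, hp.periodic s, hS s⟩ _ (sf.mem_loops s)
  · have sh := smoothPeriodic_varDeriv dh hγ hS
    have sf := smoothPeriodic_varDeriv df hγ hS
    have hk : γ s ∈ loops T S := ⟨hγ.loop s, hγ.periodic s, hS s⟩
    have wh := hP.mem_loops hk (sh.mem_loops s)
    have wf := hP.mem_loops hk (sf.mem_loops s)
    have ah := hP.admissible _ hk _ (sh.mem_loops s)
    have af := hP.admissible _ hk _ (sf.mem_loops s)
    have stot := sf.dot (hP.smooth _ _ hγ hS sh)
    have h1 := stot.hasDerivAt_integral s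
    refine HasDerivAt.congr_deriv h1 (Eq.symm ?_)
    have e : ∀ x, deriv (fun r => (dotLoopSpace T S).varDeriv f (γ r) x ⬝ᵥ
        P (γ r) ((dotLoopSpace T S).varDeriv h (γ r)) x) s =
        deriv (fun r => (dotLoopSpace T S).varDeriv f (γ r) x) s ⬝ᵥ
          P (γ s) ((dotLoopSpace T S).varDeriv h (γ s)) x
        + ((dotLoopSpace T S).varDeriv f (γ s) x ⬝ᵥ
          P (γ s) (fun y => deriv (fun r => (dotLoopSpace T S).varDeriv h (γ r) y) s) x
        + (dotLoopSpace T S).varDeriv f (γ s) x ⬝ᵥ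
          P' (γ s) ((dotLoopSpace T S).varDeriv h (γ s)) (fun y => deriv (fun r => γ r y) s) x) := by
      intro x
      rw [(hasDerivAt_dotProduct (sf.hasDerivAt s x) (hP.hasDerivAt _ _ hγ hS sh s x)).deriv,
        dotProduct_add]
    have lf := sf.mem_loops s
    have lf' := sf.derivParam.mem_loops s
    have lh' := sh.derivParam.mem_loops s
    have l' := hγ.derivParam.mem_loops s
    have i3 := hP.adj _ hk _ lf _ (sh.mem_loops s) _ l'
    have i2 := hP.skew _ hk _ lf _ lh'
    rw [hess_symm dh hγ hS wf af] at i2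
    have i1 := hess_symm df hγ hS wh ah s
    -- `IsHamiltonian` asks for no smoothness of `P'`. Writing this term as the total derivative
    -- minus the other two makes its integral split into integrals of smooth functions.
    have e' : ∀ x, (dotLoopSpace T S).varDeriv f (γ s) x ⬝ᵥ P' (γ s)
        ((dotLoopSpace T S).varDeriv h (γ s)) (fun y => deriv (fun r => γ r y) s) x = _ :=
      fun x => (sub_eq_of_eq_add' (sub_eq_of_eq_add' (e x))).symm
    simp only [e'] at i3
    rw [intervalIntegral.integral_sub, intervalIntegral.integral_sub] at i3
    · have g1 := (smoothPeriodic_hess df (E := ℝ) (SmoothPeriodic.of_loop hk) (fun _ => hk.2.2)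
        (SmoothPeriodic.of_loop wh) fun _ => ah).mem_loops 0
      have g2 := (smoothPeriodic_hess dh (E := ℝ) (SmoothPeriodic.of_loop hk) (fun _ => hk.2.2)
        (SmoothPeriodic.of_loop wf) fun _ => af).mem_loops 0
      have g3 := hP.adj_mem_loops hk lf (sh.mem_loops s)
      simp only [add_dotProduct, sub_dotProduct]
      rw [intervalIntegral.integral_add, intervalIntegral.integral_sub]
      · linarith
      · exact intervalIntegrable_dot g1 l' _ _
      · exact intervalIntegrable_dot g2 l' _ _
      · exact (intervalIntegrable_dot g1 l' _ _).sub (intervalIntegrable_dot g2 l' _ _)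
      · exact intervalIntegrable_dot g3 l' _ _
    · exact stot.derivParam.intervalIntegrable s _ _
    · exact intervalIntegrable_dot lf' wh _ _
    · exact (stot.derivParam.intervalIntegrable s _ _).sub (intervalIntegrable_dot lf' wh _ _)
    · exact intervalIntegrable_dot lf (hP.mem_loops hk lh') _ _

/-- `{h, f}` is minus the derivative of `h` along the Hamiltonian vector field of `f`. -/
theorem hasDerivAt_opBracket (hP : IsHamiltonian T S P P' R)
    (hh : (dotLoopSpace T S).IsSmooth h) (hf : (dotLoopSpace T S).IsSmooth f)
    {k : ℝ → Fin m → ℝ} (hk : k ∈ loops T S) :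
    HasDerivAt (fun t : ℝ => h (fun x => k x + t • P k ((dotLoopSpace T S).varDeriv f k) x))
      (-(dotLoopSpace T S).opBracket P h f k) 0 := by
  have sh := varDeriv_mem_loops hh.hasVarDeriv hk
  have sf := varDeriv_mem_loops hf.hasVarDeriv hk
  have := hasDerivAt_line hh.hasVarDeriv hk (hP.mem_loops hk sf) (hP.admissible k hk _ sf)
  rw [hP.skew k hk _ sh _ sf] at this
  exact this

/-- `varDeriv` is an arbitrary choice, so additivity and the Leibniz rule are not read off from
gradients; they hold because `-{h, f}` is a directional derivative of `h`, and derivatives of real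
functions are unique. In the Jacobi sum the six terms with second variations cancel in pairs by
`hess_symm_line`, which leaves the cyclic sum of the terms with `R`. -/
theorem isPoisson (hP : IsHamiltonian T S P P' R) :
    (dotLoopSpace T S).IsPoisson ((dotLoopSpace T S).opBracket P) where
  smooth h f hh hf := ⟨_, hP.hasVarDeriv_opBracket hh hf⟩
  skew h f hh hf k hk :=
    hP.skew k hk _ (varDeriv_mem_loops hf.hasVarDeriv hk) _ (varDeriv_mem_loops hh.hasVarDeriv hk)
  linear a h h' f hh hh' hf k hk := by
    have h1 := hP.hasDerivAt_opBracket ⟨_, hasVarDeriv_smul_add a hh.hasVarDeriv hh'.hasVarDeriv⟩ hf hk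
    have h2 := ((hP.hasDerivAt_opBracket hh hf hk).const_mul a).add
      (hP.hasDerivAt_opBracket hh' hf hk)
    linarith [h1.unique h2]
  leibniz h h' f hh hh' hf k hk := by
    have h1 := hP.hasDerivAt_opBracket ⟨_, hasVarDeriv_mul hh.hasVarDeriv hh'.hasVarDeriv⟩ hf hk
    have h2 := (hP.hasDerivAt_opBracket hh hf hk).mul (hP.hasDerivAt_opBracket hh' hf hk)
    have h3 := h1.unique h2
    simp only [zero_smul, add_zero] at h3
    linarith
  jacobi h f g hh hf hg k hk := by
    have key : ∀ {h f g : (ℝ → Fin m → ℝ) → ℝ}, (dotLoopSpace T S).IsSmooth h →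
        (dotLoopSpace T S).IsSmooth f → (dotLoopSpace T S).IsSmooth g →
        (dotLoopSpace T S).opBracket P ((dotLoopSpace T S).opBracket P h f) g k =
          -((∫ x in (0 : ℝ)..T, hess ((dotLoopSpace T S).varDeriv f) k
              (P k ((dotLoopSpace T S).varDeriv h k)) x ⬝ᵥ P k ((dotLoopSpace T S).varDeriv g k) x)
            - (∫ x in (0 : ℝ)..T, hess ((dotLoopSpace T S).varDeriv h) k
              (P k ((dotLoopSpace T S).varDeriv f k)) x ⬝ᵥ P k ((dotLoopSpace T S).varDeriv g k) x)
            + ∫ x in (0 : ℝ)..T, R k ((dotLoopSpace T S).varDeriv f k)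
              ((dotLoopSpace T S).varDeriv h k) x ⬝ᵥ P k ((dotLoopSpace T S).varDeriv g k) x) := by
      intro h f g hh hf hg
      have lh := varDeriv_mem_loops hh.hasVarDeriv hk
      have lf := varDeriv_mem_loops hf.hasVarDeriv hk
      have lg := varDeriv_mem_loops hg.hasVarDeriv hk
      have wg := hP.mem_loops hk lg
      have d := hP.hasVarDeriv_opBracket hh hf
      have h1 := hP.hasDerivAt_opBracket ⟨_, d⟩ hg hk
      have h2 := hasDerivAt_line d hk wg (hP.admissible k hk _ lg)
      have h3 := h1.unique h2
      have g1 := (smoothPeriodic_hess hf.hasVarDeriv (E := ℝ) (SmoothPeriodic.of_loop hk)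
        (fun _ => hk.2.2) (SmoothPeriodic.of_loop (hP.mem_loops hk lh))
        fun _ => hP.admissible k hk _ lh).mem_loops 0
      have g2 := (smoothPeriodic_hess hh.hasVarDeriv (E := ℝ) (SmoothPeriodic.of_loop hk)
        (fun _ => hk.2.2) (SmoothPeriodic.of_loop (hP.mem_loops hk lf))
        fun _ => hP.admissible k hk _ lf).mem_loops 0
      simp only [add_dotProduct, sub_dotProduct] at h3
      rw [intervalIntegral.integral_add, intervalIntegral.integral_sub] at h3
      · linarith
      · exact intervalIntegrable_dot g1 wg _ _
      · exact intervalIntegrable_dot g2 wg _ _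
      · exact (intervalIntegrable_dot g1 wg _ _).sub (intervalIntegrable_dot g2 wg _ _)
      · exact intervalIntegrable_dot (hP.adj_mem_loops hk lf lh) wg _ _
    have sym : ∀ {h f g : (ℝ → Fin m → ℝ) → ℝ}, (dotLoopSpace T S).IsSmooth h →
        (dotLoopSpace T S).IsSmooth f → (dotLoopSpace T S).IsSmooth g → _ :=
      fun {h f g} hh hf hg => hess_symm_line hh.hasVarDeriv hk
        (hP.mem_loops hk (varDeriv_mem_loops hf.hasVarDeriv hk))
        (hP.admissible k hk _ (varDeriv_mem_loops hf.hasVarDeriv hk))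
        (hP.mem_loops hk (varDeriv_mem_loops hg.hasVarDeriv hk))
        (hP.admissible k hk _ (varDeriv_mem_loops hg.hasVarDeriv hk))
    have lh := varDeriv_mem_loops hh.hasVarDeriv hk
    have lf := varDeriv_mem_loops hf.hasVarDeriv hk
    have lg := varDeriv_mem_loops hg.hasVarDeriv hk
    have j := hP.jacobi k hk _ lf _ lh _ lg
    rw [intervalIntegral.integral_add, intervalIntegral.integral_add] at j
    · rw [key hh hf hg, key hf hg hh, key hg hh hf, sym hh hf hg, sym hf hg hh, sym hg hh hf]
      linarith
    · exact intervalIntegrable_dot (hP.adj_mem_loops hk lf lh) (hP.mem_loops hk lg) _ _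
    · exact intervalIntegrable_dot (hP.adj_mem_loops hk lh lg) (hP.mem_loops hk lf) _ _
    · exact (intervalIntegrable_dot (hP.adj_mem_loops hk lf lh) (hP.mem_loops hk lg) _ _).add
        (intervalIntegrable_dot (hP.adj_mem_loops hk lh lg) (hP.mem_loops hk lf) _ _)
    · exact intervalIntegrable_dot (hP.adj_mem_loops hk lg lf) (hP.mem_loops hk lh) _ _

end IsHamiltonian

end Poisson

/-! ### Periodic scalars, integration by parts, and the operators `D a + a D`. -/

section Operators

variable {T : ℝ} {E : Type} [NormedAddCommGroup E] [NormedSpace ℝ E]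

/-- Smooth periodic scalar functions. -/
structure IsLoop (T : ℝ) (u : ℝ → ℝ) : Prop where
  contDiff : ContDiff ℝ ∞ u
  periodic : Function.Periodic u T

namespace IsLoop

theorem apply {m : ℕ} {S : Set (Fin m → ℝ)} {k : ℝ → Fin m → ℝ} (hk : k ∈ loops T S) (i : Fin m) :
    IsLoop T (fun x => k x i) :=
  ⟨contDiff_pi.1 hk.1 i, fun x => congrFun (hk.2.1 x) i⟩

theorem smoothPeriodic {u : ℝ → ℝ} (hu : IsLoop T u) : SmoothPeriodic T (fun _ : E => u) :=
  ⟨hu.contDiff.comp contDiff_snd, fun _ => hu.periodic⟩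

theorem of_smoothPeriodic {p : E → ℝ → ℝ} (hp : SmoothPeriodic T p) (s : E) : IsLoop T (p s) :=
  ⟨hp.loop s, hp.periodic s⟩

variable {u v : ℝ → ℝ}

theorem hasDerivAt (hu : IsLoop T u) (x : ℝ) : HasDerivAt u (_root_.deriv u x) x :=
  (hu.contDiff.differentiable (by simp) x).hasDerivAt

theorem deriv (hu : IsLoop T u) : IsLoop T (deriv u) :=
  of_smoothPeriodic (E := ℝ) hu.smoothPeriodic.deriv 0

theorem inv (hu : IsLoop T u) (h0 : ∀ x, u x ≠ 0) : IsLoop T (fun x => 1 / u x) := by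
  simp only [one_div]
  exact of_smoothPeriodic (E := ℝ) (hu.smoothPeriodic.inv fun _ => h0) 0

theorem mul (hu : IsLoop T u) (hv : IsLoop T v) : IsLoop T (fun x => u x * v x) :=
  of_smoothPeriodic (E := ℝ) (hu.smoothPeriodic.mul hv.smoothPeriodic) 0

theorem add (hu : IsLoop T u) (hv : IsLoop T v) : IsLoop T (fun x => u x + v x) :=
  of_smoothPeriodic (E := ℝ) (hu.smoothPeriodic.add hv.smoothPeriodic) 0

theorem sub (hu : IsLoop T u) (hv : IsLoop T v) : IsLoop T (fun x => u x - v x) :=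
  of_smoothPeriodic (E := ℝ) (hu.smoothPeriodic.sub hv.smoothPeriodic) 0

theorem const_mul (hu : IsLoop T u) (c : ℝ) : IsLoop T (fun x => c * u x) :=
  of_smoothPeriodic (E := ℝ) (hu.smoothPeriodic.const_mul c) 0

theorem intervalIntegrable (hu : IsLoop T u) (a b : ℝ) :
    IntervalIntegrable u MeasureTheory.volume a b :=
  hu.contDiff.continuous.intervalIntegrable _ _

end IsLoop

/-- Integration by parts on the circle, in the form used for every integral identity below: exhibit
a periodic `F` whose derivative is the difference of the integrands. -/
theorem integral_eq_of_hasDerivAt_sub {f g F : ℝ → ℝ}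
    (hf : IntervalIntegrable f MeasureTheory.volume 0 T)
    (hg : IntervalIntegrable g MeasureTheory.volume 0 T)
    (hF : Function.Periodic F T) (h : ∀ x, HasDerivAt F (f x - g x) x) :
    ∫ x in (0 : ℝ)..T, f x = ∫ x in (0 : ℝ)..T, g x := by
  rw [← sub_eq_zero, ← intervalIntegral.integral_sub hf hg,
    intervalIntegral.integral_eq_sub_of_hasDerivAt (fun x _ => h x) (hf.sub hg)]
  simpa using sub_eq_zero.2 (hF 0)

/-- The single test loop `u - v` suffices, since the hypothesis then says `∫ |u - v|² = 0`. -/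
theorem eq_of_integral_dot_sub_eq {m : ℕ} (hT : 0 < T) {u v : ℝ → Fin m → ℝ}
    (hu : u ∈ loops T Set.univ) (hv : v ∈ loops T Set.univ)
    (h : ∫ x in (0 : ℝ)..T, u x ⬝ᵥ (u x - v x) = ∫ x in (0 : ℝ)..T, v x ⬝ᵥ (u x - v x)) : u = v := by
  have hw : (fun x => u x - v x) ∈ loops T Set.univ :=
    ((SmoothPeriodic.of_loop (E := ℝ) hu).sub (SmoothPeriodic.of_loop hv)).mem_loops 0
  rw [← sub_eq_zero, ← intervalIntegral.integral_sub (intervalIntegrable_dot hu hw _ _)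
    (intervalIntegrable_dot hv hw _ _)] at h
  simp only [← sub_dotProduct] at h
  have hs := (SmoothPeriodic.of_loop (E := ℝ) hw).dot (SmoothPeriodic.of_loop hw)
  funext x
  have := eq_zero_of_integral_eq_zero hT (hs.loop 0).continuous (hs.periodic 0)
    (fun x => Finset.sum_nonneg fun i _ => mul_self_nonneg _) h x
  exact sub_eq_zero.1 (dotProduct_self_eq_zero.1 this)

/-- Variational derivatives are unique on spaces of loops in a vector space. -/
theorem varDeriv_unique {m : ℕ} (hT : 0 < T) {h : (ℝ → Fin m → ℝ) → ℝ}
    {δ δ' : (ℝ → Fin m → ℝ) → ℝ → Fin m → ℝ}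
    (hδ : (dotLoopSpace T Set.univ).HasVarDeriv h δ)
    (hδ' : (dotLoopSpace T Set.univ).HasVarDeriv h δ') {k : ℝ → Fin m → ℝ}
    (hk : k ∈ loops T Set.univ) : δ k = δ' k := by
  have hd := varDeriv_mem_loops hδ hk
  have hd' := varDeriv_mem_loops hδ' hk
  have hw : (fun x => δ k x - δ' k x) ∈ loops T Set.univ :=
    ((SmoothPeriodic.of_loop (E := ℝ) hd).sub (SmoothPeriodic.of_loop hd')).mem_loops 0
  exact eq_of_integral_dot_sub_eq hT hd hd' ((hasDerivAt_line hδ hk hw fun _ _ _ _ => trivial).unique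
    (hasDerivAt_line hδ' hk hw fun _ _ _ _ => trivial))

/-- The operator `D a + a D`. -/
def symOp (a v : ℝ → ℝ) (x : ℝ) : ℝ := deriv (fun y => a y * v y) x + a x * deriv v x

theorem symOp_apply {a v : ℝ → ℝ} (ha : IsLoop T a) (hv : IsLoop T v) (x : ℝ) :
    symOp a v x = deriv a x * v x + 2 * a x * deriv v x := by
  rw [symOp, ((ha.hasDerivAt x).fun_mul (hv.hasDerivAt x)).deriv]
  ring

theorem SmoothPeriodic.symOp {a v : E → ℝ → ℝ} (ha : SmoothPeriodic T a)
    (hv : SmoothPeriodic T v) : SmoothPeriodic T (fun s => symOp (a s) (v s)) :=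
  (ha.mul hv).deriv.add (ha.mul hv.deriv)

theorem SmoothPeriodic.hasDerivAt_deriv {v : ℝ → ℝ → ℝ} (hv : SmoothPeriodic T v) (s x : ℝ) :
    HasDerivAt (fun r => _root_.deriv (v r) x)
      (_root_.deriv (fun y => _root_.deriv (fun r => v r y) s) x) s := by
  rw [← deriv_deriv_comm hv.contDiff]
  exact hv.deriv.hasDerivAt s x

theorem SmoothPeriodic.hasDerivAt_symOp {a v : ℝ → ℝ → ℝ} (ha : SmoothPeriodic T a)
    (hv : SmoothPeriodic T v) (s x : ℝ) :
    HasDerivAt (fun r => LightCone.symOp (a r) (v r) x)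
      (LightCone.symOp (a s) (fun y => _root_.deriv (fun r => v r y) s) x
        + LightCone.symOp (fun y => _root_.deriv (fun r => a r y) s) (v s) x) s := by
  have h1 := (ha.mul hv).hasDerivAt_deriv s x
  have h2 := (ha.hasDerivAt s x).mul (hv.hasDerivAt_deriv s x)
  refine (h1.add h2).congr_deriv ?_
  have e : (fun y => _root_.deriv (fun r => a r y * v r y) s) = fun y =>
      _root_.deriv (fun r => a r y) s * v s y + a s y * _root_.deriv (fun r => v r y) s :=
    funext fun y => ((ha.hasDerivAt s y).mul (hv.hasDerivAt s y)).deriv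
  have l1 := IsLoop.of_smoothPeriodic (ha.derivParam.mul (SmoothPeriodic.of_loop (hv.mem_loops s))) s
  have l2 := IsLoop.of_smoothPeriodic ((SmoothPeriodic.of_loop (ha.mem_loops s)).mul hv.derivParam) s
  rw [e, ((l1.hasDerivAt x).fun_add (l2.hasDerivAt x)).deriv, LightCone.symOp, LightCone.symOp]
  ring

theorem hasDerivAt_vec3 {f : ℝ → Fin 3 → ℝ} {f' : Fin 3 → ℝ} {s : ℝ}
    (h0 : HasDerivAt (fun r => f r 0) (f' 0) s) (h1 : HasDerivAt (fun r => f r 1) (f' 1) s)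
    (h2 : HasDerivAt (fun r => f r 2) (f' 2) s) : HasDerivAt f f' s := by
  rw [hasDerivAt_pi]
  intro i
  fin_cases i
  exacts [h0, h1, h2]

theorem hasDerivAt_vec2 {f : ℝ → Fin 2 → ℝ} {f' : Fin 2 → ℝ} {s : ℝ}
    (h0 : HasDerivAt (fun r => f r 0) (f' 0) s) (h1 : HasDerivAt (fun r => f r 1) (f' 1) s) :
    HasDerivAt f f' s := by
  rw [hasDerivAt_pi]
  intro i
  fin_cases i
  exacts [h0, h1]

theorem SmoothPeriodic.vec3 {f g h : E → ℝ → ℝ} (hf : SmoothPeriodic T f)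
    (hg : SmoothPeriodic T g) (hh : SmoothPeriodic T h) :
    SmoothPeriodic T (fun s x => ![f s x, g s x, h s x]) :=
  pi fun i => by fin_cases i <;> assumption

theorem SmoothPeriodic.vec2 {f g : E → ℝ → ℝ} (hf : SmoothPeriodic T f)
    (hg : SmoothPeriodic T g) :
    SmoothPeriodic T (fun s x => ![f s x, g s x]) :=
  pi fun i => by fin_cases i <;> assumption

theorem P0_eq (k v : ℝ → Fin 3 → ℝ) (x : ℝ) :
    P0 k v x = ![0, -symOp (fun y => 1 / k y 0) (fun y => v y 1) x,
      symOp (fun y => 1 / k y 0) (fun y => v y 2) x] := by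
  simp only [P0, symOp, neg_add, sub_eq_add_neg]

theorem leafOp_eq (c : ℝ → ℝ) (v : ℝ → Fin 2 → ℝ) (x : ℝ) :
    leafOp c v x = ![-symOp (fun y => 1 / c y) (fun y => v y 0) x,
      symOp (fun y => 1 / c y) (fun y => v y 1) x] := by
  simp only [leafOp, symOp, neg_add, sub_eq_add_neg]

theorem kdvP_eq (κ v : ℝ → Fin 2 → ℝ) (x : ℝ) :
    kdvP κ v x = ![-deriv (deriv (deriv fun y => v y 0)) x + symOp (fun y => κ y 0) (fun y => v y 0) x
        + symOp (fun y => κ y 1) (fun y => v y 1) x,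
      symOp (fun y => κ y 1) (fun y => v y 0) x + deriv (deriv (deriv fun y => v y 1)) x
        - symOp (fun y => κ y 0) (fun y => v y 1) x] := by
  simp only [kdvP, symOp, iteratedDeriv_succ, iteratedDeriv_zero]
  ext i
  fin_cases i
  · simp; ring
  · simp; ring

end Operators

/-! ### The operator `P₀` and its blocks at fixed `k₀`. -/

section Instances

variable {T : ℝ}

/-- The operator `P₀` is Hamiltonian, also after rescaling. -/
theorem isHamiltonian_P0 (T c : ℝ) :
    IsHamiltonian T {v : Fin 3 → ℝ | 0 < v 0} (fun k v => c • P0 k v)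
      (fun k v w => c • fun x => ![0, -symOp (fun y => -w y 0 / k y 0 ^ 2) (fun y => v y 1) x,
        symOp (fun y => -w y 0 / k y 0 ^ 2) (fun y => v y 2) x])
      (fun k u v => c • fun x => ![-(1 / k x 0 ^ 2) *
        ((deriv (fun y => u y 1) x * v x 1 - u x 1 * deriv (fun y => v y 1) x)
        - (deriv (fun y => u y 2) x * v x 2 - u x 2 * deriv (fun y => v y 2) x)), 0, 0]) := by
  have hsm : ∀ {E : Type} [NormedAddCommGroup E] [NormedSpace ℝ E] [FiniteDimensional ℝ E]
      (p v : E → ℝ → Fin 3 → ℝ), SmoothPeriodic T p →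
      (∀ s x, p s x ∈ {v : Fin 3 → ℝ | 0 < v 0}) → SmoothPeriodic T v →
      SmoothPeriodic T (fun s => c • P0 (p s) (v s)) := by
    intro E _ _ _ p v hp hS hv
    have hi : SmoothPeriodic T (fun s x => 1 / p s x 0) :=
      (SmoothPeriodic.const 1).div (hp.apply 0) fun s x => (hS s x).ne'
    have := ((SmoothPeriodic.const 0).vec3 (hi.symOp (hv.apply 1)).neg
      (hi.symOp (hv.apply 2))).const_smul c
    convert this using 4
    exact congrArg (c • ·) (P0_eq _ _ _)
  have hl : ∀ k ∈ loops T {v : Fin 3 → ℝ | 0 < v 0}, ∀ v ∈ loops T Set.univ,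
      c • P0 k v ∈ loops T Set.univ := fun k hk v hv =>
    (hsm (E := ℝ) _ _ (SmoothPeriodic.of_loop hk) (fun _ => hk.2.2)
    (SmoothPeriodic.of_loop hv)).mem_loops 0
  have hadj : ∀ {E : Type} [NormedAddCommGroup E] [NormedSpace ℝ E] [FiniteDimensional ℝ E]
      (p u v : E → ℝ → Fin 3 → ℝ), SmoothPeriodic T p →
      (∀ s x, p s x ∈ {v : Fin 3 → ℝ | 0 < v 0}) → SmoothPeriodic T u → SmoothPeriodic T v →
      SmoothPeriodic T (fun s => c • fun x => ![-(1 / p s x 0 ^ 2) *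
        ((deriv (fun y => u s y 1) x * v s x 1 - u s x 1 * deriv (fun y => v s y 1) x)
        - (deriv (fun y => u s y 2) x * v s x 2 - u s x 2 * deriv (fun y => v s y 2) x)), 0, 0]) := by
    intro E _ _ _ p u v hp hS hu hv
    have hi : SmoothPeriodic T (fun s x => -(1 / p s x 0 ^ 2)) := by
      simp only [pow_two]
      exact ((SmoothPeriodic.const 1).div ((hp.apply 0).mul (hp.apply 0))
        fun s x => (mul_pos (hS s x) (hS s x)).ne').neg
    exact ((hi.mul ((((hu.apply 1).deriv.mul (hv.apply 1)).sub
      ((hu.apply 1).mul (hv.apply 1).deriv)).sub (((hu.apply 2).deriv.mul (hv.apply 2)).sub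
      ((hu.apply 2).mul (hv.apply 2).deriv)))).vec3 (.const 0) (.const 0)).const_smul c
  refine ⟨hsm, hadj, ?_, ?_, ?_, ?_, ?_⟩
  -- The first component of `P₀` is zero, so a motion along its values does not change `k₀`, which
  -- stays positive.
  · intro k hk v hv y hy t x
    change 0 < y 0 + t * (c * 0)
    rw [mul_zero, mul_zero, add_zero]
    exact hy
  · intro k hk u hu v hv
    rw [← intervalIntegral.integral_neg]
    have hk0 := (IsLoop.apply hk 0).inv fun x => (hk.2.2 x).ne'
    have u1 := IsLoop.apply hu 1
    have u2 := IsLoop.apply hu 2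
    have v1 := IsLoop.apply hv 1
    have v2 := IsLoop.apply hv 2
    -- With `a = 1/k₀`, skew-adjointness comes from `u (D a + a D) v + v (D a + a D) u = 2 (a u
    -- v)'`.
    refine integral_eq_of_hasDerivAt_sub (intervalIntegrable_dot hu (hl k hk v hv) _ _)
      (intervalIntegrable_dot hv (hl k hk u hu) _ _).neg
      ((hk0.mul ((v2.mul u2).sub (v1.mul u1))).const_mul (2 * c)).periodic fun x => ?_
    refine (((hk0.hasDerivAt x).fun_mul ((((v2.hasDerivAt x).fun_mul (u2.hasDerivAt x))).fun_sub
      ((v1.hasDerivAt x).fun_mul (u1.hasDerivAt x)))).const_mul (2 * c)).congr_deriv ?_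
    simp only [Pi.smul_apply, P0_eq, symOp_apply hk0 u1, symOp_apply hk0 u2, symOp_apply hk0 v1,
      symOp_apply hk0 v2, dotProduct, Fin.sum_univ_three, smul_eq_mul]
    simp
    ring
  · intro γ v hγ hS hv s x
    have hi : SmoothPeriodic T (fun s x => 1 / γ s x 0) :=
      (SmoothPeriodic.const 1).div (hγ.apply 0) fun s x => (hS s x).ne'
    have ei : (fun y => deriv (fun r => 1 / γ r y 0) s) =
        fun y => -deriv (fun r => γ r y) s 0 / γ s y 0 ^ 2 := by
      funext y
      rw [deriv_apply (hγ.hasDerivAt s y).differentiableAt]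
      simpa using (((hγ.apply 0).hasDerivAt s y).fun_inv (hS s y).ne').deriv
    have ev : ∀ i, (fun y => deriv (fun r => v r y i) s) = fun y => deriv (fun r => v r y) s i :=
      fun i => funext fun y => (deriv_apply (hv.hasDerivAt s y).differentiableAt i).symm
    have h1 := hi.hasDerivAt_symOp (hv.apply 1) s x
    have h2 := hi.hasDerivAt_symOp (hv.apply 2) s x
    rw [ei, ev] at h1 h2
    simp only [Pi.smul_apply, P0_eq]
    rw [← smul_add]
    refine HasDerivAt.const_smul c (hasDerivAt_vec3 ?_ ?_ ?_)
    · simpa using hasDerivAt_const s (0 : ℝ)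
    · refine h1.fun_neg.congr_deriv ?_
      simp
      ring
    · exact h2
  · intro k hk u hu v hv w hw
    have hk0 := IsLoop.apply hk 0
    have hki := hk0.inv fun x => (hk.2.2 x).ne'
    have w0 := IsLoop.apply hw 0
    have hb : IsLoop T (fun y => -w y 0 / k y 0 ^ 2) := by
      convert (w0.mul (hki.mul hki)).const_mul (-1) using 2 with y
      have : k y 0 ≠ 0 := ne_of_gt (hk.2.2 y)
      field_simp
    have u1 := IsLoop.apply hu 1
    have u2 := IsLoop.apply hu 2
    have v1 := IsLoop.apply hv 1
    have v2 := IsLoop.apply hv 2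
    have hP' : (c • fun x => ![0, -symOp (fun y => -w y 0 / k y 0 ^ 2) (fun y => v y 1) x,
        symOp (fun y => -w y 0 / k y 0 ^ 2) (fun y => v y 2) x]) ∈ loops T Set.univ :=
      (((SmoothPeriodic.const (0 : ℝ)).vec3 (hb.smoothPeriodic.symOp v1.smoothPeriodic).neg
        (hb.smoothPeriodic.symOp v2.smoothPeriodic)).const_smul c).mem_loops (0 : ℝ)
    -- With `b = -w₀/k₀²`, the variation of `1/k₀`, one has `u (D b + b D) v = (b u v)' + b (u v' -
    -- u' v)`; the last term is the source of `R`.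
    refine integral_eq_of_hasDerivAt_sub (intervalIntegrable_dot hu hP' _ _)
      (intervalIntegrable_dot ((hadj (E := ℝ) _ _ _ (SmoothPeriodic.of_loop hk) (fun _ => hk.2.2)
        (SmoothPeriodic.of_loop hu) (SmoothPeriodic.of_loop hv)).mem_loops 0) hw _ _)
      ((hb.mul ((u2.mul v2).sub (u1.mul v1))).const_mul c).periodic fun x => ?_
    refine (((hb.hasDerivAt x).fun_mul ((((u2.hasDerivAt x).fun_mul (v2.hasDerivAt x))).fun_sub
      ((u1.hasDerivAt x).fun_mul (v1.hasDerivAt x)))).const_mul c).congr_deriv ?_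
    simp only [Pi.smul_apply, symOp_apply hb v1, symOp_apply hb v2, dotProduct,
      Fin.sum_univ_three, smul_eq_mul]
    simp
    ring
  -- `R` has only the component along `k₀` and `P₀` has none there, so every product vanishes
  -- pointwise.
  · intro k hk u hu v hv w hw
    simp [P0, dotProduct, Fin.sum_univ_three]

/-- The operators on the leaves of constant `k₀` are Hamiltonian. -/
theorem isHamiltonian_leafOp {c : ℝ → ℝ} (hc : c ∈ loops T (Set.Ioi (0 : ℝ))) (a : ℝ) :
    IsHamiltonian T (Set.univ : Set (Fin 2 → ℝ)) (fun _ v => a • leafOp c v) (fun _ _ _ => 0)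
      (fun _ _ _ => 0) := by
  have hci : IsLoop T (fun x => 1 / c x) := IsLoop.inv ⟨hc.1, hc.2.1⟩ fun x => (hc.2.2 x).ne'
  have hsm : ∀ {E : Type} [NormedAddCommGroup E] [NormedSpace ℝ E] (v : E → ℝ → Fin 2 → ℝ),
      SmoothPeriodic T v → SmoothPeriodic T (fun s => a • leafOp c (v s)) := by
    intro E _ _ v hv
    have := ((hci.smoothPeriodic.symOp (hv.apply 0)).neg.vec2
      (hci.smoothPeriodic.symOp (hv.apply 1))).const_smul a
    convert this using 4
    exact congrArg (a • ·) (leafOp_eq _ _ _)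
  have hl : ∀ v ∈ loops T Set.univ, a • leafOp c v ∈ loops T Set.univ := fun v hv =>
    (hsm (E := ℝ) _ (SmoothPeriodic.of_loop hv)).mem_loops 0
  refine ⟨fun _ v _ _ hv => hsm v hv, fun _ _ _ _ _ _ _ => .const 0, fun _ _ _ _ _ _ _ _ => trivial,
    ?_, ?_, ?_, ?_⟩
  · intro k hk u hu v hv
    rw [← intervalIntegral.integral_neg]
    have u0 := IsLoop.apply hu 0
    have u1 := IsLoop.apply hu 1
    have v0 := IsLoop.apply hv 0
    have v1 := IsLoop.apply hv 1
    refine integral_eq_of_hasDerivAt_sub (intervalIntegrable_dot hu (hl v hv) _ _)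
      (intervalIntegrable_dot hv (hl u hu) _ _).neg
      ((hci.mul ((v1.mul u1).sub (v0.mul u0))).const_mul (2 * a)).periodic fun x => ?_
    refine (((hci.hasDerivAt x).fun_mul ((((v1.hasDerivAt x).fun_mul (u1.hasDerivAt x))).fun_sub
      ((v0.hasDerivAt x).fun_mul (u0.hasDerivAt x)))).const_mul (2 * a)).congr_deriv ?_
    simp only [Pi.smul_apply, leafOp_eq, symOp_apply hci u0, symOp_apply hci u1,
      symOp_apply hci v0, symOp_apply hci v1, dotProduct, Fin.sum_univ_two, smul_eq_mul]
    simp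
    ring
  · intro γ v hγ hS hv s x
    have hi : SmoothPeriodic T (fun (_ : ℝ) x => 1 / c x) := hci.smoothPeriodic
    have ev : ∀ i, (fun y => deriv (fun r => v r y i) s) = fun y => deriv (fun r => v r y) s i :=
      fun i => funext fun y => (deriv_apply (hv.hasDerivAt s y).differentiableAt i).symm
    have h0 := hi.hasDerivAt_symOp (hv.apply 0) s x
    have h1 := hi.hasDerivAt_symOp (hv.apply 1) s x
    rw [ev] at h0 h1
    simp only [Pi.smul_apply, leafOp_eq]
    simp only [Pi.zero_apply, add_zero]
    refine HasDerivAt.const_smul a (hasDerivAt_vec2 ?_ ?_)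
    · refine h0.fun_neg.congr_deriv ?_
      simp [symOp]
    · refine h1.congr_deriv ?_
      simp [symOp]
  -- The operator does not depend on the point of the leaf, so `P'` and `R` are zero and the last
  -- two conditions are trivial.
  · simp
  · simp

end Instances

/-! ### The complex KdV pencil. -/

section KdV

variable {T : ℝ}

/-- The pencil of the two Hamiltonian structures of the complexly coupled KdV system. -/
theorem isHamiltonian_kdv (T a b : ℝ) :
    IsHamiltonian T (Set.univ : Set (Fin 2 → ℝ)) (fun κ v => a • kdvP κ v + b • diagD v)
      (fun _ v w => a • fun x => ![symOp (fun y => w y 0) (fun y => v y 0) x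
          + symOp (fun y => w y 1) (fun y => v y 1) x,
        symOp (fun y => w y 1) (fun y => v y 0) x - symOp (fun y => w y 0) (fun y => v y 1) x])
      (fun _ u v => a • fun x =>
        ![u x 0 * deriv (fun y => v y 0) x - deriv (fun y => u y 0) x * v x 0
          - (u x 1 * deriv (fun y => v y 1) x - deriv (fun y => u y 1) x * v x 1),
        u x 0 * deriv (fun y => v y 1) x - deriv (fun y => u y 0) x * v x 1
          + (u x 1 * deriv (fun y => v y 0) x - deriv (fun y => u y 1) x * v x 0)]) := by
  -- Put `q = κ₀ + i κ₁` and `v̂ = v₀ - i v₁`. The pencil is `a (-D³ + q D + D q) v̂ - b D v̂` and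
  -- the dot product `u ⬝ᵥ w` is the real part of `û w`, so each condition is the real part of its
  -- analogue for scalar KdV.
  have heq : ∀ (κ v : ℝ → Fin 2 → ℝ) (x : ℝ), (a • kdvP κ v + b • diagD v) x =
      ![a * (-deriv (deriv (deriv fun y => v y 0)) x + symOp (fun y => κ y 0) (fun y => v y 0) x
        + symOp (fun y => κ y 1) (fun y => v y 1) x) + b * -deriv (fun y => v y 0) x,
      a * (symOp (fun y => κ y 1) (fun y => v y 0) x + deriv (deriv (deriv fun y => v y 1)) x
        - symOp (fun y => κ y 0) (fun y => v y 1) x) + b * deriv (fun y => v y 1) x] := by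
    intro κ v x
    simp only [Pi.add_apply, Pi.smul_apply, kdvP_eq, diagD]
    ext i
    fin_cases i <;> simp
  have hsm : ∀ {E : Type} [NormedAddCommGroup E] [NormedSpace ℝ E] [FiniteDimensional ℝ E]
      (p v : E → ℝ → Fin 2 → ℝ), SmoothPeriodic T p → SmoothPeriodic T v →
      SmoothPeriodic T (fun s => a • kdvP (p s) (v s) + b • diagD (v s)) := by
    intro E _ _ _ p v hp hv
    have := ((((hv.apply 0).deriv.deriv.deriv.neg.add ((hp.apply 0).symOp (hv.apply 0))).add
      ((hp.apply 1).symOp (hv.apply 1))).const_mul a |>.add ((hv.apply 0).deriv.neg.const_mul b)).vec2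
      (((((hp.apply 1).symOp (hv.apply 0)).add (hv.apply 1).deriv.deriv.deriv).sub
      ((hp.apply 0).symOp (hv.apply 1))).const_mul a |>.add ((hv.apply 1).deriv.const_mul b))
    convert this using 3
    exact heq _ _ _
  have hadj : ∀ {E : Type} [NormedAddCommGroup E] [NormedSpace ℝ E] [FiniteDimensional ℝ E]
      (u v : E → ℝ → Fin 2 → ℝ), SmoothPeriodic T u → SmoothPeriodic T v →
      SmoothPeriodic T (fun s => a • fun x =>
        ![u s x 0 * deriv (fun y => v s y 0) x - deriv (fun y => u s y 0) x * v s x 0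
          - (u s x 1 * deriv (fun y => v s y 1) x - deriv (fun y => u s y 1) x * v s x 1),
        u s x 0 * deriv (fun y => v s y 1) x - deriv (fun y => u s y 0) x * v s x 1
          + (u s x 1 * deriv (fun y => v s y 0) x - deriv (fun y => u s y 1) x * v s x 0)]) := by
    intro E _ _ _ u v hu hv
    have w : ∀ i j, SmoothPeriodic T fun s x =>
        u s x i * deriv (fun y => v s y j) x - deriv (fun y => u s y i) x * v s x j :=
      fun i j => ((hu.apply i).mul (hv.apply j).deriv).sub ((hu.apply i).deriv.mul (hv.apply j))
    exact (((w 0 0).sub (w 1 1)).vec2 ((w 0 1).add (w 1 0))).const_smul a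
  have hl : ∀ k ∈ loops T Set.univ, ∀ v ∈ loops T Set.univ,
      a • kdvP k v + b • diagD v ∈ loops T Set.univ := fun k hk v hv =>
    (hsm (E := ℝ) _ _ (SmoothPeriodic.of_loop hk) (SmoothPeriodic.of_loop hv)).mem_loops 0
  have hla : ∀ u ∈ loops T Set.univ, ∀ v ∈ loops T Set.univ, _ := fun u hu v hv =>
    (hadj (E := ℝ) _ _ (SmoothPeriodic.of_loop hu) (SmoothPeriodic.of_loop hv)).mem_loops 0
  refine ⟨fun p v hp _ hv => hsm p v hp hv, fun _ u v _ _ hu hv => hadj u v hu hv,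
    fun _ _ _ _ _ _ _ _ => trivial, ?_, ?_, ?_, ?_⟩
  · intro k hk u hu v hv
    rw [← intervalIntegral.integral_neg]
    have k0 := IsLoop.apply hk 0
    have k1 := IsLoop.apply hk 1
    have u0 := IsLoop.apply hu 0
    have u1 := IsLoop.apply hu 1
    have v0 := IsLoop.apply hv 0
    have v1 := IsLoop.apply hv 1
    -- antiderivatives of `u v''' + v u'''`, `u (Dk + kD) v + v (Dk + kD) u` and `u v' + v u'`
    have d3 : ∀ {p q : ℝ → ℝ}, IsLoop T p → IsLoop T q → ∃ F, IsLoop T F ∧ ∀ x, HasDerivAt F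
        (p x * deriv (deriv (deriv q)) x + q x * deriv (deriv (deriv p)) x) x := by
      intro p q hp hq
      refine ⟨_, ((hp.mul hq.deriv.deriv).add (hq.mul hp.deriv.deriv)).sub (hp.deriv.mul hq.deriv),
        fun x => ?_⟩
      refine ((((hp.hasDerivAt x).fun_mul (hq.deriv.deriv.hasDerivAt x)).fun_add
        ((hq.hasDerivAt x).fun_mul (hp.deriv.deriv.hasDerivAt x))).fun_sub
        ((hp.deriv.hasDerivAt x).fun_mul (hq.deriv.hasDerivAt x))).congr_deriv ?_
      ring
    have dsym : ∀ {g p q : ℝ → ℝ}, IsLoop T g → IsLoop T p → IsLoop T q → ∃ F, IsLoop T F ∧ ∀ x,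
        HasDerivAt F (p x * symOp g q x + q x * symOp g p x) x := by
      intro g p q hg hp hq
      refine ⟨_, (hg.mul (hp.mul hq)).const_mul 2, fun x => ?_⟩
      refine (((hg.hasDerivAt x).fun_mul ((hp.hasDerivAt x).fun_mul
        (hq.hasDerivAt x))).const_mul 2).congr_deriv ?_
      rw [symOp_apply hg hq, symOp_apply hg hp]
      ring
    obtain ⟨A0, lA0, dA0⟩ := d3 u0 v0
    obtain ⟨A1, lA1, dA1⟩ := d3 u1 v1
    obtain ⟨B0, lB0, dB0⟩ := dsym k0 u0 v0
    obtain ⟨B1, lB1, dB1⟩ := dsym k0 u1 v1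
    obtain ⟨C0, lC0, dC0⟩ := dsym k1 u0 v1
    obtain ⟨C1, lC1, dC1⟩ := dsym k1 u1 v0
    refine integral_eq_of_hasDerivAt_sub (intervalIntegrable_dot hu (hl k hk v hv) _ _)
      (intervalIntegrable_dot hv (hl k hk u hu) _ _).neg
      ((((((lA1.sub lA0).add (lB0.sub lB1)).add (lC0.add lC1)).const_mul a).add
        (((u1.mul v1).sub (u0.mul v0)).const_mul b))).periodic fun x => ?_
    refine ((((((dA1 x).fun_sub (dA0 x)).fun_add ((dB0 x).fun_sub (dB1 x))).fun_add
      ((dC0 x).fun_add (dC1 x))).const_mul a).fun_add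
      ((((u1.hasDerivAt x).fun_mul (v1.hasDerivAt x)).fun_sub
      ((u0.hasDerivAt x).fun_mul (v0.hasDerivAt x))).const_mul b)).congr_deriv ?_
    rw [heq, heq]
    simp only [dotProduct, Fin.sum_univ_two, Matrix.cons_val_zero, Matrix.cons_val_one]
    ring
  · intro γ v hγ hS hv s x
    have ev : ∀ i, (fun y => deriv (fun r => v r y i) s) = fun y => deriv (fun r => v r y) s i :=
      fun i => funext fun y => (deriv_apply (hv.hasDerivAt s y).differentiableAt i).symm
    have eγ : ∀ i, (fun y => deriv (fun r => γ r y i) s) = fun y => deriv (fun r => γ r y) s i :=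
      fun i => funext fun y => (deriv_apply (hγ.hasDerivAt s y).differentiableAt i).symm
    have hs : ∀ i j, HasDerivAt (fun r => symOp (fun y => γ r y i) (fun y => v r y j) x)
        (symOp (fun y => γ s y i) (fun y => deriv (fun r => v r y) s j) x
          + symOp (fun y => deriv (fun r => γ r y) s i) (fun y => v s y j) x) s := by
      intro i j
      rw [← ev, ← eγ]
      exact (hγ.apply i).hasDerivAt_symOp (hv.apply j) s x
    have h1 : ∀ i, HasDerivAt (fun r => deriv (fun y => v r y i) x)
        (deriv (fun y => deriv (fun r => v r y) s i) x) s := by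
      intro i
      rw [← ev]
      exact (hv.apply i).hasDerivAt_deriv s x
    have h3 : ∀ i, HasDerivAt (fun r => deriv (deriv (deriv fun y => v r y i)) x)
        (deriv (deriv (deriv fun y => deriv (fun r => v r y) s i)) x) s := by
      intro i
      have h := (hv.apply i).deriv.deriv.hasDerivAt_deriv s x
      have e2 : (fun y => deriv (fun r => deriv (deriv fun y => v r y i) y) s) =
          fun y => deriv (fun y => deriv (fun r => deriv (fun y => v r y i) y) s) y :=
        funext fun y => ((hv.apply i).deriv.hasDerivAt_deriv s y).deriv
      have e1 : (fun y => deriv (fun r => deriv (fun y => v r y i) y) s) =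
          fun y => deriv (fun y => deriv (fun r => v r y i) s) y :=
        funext fun y => ((hv.apply i).hasDerivAt_deriv s y).deriv
      rw [ev] at e1
      rw [e1] at e2
      rw [e2] at h
      exact h
    simp only [heq]
    refine hasDerivAt_vec2 ?_ ?_
    · refine (((((h3 0).fun_neg.fun_add (hs 0 0)).fun_add (hs 1 1)).const_mul a).fun_add
        ((h1 0).fun_neg.const_mul b)).congr_deriv ?_
      simp
      ring
    · refine (((((hs 1 0).fun_add (h3 1)).fun_sub (hs 0 1)).const_mul a).fun_add
        ((h1 1).const_mul b)).congr_deriv ?_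
      simp
      ring
  · intro k hk u hu v hv w hw
    have w0 := IsLoop.apply hw 0
    have w1 := IsLoop.apply hw 1
    have u0 := IsLoop.apply hu 0
    have u1 := IsLoop.apply hu 1
    have v0 := IsLoop.apply hv 0
    have v1 := IsLoop.apply hv 1
    have hP' : (a • fun x => ![symOp (fun y => w y 0) (fun y => v y 0) x
          + symOp (fun y => w y 1) (fun y => v y 1) x,
        symOp (fun y => w y 1) (fun y => v y 0) x - symOp (fun y => w y 0) (fun y => v y 1) x])
        ∈ loops T Set.univ :=
      ((((w0.smoothPeriodic.symOp v0.smoothPeriodic).add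
        (w1.smoothPeriodic.symOp v1.smoothPeriodic)).vec2
        ((w1.smoothPeriodic.symOp v0.smoothPeriodic).sub
        (w0.smoothPeriodic.symOp v1.smoothPeriodic))).const_smul a).mem_loops (0 : ℝ)
    refine integral_eq_of_hasDerivAt_sub (intervalIntegrable_dot hu hP' _ _)
      (intervalIntegrable_dot (hla u hu v hv) hw _ _)
      (((w0.mul ((u0.mul v0).sub (u1.mul v1))).add
        (w1.mul ((u0.mul v1).add (u1.mul v0)))).const_mul a).periodic fun x => ?_
    refine ((((w0.hasDerivAt x).fun_mul (((u0.hasDerivAt x).fun_mul (v0.hasDerivAt x)).fun_sub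
      ((u1.hasDerivAt x).fun_mul (v1.hasDerivAt x)))).fun_add
      ((w1.hasDerivAt x).fun_mul (((u0.hasDerivAt x).fun_mul (v1.hasDerivAt x)).fun_add
      ((u1.hasDerivAt x).fun_mul (v0.hasDerivAt x))))).const_mul a).congr_deriv ?_
    simp only [Pi.smul_apply, symOp_apply w0 v0, symOp_apply w0 v1, symOp_apply w1 v0,
      symOp_apply w1 v1, dotProduct, Fin.sum_univ_two, smul_eq_mul,
      Matrix.cons_val_zero, Matrix.cons_val_one]
    ring
  -- In complex form `R` comes from the Wronskian `u v' - u' v`. In the cyclic sum the terms with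
  -- `q`, `q'` and `b` cancel pointwise. The terms with `w'''` add up to a total derivative, because
  -- the cyclic sum of `(u v'' - u'' v) w''` is zero. The factor `-a²` below is `a` from `R` times
  -- `-a` from the coefficient of `D³`.
  · intro k hk u hu v hv w hw
    have k0 := IsLoop.apply hk 0
    have k1 := IsLoop.apply hk 1
    have w0 := IsLoop.apply hw 0
    have w1 := IsLoop.apply hw 1
    have u0 := IsLoop.apply hu 0
    have u1 := IsLoop.apply hu 1
    have v0 := IsLoop.apply hv 0
    have v1 := IsLoop.apply hv 1
    -- `D ((p q' - p' q) r'') = (p q'' - p'' q) r'' + (p q' - p' q) r'''`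
    have dw : ∀ {p q r : ℝ → ℝ}, IsLoop T p → IsLoop T q → IsLoop T r → ∃ F, IsLoop T F ∧ ∀ x,
        HasDerivAt F ((p x * deriv (deriv q) x - deriv (deriv p) x * q x) * deriv (deriv r) x
          + (p x * deriv q x - deriv p x * q x) * deriv (deriv (deriv r)) x) x := by
      intro p q r hp hq hr
      refine ⟨_, ((hp.mul hq.deriv).sub (hp.deriv.mul hq)).mul hr.deriv.deriv, fun x => ?_⟩
      refine (((((hp.hasDerivAt x).fun_mul (hq.deriv.hasDerivAt x)).fun_sub
        ((hp.deriv.hasDerivAt x).fun_mul (hq.hasDerivAt x))).fun_mul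
        (hr.deriv.deriv.hasDerivAt x))).congr_deriv ?_
      ring
    -- the real part of `(p q' - p' q) r''` for complex `p`, `q`, `r`
    have dc : ∀ {p q r p' q' r' : ℝ → ℝ}, IsLoop T p → IsLoop T q → IsLoop T r → IsLoop T p' →
        IsLoop T q' → IsLoop T r' → ∃ F, IsLoop T F ∧ ∀ x, HasDerivAt F
        (((p x * deriv (deriv q) x - deriv (deriv p) x * q x) * deriv (deriv r) x
          + (p x * deriv q x - deriv p x * q x) * deriv (deriv (deriv r)) x)
        - ((p' x * deriv (deriv q') x - deriv (deriv p') x * q' x) * deriv (deriv r) x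
          + (p' x * deriv q' x - deriv p' x * q' x) * deriv (deriv (deriv r)) x)
        - ((p x * deriv (deriv q') x - deriv (deriv p) x * q' x) * deriv (deriv r') x
          + (p x * deriv q' x - deriv p x * q' x) * deriv (deriv (deriv r')) x)
        - ((p' x * deriv (deriv q) x - deriv (deriv p') x * q x) * deriv (deriv r') x
          + (p' x * deriv q x - deriv p' x * q x) * deriv (deriv (deriv r')) x)) x := by
      intro p q r p' q' r' hp hq hr hp' hq' hr'
      obtain ⟨F1, l1, d1⟩ := dw hp hq hr
      obtain ⟨F2, l2, d2⟩ := dw hp' hq' hr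
      obtain ⟨F3, l3, d3⟩ := dw hp hq' hr'
      obtain ⟨F4, l4, d4⟩ := dw hp' hq hr'
      exact ⟨_, ((l1.sub l2).sub l3).sub l4, fun x =>
        (((d1 x).fun_sub (d2 x)).fun_sub (d3 x)).fun_sub (d4 x)⟩
    obtain ⟨F1, l1, d1⟩ := dc u0 v0 w0 u1 v1 w1
    obtain ⟨F2, l2, d2⟩ := dc v0 w0 u0 v1 w1 u1
    obtain ⟨F3, l3, d3⟩ := dc w0 u0 v0 w1 u1 v1
    refine Eq.trans ?_ (intervalIntegral.integral_zero (a := 0) (b := T)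
      (μ := MeasureTheory.volume) (E := ℝ))
    refine integral_eq_of_hasDerivAt_sub (((intervalIntegrable_dot (hla u hu v hv)
      (hl k hk w hw) _ _).add (intervalIntegrable_dot (hla v hv w hw) (hl k hk u hu) _ _)).add
      (intervalIntegrable_dot (hla w hw u hu) (hl k hk v hv) _ _)) intervalIntegrable_const
      (((l1.add l2).add l3).const_mul (-a ^ 2)).periodic fun x => ?_
    refine ((((d1 x).fun_add (d2 x)).fun_add (d3 x)).const_mul (-a ^ 2)).congr_deriv ?_
    rw [heq, heq, heq]
    simp only [Pi.smul_apply, symOp_apply k0 u0, symOp_apply k0 u1, symOp_apply k1 u0,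
      symOp_apply k1 u1, symOp_apply k0 v0, symOp_apply k0 v1, symOp_apply k1 v0,
      symOp_apply k1 v1, symOp_apply k0 w0, symOp_apply k0 w1, symOp_apply k1 w0,
      symOp_apply k1 w1, dotProduct, Fin.sum_univ_two, smul_eq_mul,
      Matrix.cons_val_zero, Matrix.cons_val_one]
    ring

end KdV

/-! ### The two Hamiltonians of the coupled KdV system. -/

section KdVFunctionals

variable {T : ℝ}

theorem hasVarDeriv_kdvH1 (T : ℝ) :
    (dotLoopSpace T (Set.univ : Set (Fin 2 → ℝ))).HasVarDeriv (kdvH1 T)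
      (fun κ x => ![κ x 0, -κ x 1]) := by
  refine hasVarDeriv_of (fun n p hp _ => (hp.apply 0).vec2 (hp.apply 1).neg) fun γ hγ _ s => ?_
  have h0 := hγ.apply 0
  have h1 := hγ.apply 1
  have hd := ((h0.mul h0).sub (h1.mul h1)).hasDerivAt_integral s
  have hd' := hd.const_mul (1 / 2)
  simp only [kdvH1, pow_two]
  refine hd'.congr_deriv ?_
  rw [← intervalIntegral.integral_const_mul]
  refine intervalIntegral.integral_congr fun x _ => ?_
  have e0 := h0.hasDerivAt s x
  have e1 := h1.hasDerivAt s x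
  simp only [((e0.fun_mul e0).fun_sub (e1.fun_mul e1)).deriv,
    dotProduct, Fin.sum_univ_two, Matrix.cons_val_zero, Matrix.cons_val_one,
    deriv_apply (hγ.hasDerivAt s x).differentiableAt]
  ring

theorem hasVarDeriv_kdvH2 (T : ℝ) :
    (dotLoopSpace T (Set.univ : Set (Fin 2 → ℝ))).HasVarDeriv (kdvH2 T)
      (fun κ x => ![deriv (deriv fun y => κ y 0) x - 3 / 2 * (κ x 0 * κ x 0 - κ x 1 * κ x 1),
        -deriv (deriv fun y => κ y 1) x + 3 * (κ x 0 * κ x 1)]) := by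
  have hsm : ∀ {E : Type} [NormedAddCommGroup E] [NormedSpace ℝ E] {p : E → ℝ → Fin 2 → ℝ},
      SmoothPeriodic T p → SmoothPeriodic T (fun s x =>
        ![deriv (deriv fun y => p s y 0) x - 3 / 2 * (p s x 0 * p s x 0 - p s x 1 * p s x 1),
        -deriv (deriv fun y => p s y 1) x + 3 * (p s x 0 * p s x 1)]) := fun hp =>
    ((hp.apply 0).deriv.deriv.sub ((((hp.apply 0).mul (hp.apply 0)).sub
      ((hp.apply 1).mul (hp.apply 1))).const_mul _)).vec2
      ((hp.apply 1).deriv.deriv.neg.add (((hp.apply 0).mul (hp.apply 1)).const_mul _))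
  refine hasVarDeriv_of (fun n p hp _ => hsm hp) fun γ hγ _ s => ?_
  have h0 := hγ.apply 0
  have h1 := hγ.apply 1
  have stot := (((h0.deriv.mul h0.deriv).sub (h1.deriv.mul h1.deriv)).add
    (h0.mul (h0.mul h0))).sub ((h0.const_mul (3 : ℝ)).mul (h1.mul h1))
  have hd' := (stot.hasDerivAt_integral s).const_mul (-(1 / 2))
  have h2 : kdvH2 T = fun κ => -(1 / 2) * ∫ x in (0 : ℝ)..T,
      (deriv (fun y => κ y 0) x * deriv (fun y => κ y 0) x
        - deriv (fun y => κ y 1) x * deriv (fun y => κ y 1) x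
      + κ x 0 * (κ x 0 * κ x 0) - 3 * κ x 0 * (κ x 1 * κ x 1)) := by
    funext κ
    simp only [kdvH2]
    congr 2
    funext x
    ring
  rw [h2]
  refine hd'.congr_deriv ?_
  rw [← intervalIntegral.integral_const_mul]
  have l0 := IsLoop.of_smoothPeriodic h0 s
  have l1 := IsLoop.of_smoothPeriodic h1 s
  have m0 := IsLoop.of_smoothPeriodic h0.derivParam s
  have m1 := IsLoop.of_smoothPeriodic h1.derivParam s
  -- The cubic terms agree pointwise. Moving `D` off the variation in the quadratic terms produces
  -- the boundary term `κ₁' κ̇₁ - κ₀' κ̇₀`, the periodic function used here.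
  refine integral_eq_of_hasDerivAt_sub ((stot.derivParam.const_mul _).intervalIntegrable s _ _)
    (intervalIntegrable_dot ((hsm hγ).mem_loops s) (hγ.derivParam.mem_loops s) _ _)
    ((l1.deriv.mul m1).sub (l0.deriv.mul m0)).periodic fun x => ?_
  refine (((l1.deriv.hasDerivAt x).fun_mul (m1.hasDerivAt x)).fun_sub
    ((l0.deriv.hasDerivAt x).fun_mul (m0.hasDerivAt x))).congr_deriv ?_
  have e0 := h0.hasDerivAt s x
  have e1 := h1.hasDerivAt s x
  have f0 := h0.hasDerivAt_deriv s x
  have f1 := h1.hasDerivAt_deriv s x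
  rw [((((f0.fun_mul f0).fun_sub (f1.fun_mul f1)).fun_add (e0.fun_mul (e0.fun_mul e0))).fun_sub
    ((e0.const_mul (3 : ℝ)).fun_mul (e1.fun_mul e1))).deriv]
  simp only [dotProduct, Fin.sum_univ_two, Matrix.cons_val_zero, Matrix.cons_val_one,
    deriv_apply (hγ.hasDerivAt s x).differentiableAt]
  ring

theorem coupledKdV_eq_kdvP {κ : ℝ → Fin 2 → ℝ} (hκ : κ ∈ loops T Set.univ) :
    coupledKdV κ = kdvP κ (fun x => ![κ x 0, -κ x 1]) := by
  have k0 := IsLoop.apply hκ 0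
  have k1 := IsLoop.apply hκ 1
  have n1 : IsLoop T (fun x => -κ x 1) := by simpa using k1.const_mul (-1)
  funext x
  simp only [coupledKdV, kdvP_eq, iteratedDeriv_succ, iteratedDeriv_zero, Matrix.cons_val_zero,
    Matrix.cons_val_one, symOp_apply k0 k0, symOp_apply k0 n1, symOp_apply k1 k0,
    symOp_apply k1 n1, ((k0.hasDerivAt x).fun_mul (k1.hasDerivAt x)).deriv, deriv.fun_neg',
    deriv.fun_neg]
  ext i
  fin_cases i <;> simp <;> ring

theorem coupledKdV_eq_diagD {κ : ℝ → Fin 2 → ℝ} (hκ : κ ∈ loops T Set.univ) :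
    coupledKdV κ = diagD (fun x =>
      ![deriv (deriv fun y => κ y 0) x - 3 / 2 * (κ x 0 * κ x 0 - κ x 1 * κ x 1),
        -deriv (deriv fun y => κ y 1) x + 3 * (κ x 0 * κ x 1)]) := by
  have k0 := IsLoop.apply hκ 0
  have k1 := IsLoop.apply hκ 1
  funext x
  have e0 := k0.hasDerivAt x
  have e1 := k1.hasDerivAt x
  have d0 := ((k0.deriv.deriv.hasDerivAt x).fun_sub
    (((e0.fun_mul e0).fun_sub (e1.fun_mul e1)).const_mul (3 / 2))).deriv
  have d1 := ((k1.deriv.deriv.hasDerivAt x).fun_neg.fun_add ((e0.fun_mul e1).const_mul 3)).deriv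
  simp only [coupledKdV, diagD, iteratedDeriv_succ, iteratedDeriv_zero, Matrix.cons_val_zero,
    Matrix.cons_val_one, d0, d1, (e0.fun_mul e1).deriv]
  ext i
  fin_cases i <;> simp
  ring

end KdVFunctionals

/-! ### The level sets of `k₀` as Poisson submanifolds. -/

section Leaves

variable {T : ℝ}

theorem image_leaf {c : ℝ → ℝ} (hc : c ∈ loops T (Set.Ioi (0 : ℝ))) :
    leaf c '' (sphereInvariants T).carrier =
      {k ∈ (coneInvariants T).carrier | ∀ x, k x 0 = c x} := by
  ext k
  constructor
  · rintro ⟨κ, hκ, rfl⟩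
    refine ⟨?_, fun x => rfl⟩
    have h := (IsLoop.smoothPeriodic (E := ℝ) ⟨hc.1, hc.2.1⟩).vec3
      (IsLoop.apply hκ 0).smoothPeriodic (IsLoop.apply hκ 1).smoothPeriodic
    exact ⟨h.loop 0, h.periodic 0, hc.2.2⟩
  · rintro ⟨hk, h0⟩
    refine ⟨fun x => ![k x 1, k x 2], ?_, ?_⟩
    · exact ((IsLoop.apply hk 1).smoothPeriodic.vec2
        (IsLoop.apply hk 2).smoothPeriodic).mem_loops (0 : ℝ)
    · funext x
      ext i
      fin_cases i
      exacts [(h0 x).symm, rfl, rfl]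

/-- Curves in the leaf do not move `k₀`, so the first component of the ambient gradient drops out of
the pairing. -/
theorem hasVarDeriv_leaf {c : ℝ → ℝ} (hc : c ∈ loops T (Set.Ioi (0 : ℝ)))
    {h : (ℝ → Fin 3 → ℝ) → ℝ} (hh : (coneInvariants T).IsSmooth h) :
    (dotLoopSpace T (Set.univ : Set (Fin 2 → ℝ))).HasVarDeriv (fun κ => h (leaf c κ))
      (fun κ x => ![(coneInvariants T).varDeriv h (leaf c κ) x 1,
        (coneInvariants T).varDeriv h (leaf c κ) x 2]) := by
  have hδ : (dotLoopSpace T {v : Fin 3 → ℝ | 0 < v 0}).HasVarDeriv h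
    ((coneInvariants T).varDeriv h) := hh.hasVarDeriv
  have hl : ∀ {E : Type} [NormedAddCommGroup E] [NormedSpace ℝ E] {p : E → ℝ → Fin 2 → ℝ},
      SmoothPeriodic T p → SmoothPeriodic T (fun s => leaf c (p s)) := fun hp =>
    (IsLoop.smoothPeriodic ⟨hc.1, hc.2.1⟩).vec3 (hp.apply 0) (hp.apply 1)
  refine hasVarDeriv_of (fun n p hp _ => ?_) fun γ hγ _ s => ?_
  · have := smoothPeriodic_varDeriv hδ (hl hp) fun s x => hc.2.2 x
    exact (this.apply 1).vec2 (this.apply 2)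
  · refine (hasDerivAt_functional hδ (hl hγ) (fun s x => hc.2.2 x) s).congr_deriv ?_
    refine intervalIntegral.integral_congr fun x _ => ?_
    simp only [dotProduct, Fin.sum_univ_two, Fin.sum_univ_three,
      deriv_apply (hγ.hasDerivAt s x).differentiableAt,
      deriv_apply ((hl hγ).hasDerivAt s x).differentiableAt]
    simp [leaf]

/-- The level sets of `k₀` are Poisson submanifolds. -/
theorem isPoissonSubmanifold_leaf (hT : 0 < T) {c : ℝ → ℝ} (hc : c ∈ loops T (Set.Ioi (0 : ℝ)))
    (a : ℝ) :
    IsPoissonSubmanifold (coneInvariants T)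
      ((coneInvariants T).opBracket (fun k v => a • P0 k v)) (sphereInvariants T)
      ((sphereInvariants T).opBracket (fun _ v => a • leafOp c v)) (leaf c) where
  mapsTo κ hκ := ((image_leaf hc).subset ⟨κ, hκ, rfl⟩).1
  injOn κ _ κ' _ h := by
    funext x
    ext i
    fin_cases i
    exacts [congrFun (congrFun h x) 1, congrFun (congrFun h x) 2]
  smooth_restrict h hh := ⟨_, hasVarDeriv_leaf hc hh⟩
  exists_extend h hh := by
    have hδ : (dotLoopSpace T (Set.univ : Set (Fin 2 → ℝ))).HasVarDeriv h
      ((sphereInvariants T).varDeriv h) := hh.hasVarDeriv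
    have hl : ∀ {E : Type} [NormedAddCommGroup E] [NormedSpace ℝ E] {p : E → ℝ → Fin 3 → ℝ},
        SmoothPeriodic T p → SmoothPeriodic T (fun s x => ![p s x 1, p s x 2]) := fun hp =>
      (hp.apply 1).vec2 (hp.apply 2)
    -- The extension ignores `k₀`, so its gradient has first component zero.
    refine ⟨fun k => h (fun x => ![k x 1, k x 2]), ⟨fun k x =>
      ![0, (sphereInvariants T).varDeriv h (fun x => ![k x 1, k x 2]) x 0,
        (sphereInvariants T).varDeriv h (fun x => ![k x 1, k x 2]) x 1], ?_⟩, fun κ _ => ?_⟩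
    · refine hasVarDeriv_of (S := {v : Fin 3 → ℝ | 0 < v 0}) (fun n p hp _ => ?_)
        fun γ hγ _ s => ?_
      · have := smoothPeriodic_varDeriv hδ (hl hp) fun _ _ => trivial
        exact (SmoothPeriodic.const 0).vec3 (this.apply 0) (this.apply 1)
      · refine (hasDerivAt_functional hδ (hl hγ) (fun _ _ => trivial) s).congr_deriv ?_
        refine intervalIntegral.integral_congr fun x _ => ?_
        simp only [dotProduct, Fin.sum_univ_two, Fin.sum_univ_three,
          deriv_apply (hγ.hasDerivAt s x).differentiableAt,
          deriv_apply ((hl hγ).hasDerivAt s x).differentiableAt]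
        simp
    · change h (fun x => ![κ x 0, κ x 1]) = h κ
      congr 1
      funext x
      ext i
      fin_cases i <;> rfl
  poisson := (isHamiltonian_leafOp hc a).isPoisson
  restrict h f hh hf κ hκ := by
    -- The gradient chosen by `varDeriv` on the leaf is identified with the truncated ambient one by
    -- uniqueness, available because the leaf is parametrized by all loops in a vector space.
    have e1 : (sphereInvariants T).varDeriv (fun κ => h (leaf c κ)) κ = _ :=
      varDeriv_unique hT (LoopSpace.IsSmooth.hasVarDeriv (M := sphereInvariants T)
        ⟨_, hasVarDeriv_leaf hc hh⟩) (hasVarDeriv_leaf hc hh) hκ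
    have e2 : (sphereInvariants T).varDeriv (fun κ => f (leaf c κ)) κ = _ :=
      varDeriv_unique hT (LoopSpace.IsSmooth.hasVarDeriv (M := sphereInvariants T)
        ⟨_, hasVarDeriv_leaf hc hf⟩) (hasVarDeriv_leaf hc hf) hκ
    rw [LoopSpace.opBracket, LoopSpace.opBracket, e1, e2]
    refine intervalIntegral.integral_congr fun x _ => ?_
    simp [coneInvariants, sphereInvariants, dotProduct, Fin.sum_univ_two, Fin.sum_univ_three, P0, leafOp, leaf]

theorem leafOp_one (v : ℝ → Fin 2 → ℝ) : leafOp (fun _ => 1) v = (2 : ℝ) • diagD v := by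
  funext x
  ext i
  fin_cases i <;> simp [leafOp, diagD] <;> ring

end Leaves

/-! ### Calculus of matrix-valued families. -/

section MatrixCalculus

variable {T : ℝ} {E : Type} [NormedAddCommGroup E] [NormedSpace ℝ E]

theorem hasDerivAt_mat {A : ℝ → Mat} {A' : Mat} {x : ℝ} :
    HasDerivAt A A' x ↔ ∀ i j, HasDerivAt (fun y => A y i j) (A' i j) x :=
  Iff.trans (hasDerivAt_pi (φ := A) (φ' := A')) (forall_congr' fun _ => hasDerivAt_pi)

theorem hasDerivAt_mat_mul {A B : ℝ → Mat} {A' B' : Mat} {x : ℝ} (hA : HasDerivAt A A' x)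
    (hB : HasDerivAt B B' x) : HasDerivAt (fun y => A y * B y) (A' * B x + A x * B') x := by
  rw [hasDerivAt_mat] at *
  intro i j
  simp only [Matrix.mul_apply, Matrix.add_apply, ← Finset.sum_add_distrib]
  exact HasDerivAt.fun_sum fun l _ => (hA i l).fun_mul (hB l j)

theorem hasDerivAt_mat_add {A B : ℝ → Mat} {A' B' : Mat} {x : ℝ} (hA : HasDerivAt A A' x)
    (hB : HasDerivAt B B' x) : HasDerivAt (fun y => A y + B y) (A' + B') x := by
  rw [hasDerivAt_mat] at *
  exact fun i j => (hA i j).fun_add (hB i j)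

theorem hasDerivAt_mat_trace {A : ℝ → Mat} {A' : Mat} {x : ℝ} (hA : HasDerivAt A A' x) :
    HasDerivAt (fun y => (A y).trace) A'.trace x := by
  rw [hasDerivAt_mat] at hA
  exact HasDerivAt.fun_sum fun i _ => hA i i

theorem hasDerivAt_mat_transpose {A : ℝ → Mat} {A' : Mat} {x : ℝ} (hA : HasDerivAt A A' x) :
    HasDerivAt (fun y => (A y)ᵀ) A'ᵀ x := by
  rw [hasDerivAt_mat] at *
  exact fun i j => hA j i

theorem deriv_mat_apply {A : ℝ → Mat} {x : ℝ} (hA : DifferentiableAt ℝ A x) (i j : Fin 4) :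
    deriv A x i j = deriv (fun y => A y i j) x :=
  (hasDerivAt_mat.1 hA.hasDerivAt i j).deriv.symm

namespace SmoothPeriodic

theorem mat {A : E → ℝ → Mat} (hA : ∀ i j, SmoothPeriodic T (fun s x => A s x i j)) :
    SmoothPeriodic T A :=
  pi (p := A) fun i => pi fun j => hA i j

theorem entry {A : E → ℝ → Mat} (hA : SmoothPeriodic T A) (i j : Fin 4) :
    SmoothPeriodic T (fun s x => A s x i j) :=
  (apply (p := A) hA i).apply j

theorem mat_mul {A B : E → ℝ → Mat} (hA : SmoothPeriodic T A) (hB : SmoothPeriodic T B) :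
    SmoothPeriodic T (fun s x => A s x * B s x) :=
  mat fun i j => by
    simp only [Matrix.mul_apply]
    exact sum fun l => (hA.entry i l).mul (hB.entry l j)

theorem mat_transpose {A : E → ℝ → Mat} (hA : SmoothPeriodic T A) :
    SmoothPeriodic T (fun s x => (A s x)ᵀ) :=
  mat fun i j => hA.entry j i

theorem mat_trace {A : E → ℝ → Mat} (hA : SmoothPeriodic T A) :
    SmoothPeriodic T (fun s x => (A s x).trace) :=
  sum fun i => hA.entry i i

theorem mat_deriv {A : E → ℝ → Mat} (hA : SmoothPeriodic T A) :
    SmoothPeriodic T (fun s x => _root_.deriv (A s) x) :=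
  hA.deriv

theorem mat_derivParam {A : ℝ → ℝ → Mat} (hA : SmoothPeriodic T A) :
    SmoothPeriodic T (fun s x => _root_.deriv (fun r => A r x) s) :=
  hA.derivParam

theorem mat_hasDerivAt {A : ℝ → ℝ → Mat} (hA : SmoothPeriodic T A) (s x : ℝ) :
    HasDerivAt (fun r => A r x) (_root_.deriv (fun r => A r x) s) s :=
  hA.hasDerivAt s x

theorem mat_hasDerivAt_loop {A : E → ℝ → Mat} (hA : SmoothPeriodic T A) (s : E) (x : ℝ) :
    HasDerivAt (A s) (_root_.deriv (A s) x) x :=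
  hA.hasDerivAt_loop s x

theorem mat_deriv_comm {A : ℝ → ℝ → Mat} (hA : SmoothPeriodic T A) (s x : ℝ) :
    _root_.deriv (fun r => _root_.deriv (A r) x) s =
      _root_.deriv (fun y => _root_.deriv (fun r => A r y) s) x :=
  deriv_deriv_comm hA.contDiff s x

end SmoothPeriodic

end MatrixCalculus

/-! ### The Lorentz algebra in components, and the isotropy groups. -/

section Lorentz

/-- The element of `𝔬(3,1)` with given components. -/
def o31Mat (α β₁ β₂ γ₁ γ₂ ρ : ℝ) : Mat :=
  !![α, β₁, β₂, 0; γ₁, 0, -ρ, β₁; γ₂, ρ, 0, β₂; 0, γ₁, γ₂, -α]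

theorem mem_o31_iff {X : Mat} : X ∈ o31 ↔ Xᵀ * J + J * X = 0 := by
  change X ∈ skewAdjointMatricesLieSubalgebra J ↔ _
  rw [mem_skewAdjointMatricesLieSubalgebra, mem_skewAdjointMatricesSubmodule,
    Matrix.IsSkewAdjoint, Matrix.IsAdjointPair, mul_neg, eq_neg_iff_add_eq_zero]

theorem o31Mat_mem (α β₁ β₂ γ₁ γ₂ ρ : ℝ) : o31Mat α β₁ β₂ γ₁ γ₂ ρ ∈ o31 := by
  rw [mem_o31_iff]
  ext i j
  fin_cases i <;> fin_cases j <;> simp [o31Mat, J, Matrix.mul_apply, Fin.sum_univ_four]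

theorem eq_o31Mat {X : Mat} (hX : X ∈ o31) :
    X = o31Mat (X 0 0) (X 0 1) (X 0 2) (X 1 0) (X 2 0) (X 2 1) := by
  rw [mem_o31_iff] at hX
  have h : ∀ i j, (Xᵀ * J + J * X) i j = 0 := fun i j => by rw [hX]; rfl
  have h00 := h 0 0
  have h01 := h 0 1
  have h02 := h 0 2
  have h03 := h 0 3
  have h11 := h 1 1
  have h12 := h 1 2
  have h13 := h 1 3
  have h22 := h 2 2
  have h23 := h 2 3
  have h33 := h 3 3
  simp only [Matrix.add_apply, Matrix.mul_apply, Fin.sum_univ_four, Matrix.transpose_apply]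
    at h00 h01 h02 h03 h11 h12 h13 h22 h23 h33
  simp [J] at h00 h01 h02 h03 h11 h12 h13 h22 h23 h33
  ext i j
  fin_cases i <;> fin_cases j <;> simp [o31Mat] <;> linarith

theorem trace_o31Mat_mul (α β₁ β₂ γ₁ γ₂ ρ α' β₁' β₂' γ₁' γ₂' ρ' : ℝ) :
    (o31Mat α β₁ β₂ γ₁ γ₂ ρ * o31Mat α' β₁' β₂' γ₁' γ₂' ρ').trace =
      2 * (α * α' + β₁ * γ₁' + β₂ * γ₂' + γ₁ * β₁' + γ₂ * β₂' - ρ * ρ') := by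
  simp [o31Mat, Matrix.trace, Fin.sum_univ_four]
  ring

theorem lie_o31Mat (α β₁ β₂ γ₁ γ₂ ρ α' β₁' β₂' γ₁' γ₂' ρ' : ℝ) :
    ⁅o31Mat α β₁ β₂ γ₁ γ₂ ρ, o31Mat α' β₁' β₂' γ₁' γ₂' ρ'⁆ =
      o31Mat (β₁ * γ₁' + β₂ * γ₂' - β₁' * γ₁ - β₂' * γ₂)
        (α * β₁' + β₂ * ρ' - α' * β₁ - β₂' * ρ) (α * β₂' - β₁ * ρ' - α' * β₂ + β₁' * ρ)
        (γ₁ * α' - ρ * γ₂' - γ₁' * α + ρ' * γ₂) (γ₂ * α' + ρ * γ₁' - γ₂' * α - ρ' * γ₁)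
        (γ₂ * β₁' + β₂ * γ₁' - γ₂' * β₁ - β₂' * γ₁) := by
  rw [Ring.lie_def]
  ext i j
  fin_cases i <;> fin_cases j <;>
    simp [o31Mat] <;> ring

theorem o31Mat_add (α β₁ β₂ γ₁ γ₂ ρ α' β₁' β₂' γ₁' γ₂' ρ' : ℝ) :
    o31Mat α β₁ β₂ γ₁ γ₂ ρ + o31Mat α' β₁' β₂' γ₁' γ₂' ρ' =
      o31Mat (α + α') (β₁ + β₁') (β₂ + β₂') (γ₁ + γ₁') (γ₂ + γ₂') (ρ + ρ') := by
  ext i j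
  fin_cases i <;> fin_cases j <;> simp [o31Mat] <;> ring

theorem smul_KL (ε : ℝ) (k : Fin 3 → ℝ) :
    ε • KL k = o31Mat 0 (-(ε * k 0)) 0 (-(ε * k 1)) (-(ε * k 2)) 0 := by
  ext i j
  fin_cases i <;> fin_cases j <;> simp [o31Mat, KL]

theorem KM_eq_KL (κ : Fin 2 → ℝ) : KM κ = KL ![1, κ 0, κ 1] := by
  ext i j
  fin_cases i <;> fin_cases j <;> simp [KM, KL]

theorem L0_eq : L0 = o31Mat 0 0 0 1 0 0 := by
  ext i j
  fin_cases i <;> fin_cases j <;> simp [L0, o31Mat]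

theorem J_mul_J : J * J = 1 := by
  ext i j
  fin_cases i <;> fin_cases j <;> simp [J, Matrix.mul_apply, Fin.sum_univ_four]

theorem J_transpose : Jᵀ = J := by
  ext i j
  fin_cases i <;> fin_cases j <;> simp [J]

variable {g : Mat}

theorem lorentz_left_inv (hg : gᵀ * J * g = J) : (J * gᵀ * J) * g = 1 := by
  rw [Matrix.mul_assoc, Matrix.mul_assoc, ← Matrix.mul_assoc gᵀ, hg, J_mul_J]

theorem lorentz_inv (hg : gᵀ * J * g = J) : g⁻¹ = J * gᵀ * J :=
  Matrix.inv_eq_left_inv (lorentz_left_inv hg)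

theorem lorentz_inv_mul (hg : gᵀ * J * g = J) : g⁻¹ * g = 1 := by
  rw [lorentz_inv hg, lorentz_left_inv hg]

theorem lorentz_mul_inv (hg : gᵀ * J * g = J) : g * g⁻¹ = 1 :=
  mul_eq_one_comm.1 (lorentz_inv_mul hg)

theorem conj_mem_o31 (hg : gᵀ * J * g = J) {X : Mat} (hX : X ∈ o31) : g⁻¹ * X * g ∈ o31 := by
  rw [mem_o31_iff] at *
  have h1 : (g⁻¹)ᵀ = J * g * J := by
    rw [lorentz_inv hg, Matrix.transpose_mul, Matrix.transpose_mul, Matrix.transpose_transpose,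
      J_transpose, Matrix.mul_assoc]
  have h2 : J * g⁻¹ = gᵀ * J := by
    rw [lorentz_inv hg, ← Matrix.mul_assoc, ← Matrix.mul_assoc, J_mul_J, Matrix.one_mul]
  have h3 : J * g * J * J = J * g := by rw [Matrix.mul_assoc, J_mul_J, Matrix.mul_one]
  have h4 : (g⁻¹)ᵀ * J = J * g := by rw [h1, h3]
  have h5 : gᵀ * (Xᵀ * J + J * X) * g = 0 := by rw [hX]; simp
  have h6 : (g⁻¹ * X * g)ᵀ * J = gᵀ * (Xᵀ * J) * g := by
    have : gᵀ * J * g * J = 1 := by rw [hg, J_mul_J]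
    have h7 : (g⁻¹)ᵀ * J = J * g := h4
    rw [Matrix.transpose_mul, Matrix.transpose_mul]
    simp only [Matrix.mul_assoc]
    rw [h7]
  rw [h6]
  have h7 : J * (g⁻¹ * X * g) = gᵀ * (J * X) * g := by
    simp only [← Matrix.mul_assoc]
    rw [h2]
  rw [h7, ← Matrix.add_mul, ← Matrix.mul_add]
  exact h5

theorem HL_subset_HM : HL ⊆ HM := fun _ hg => ⟨hg.1, hg.2.1, 1, one_pos, by simpa using hg.2.2⟩

theorem HM_mul_mem {g g' : Mat} (hg : g ∈ HM) (hg' : g' ∈ HM) : g * g' ∈ HM := by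
  obtain ⟨h1, h2, r, hr, h3⟩ := hg
  obtain ⟨h1', h2', r', hr', h3'⟩ := hg'
  refine ⟨?_, by rw [Matrix.det_mul, h2, h2', one_mul], r' * r, mul_pos hr' hr, ?_⟩
  · rw [Matrix.transpose_mul, Matrix.mul_assoc, Matrix.mul_assoc, ← Matrix.mul_assoc J,
      ← Matrix.mul_assoc gᵀ, ← Matrix.mul_assoc gᵀ, h1, ← Matrix.mul_assoc, h1']
  · rw [← Matrix.mulVec_mulVec, h3', Matrix.mulVec_smul, h3, smul_smul]

theorem HL_mul_mem {g g' : Mat} (hg : g ∈ HL) (hg' : g' ∈ HL) : g * g' ∈ HL := by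
  have := HM_mul_mem (HL_subset_HM hg) (HL_subset_HM hg')
  refine ⟨this.1, this.2.1, ?_⟩
  rw [← Matrix.mulVec_mulVec, hg'.2.2, hg.2.2]

theorem one_mem_HL : (1 : Mat) ∈ HL := ⟨by simp, by simp, by simp⟩

end Lorentz

/-! ### The moving frame. -/

section NormalForm

/-- The entries of an element of `H_M`. -/
structure IsIsotropy (g : Mat) : Prop where
  pos : 0 < g 3 3
  e03 : g 0 3 = 0
  e13 : g 1 3 = 0
  e23 : g 2 3 = 0
  e01 : g 0 1 = 0
  e02 : g 0 2 = 0
  e00 : g 0 0 = 1 / g 3 3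
  unit : g 1 1 ^ 2 + g 1 2 ^ 2 = 1
  e22 : g 2 2 = g 1 1
  e21 : g 2 1 = -g 1 2
  e20 : g 2 0 = g 0 0 * (g 3 1 * g 2 1 + g 3 2 * g 2 2)
  e30 : g 3 0 = g 3 3 * (g 1 0 ^ 2 + g 2 0 ^ 2) / 2

theorem mulVec_e4 (g : Mat) (i : Fin 4) : (g *ᵥ e4) i = g i 3 := by
  simp [Matrix.mulVec, dotProduct, e4, Fin.sum_univ_four]

/-- The last column is `(0, 0, 0, g₃₃)`. Its Minkowski products with the other columns give `g₀₁ =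
g₀₂ = 0` and `g₀₀ g₃₃ = 1`. The middle `2 × 2` block is then orthogonal with determinant `1`, hence
a rotation, and the products involving the first column determine `g₂₀` and `g₃₀`. -/
theorem isIsotropy_of_mem {g : Mat} (hg : g ∈ HM) : IsIsotropy g := by
  obtain ⟨hJ, hdet, r, hr, he⟩ := hg
  have hc : ∀ i, g i 3 = r * e4 i := fun i =>
    (mulVec_e4 g i).symm.trans (by rw [he]; rfl)
  have h03 : g 0 3 = 0 := by simpa [e4] using hc 0
  have h13 : g 1 3 = 0 := by simpa [e4] using hc 1
  have h23 : g 2 3 = 0 := by simpa [e4] using hc 2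
  have h33 : 0 < g 3 3 := by
    have : g 3 3 = r := by simpa [e4] using hc 3
    rwa [this]
  have h : ∀ i j, (gᵀ * J * g) i j = J i j := fun i j => by rw [hJ]
  have h30 := h 3 0
  have h31 := h 3 1
  have h32 := h 3 2
  have h11 := h 1 1
  have h12 := h 1 2
  have h22 := h 2 2
  have h00 := h 0 0
  have h01 := h 0 1
  have h02 := h 0 2
  simp only [Matrix.mul_apply, Fin.sum_univ_four, Matrix.transpose_apply]
    at h30 h31 h32 h11 h12 h22 h00 h01 h02
  simp [J, h03, h13, h23] at h30 h31 h32 h11 h12 h22 h00 h01 h02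
  have e01 : g 0 1 = 0 := h31.resolve_left h33.ne'
  have e02 : g 0 2 = 0 := h32.resolve_left h33.ne'
  simp only [e01, e02, mul_zero, zero_mul, neg_zero, add_zero, zero_add] at h11 h12 h22 h01 h02
  have hd : g.det = g 3 3 * g 0 0 * (g 1 1 * g 2 2 - g 1 2 * g 2 1) := by
    rw [Matrix.det_succ_row_zero]
    simp [Fin.sum_univ_succ, Matrix.det_fin_three, e01, e02, h03, Fin.succAbove]
    simp [h13, h23]
    ring
  rw [hdet, h30, one_mul] at hd
  have e22 : g 2 2 = g 1 1 := by
    linear_combination (-g 2 2) * h11 + g 2 1 * h12 - g 1 1 * hd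
  have e21 : g 2 1 = -g 1 2 := by
    linear_combination (-g 2 1) * h22 + g 2 2 * h12 + g 1 2 * hd
  have hu : g 1 1 ^ 2 + g 1 2 ^ 2 = 1 := by
    rw [e21] at h11
    linear_combination h11
  refine ⟨h33, h03, h13, h23, e01, e02, ?_, hu, e22, e21, ?_, ?_⟩
  · rw [eq_div_iff h33.ne']
    linear_combination h30
  · rw [e21] at h01 ⊢
    rw [e22] at h02 ⊢
    linear_combination (-g 1 2) * h01 + g 1 1 * h02 - g 2 0 * hu
  · linear_combination (-(g 3 3 / 2)) * h00 - g 3 0 * h30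

theorem mul_gauge {g K : ℝ → Mat} {x : ℝ} (hg : (g x)ᵀ * J * g x = J) :
    g x * gauge g K x = deriv g x + K x * g x := by
  rw [gauge, Matrix.mul_add, ← Matrix.mul_assoc, lorentz_mul_inv hg, Matrix.one_mul,
    Matrix.mul_assoc (g x)⁻¹, ← Matrix.mul_assoc (g x), lorentz_mul_inv hg, Matrix.one_mul]

theorem eq_gauge {g K L : ℝ → Mat} {x : ℝ} (hg : (g x)ᵀ * J * g x = J)
    (h : g x * L x = deriv g x + K x * g x) : L x = gauge g K x := by
  rw [← mul_gauge hg] at h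
  have := congrArg (fun A => (g x)⁻¹ * A) h
  simpa only [← Matrix.mul_assoc, lorentz_inv_mul hg, Matrix.one_mul] using this

/-- The moving frame `g` and the invariants `k` of `L = g⁻¹ g' + g⁻¹ (ε K_L(k)) g` in terms of
`L`, `g₃₃` and `k₀`. -/
structure IsFrame (ε : ℝ) (g : ℝ → Mat) (k : ℝ → Fin 3 → ℝ) (L : ℝ → Mat) : Prop where
  norm : ∀ x, g x 3 3 * k x 0 = Real.sqrt (L x 0 1 ^ 2 + L x 0 2 ^ 2)
  e11 : ∀ x, g x 1 1 = -ε * L x 0 1 / (g x 3 3 * k x 0)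
  e12 : ∀ x, g x 1 2 = -ε * L x 0 2 / (g x 3 3 * k x 0)
  e10 : ∀ x, g x 1 0 = ε * (deriv (fun y => g y 0 0) x - g x 0 0 * L x 0 0) / k x 0
  e31 : ∀ x, g x 3 1 = ε * (deriv (fun y => g y 1 1) x
    - (g x 1 0 * L x 0 1 + g x 1 1 * L x 1 1 + g x 1 2 * L x 2 1)) / k x 0
  e32 : ∀ x, g x 3 2 = ε * (deriv (fun y => g y 1 2) x
    - (g x 1 0 * L x 0 2 + g x 1 1 * L x 1 2 + g x 1 2 * L x 2 2)) / k x 0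
  k1 : ∀ x, k x 1 = ε * g x 3 3 * (deriv (fun y => g y 1 0) x
    - (g x 1 0 * L x 0 0 + g x 1 1 * L x 1 0 + g x 1 2 * L x 2 0)) - k x 0 * g x 3 3 * g x 3 0
  k2 : ∀ x, k x 2 = ε * g x 3 3 * (deriv (fun y => g y 2 0) x
    - (g x 2 0 * L x 0 0 + g x 2 1 * L x 1 0 + g x 2 2 * L x 2 0))

/-- Compares entries of `g L = g_x + ε K g`, which is linear in `L` and avoids `g⁻¹`. The entries
`01, 02` give the rotation, and its unit length the norm relation; `00` gives `g₁₀`; `11, 12` give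
`g₃₁, g₃₂`; `10, 20` give `k₁, k₂`. -/
theorem isFrame_gauge {ε : ℝ} (hε : ε * ε = 1) {g : ℝ → Mat} {k : ℝ → Fin 3 → ℝ}
    (hg : ∀ x, g x ∈ HM) (hd : Differentiable ℝ g) (hk : ∀ x, 0 < k x 0) :
    IsFrame ε g k (gauge g (fun x => ε • KL (k x))) := by
  set L := gauge g (fun x => ε • KL (k x)) with hL
  have hm : ∀ x i j, (g x * L x) i j = deriv (fun y => g y i j) x + (ε • KL (k x) * g x) i j := by
    intro x i j
    rw [hL, mul_gauge (hg x).1, Matrix.add_apply, deriv_mat_apply (hd x)]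
  have hI := fun x => isIsotropy_of_mem (hg x)
  have z01 : (fun y => g y 0 1) = fun _ => 0 := funext fun y => (hI y).e01
  have z02 : (fun y => g y 0 2) = fun _ => 0 := funext fun y => (hI y).e02
  have m01 := fun x => hm x 0 1
  have m02 := fun x => hm x 0 2
  have m00 := fun x => hm x 0 0
  have m11 := fun x => hm x 1 1
  have m12 := fun x => hm x 1 2
  have m10 := fun x => hm x 1 0
  have m20 := fun x => hm x 2 0
  simp only [Matrix.mul_apply, Fin.sum_univ_four, Matrix.smul_apply, z01, z02, deriv_const]
    at m01 m02 m00 m11 m12 m10 m20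
  simp [KL, (hI _).e01, (hI _).e02, (hI _).e03, (hI _).e13, (hI _).e23]
    at m01 m02 m00 m11 m12 m10 m20
  have hr := fun x => (hI x).pos
  have h00 : ∀ x, g x 0 0 * g x 3 3 = 1 := fun x => by
    rw [(hI x).e00, one_div_mul_cancel (hr x).ne']
  have e11 : ∀ x, g x 3 3 * k x 0 * g x 1 1 = -ε * L x 0 1 := fun x => by
    linear_combination (ε * g x 3 3) * m01 x - ε * L x 0 1 * h00 x
      - (g x 3 3 * k x 0 * g x 1 1) * hε
  have e12 : ∀ x, g x 3 3 * k x 0 * g x 1 2 = -ε * L x 0 2 := fun x => by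
    linear_combination (ε * g x 3 3) * m02 x - ε * L x 0 2 * h00 x
      - (g x 3 3 * k x 0 * g x 1 2) * hε
  refine ⟨fun x => ?_, fun x => ?_, fun x => ?_, fun x => ?_, fun x => ?_, fun x => ?_,
    fun x => ?_, fun x => ?_⟩
  · have hpos := mul_pos (hr x) (hk x)
    symm
    rw [Real.sqrt_eq_iff_mul_self_eq_of_pos hpos]
    have u := (hI x).unit
    have a1 := e11 x
    have a2 := e12 x
    linear_combination (-(g x 3 3 * k x 0) ^ 2) * u + (g x 3 3 * k x 0 * g x 1 1 - ε * L x 0 1) * a1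
      + (g x 3 3 * k x 0 * g x 1 2 - ε * L x 0 2) * a2 + (L x 0 1 ^ 2 + L x 0 2 ^ 2) * hε
  · rw [eq_div_iff (mul_pos (hr x) (hk x)).ne']
    linear_combination e11 x
  · rw [eq_div_iff (mul_pos (hr x) (hk x)).ne']
    linear_combination e12 x
  · rw [eq_div_iff (hk x).ne']
    linear_combination ε * m00 x - (k x 0 * g x 1 0) * hε
  · rw [eq_div_iff (hk x).ne']
    linear_combination ε * m11 x - (k x 0 * g x 3 1) * hε
  · rw [eq_div_iff (hk x).ne']
    linear_combination ε * m12 x - (k x 0 * g x 3 2) * hε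
  · linear_combination (ε * g x 3 3) * m10 x
      - (k x 1 * g x 0 0 * g x 3 3 + k x 0 * g x 3 3 * g x 3 0) * hε - k x 1 * h00 x
  · linear_combination (ε * g x 3 3) * m20 x - (k x 2 * g x 0 0 * g x 3 3) * hε - k x 2 * h00 x

/-- No joint smoothness of `g` and `k` is assumed beyond `g₃₃` and `k₀`: the formulas of `IsFrame`
and `IsIsotropy` are triangular and differentiate only entries already shown to be smooth. -/
theorem SmoothPeriodic.of_isFrame {T : ℝ} {E : Type} [NormedAddCommGroup E] [NormedSpace ℝ E]
    {ε : ℝ} {g L : E → ℝ → Mat} {k : E → ℝ → Fin 3 → ℝ} (hF : ∀ s, IsFrame ε (g s) (k s) (L s))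
    (hg : ∀ s x, g s x ∈ HM) (hk : ∀ s x, 0 < k s x 0) (hL : SmoothPeriodic T L)
    (h33 : SmoothPeriodic T (fun s x => g s x 3 3)) (hk0 : SmoothPeriodic T (fun s x => k s x 0)) :
    SmoothPeriodic T g ∧ SmoothPeriodic T k := by
  have hI := fun s x => isIsotropy_of_mem (hg s x)
  have hk' := fun s x => (hk s x).ne'
  have hrk : ∀ s x, g s x 3 3 * k s x 0 ≠ 0 := fun s x => (mul_pos (hI s x).pos (hk s x)).ne'
  have z : ∀ {i j}, (∀ s x, g s x i j = 0) → SmoothPeriodic T (fun s x => g s x i j) :=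
    fun h => by simpa only [h] using SmoothPeriodic.const (0 : ℝ)
  have h00 : SmoothPeriodic T (fun s x => g s x 0 0) := by
    simp only [(hI _ _).e00]
    exact (SmoothPeriodic.const 1).div h33 fun s x => (hI s x).pos.ne'
  have h11 : SmoothPeriodic T (fun s x => g s x 1 1) := by
    simp only [(hF _).e11]
    exact ((hL.entry 0 1).const_mul (-ε)).div (h33.mul hk0) hrk
  have h12 : SmoothPeriodic T (fun s x => g s x 1 2) := by
    simp only [(hF _).e12]
    exact ((hL.entry 0 2).const_mul (-ε)).div (h33.mul hk0) hrk
  have h10 : SmoothPeriodic T (fun s x => g s x 1 0) := by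
    simp only [(hF _).e10]
    exact ((h00.deriv.sub (h00.mul (hL.entry 0 0))).const_mul ε).div hk0 hk'
  have h22 : SmoothPeriodic T (fun s x => g s x 2 2) := by simpa only [(hI _ _).e22] using h11
  have h21 : SmoothPeriodic T (fun s x => g s x 2 1) := by simpa only [(hI _ _).e21] using h12.neg
  have h31 : SmoothPeriodic T (fun s x => g s x 3 1) := by
    simp only [(hF _).e31]
    exact ((h11.deriv.sub (((h10.mul (hL.entry 0 1)).add (h11.mul (hL.entry 1 1))).add
      (h12.mul (hL.entry 2 1)))).const_mul ε).div hk0 hk'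
  have h32 : SmoothPeriodic T (fun s x => g s x 3 2) := by
    simp only [(hF _).e32]
    exact ((h12.deriv.sub (((h10.mul (hL.entry 0 2)).add (h11.mul (hL.entry 1 2))).add
      (h12.mul (hL.entry 2 2)))).const_mul ε).div hk0 hk'
  have h20 : SmoothPeriodic T (fun s x => g s x 2 0) := by
    simp only [(hI _ _).e20]
    exact h00.mul ((h31.mul h21).add (h32.mul h22))
  have h30 : SmoothPeriodic T (fun s x => g s x 3 0) := by
    simp only [(hI _ _).e30, pow_two]
    exact (h33.mul ((h10.mul h10).add (h20.mul h20))).div (.const 2) fun _ _ => two_ne_zero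
  have hk1 : SmoothPeriodic T (fun s x => k s x 1) := by
    simp only [(hF _).k1]
    exact ((h33.const_mul ε).mul (h10.deriv.sub (((h10.mul (hL.entry 0 0)).add
      (h11.mul (hL.entry 1 0))).add (h12.mul (hL.entry 2 0))))).sub ((hk0.mul h33).mul h30)
  have hk2 : SmoothPeriodic T (fun s x => k s x 2) := by
    simp only [(hF _).k2]
    exact (h33.const_mul ε).mul (h20.deriv.sub (((h20.mul (hL.entry 0 0)).add
      (h21.mul (hL.entry 1 0))).add (h22.mul (hL.entry 2 0))))
  constructor
  · refine SmoothPeriodic.mat fun i j => ?_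
    fin_cases i <;> fin_cases j
    exacts [h00, z fun s x => (hI s x).e01, z fun s x => (hI s x).e02, z fun s x => (hI s x).e03,
      h10, h11, h12, z fun s x => (hI s x).e13, h20, h21, h22, z fun s x => (hI s x).e23,
      h30, h31, h32, h33]
  · refine SmoothPeriodic.pi fun i => ?_
    fin_cases i
    exacts [hk0, hk1, hk2]

theorem IsFrame.unique {ε : ℝ} {g g' L : ℝ → Mat} {k k' : ℝ → Fin 3 → ℝ} (hF : IsFrame ε g k L)
    (hF' : IsFrame ε g' k' L) (hg : ∀ x, g x ∈ HM) (hg' : ∀ x, g' x ∈ HM)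
    (h33 : ∀ x, g x 3 3 = g' x 3 3) (h0 : ∀ x, k x 0 = k' x 0) : k = k' := by
  have hI := fun x => isIsotropy_of_mem (hg x)
  have hI' := fun x => isIsotropy_of_mem (hg' x)
  have h00 : ∀ x, g x 0 0 = g' x 0 0 := fun x => by rw [(hI x).e00, (hI' x).e00, h33]
  have h11 : ∀ x, g x 1 1 = g' x 1 1 := fun x => by rw [hF.e11, hF'.e11, h33, h0]
  have h12 : ∀ x, g x 1 2 = g' x 1 2 := fun x => by rw [hF.e12, hF'.e12, h33, h0]
  have h10 : ∀ x, g x 1 0 = g' x 1 0 := fun x => by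
    rw [hF.e10, hF'.e10, funext h00, h00, h0]
  have h31 : ∀ x, g x 3 1 = g' x 3 1 := fun x => by
    rw [hF.e31, hF'.e31, funext h11, h11, h10, h12, h0]
  have h32 : ∀ x, g x 3 2 = g' x 3 2 := fun x => by
    rw [hF.e32, hF'.e32, funext h12, h11, h10, h12, h0]
  have h20 : ∀ x, g x 2 0 = g' x 2 0 := fun x => by
    rw [(hI x).e20, (hI' x).e20, h00, h31, h32, (hI x).e21, (hI' x).e21, (hI x).e22, (hI' x).e22,
      h11, h12]
  have h30 : ∀ x, g x 3 0 = g' x 3 0 := fun x => by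
    rw [(hI x).e30, (hI' x).e30, h33, h10, h20]
  funext x
  ext i
  fin_cases i
  · exact h0 x
  · change k x 1 = k' x 1
    rw [hF.k1, hF'.k1, funext h10, h10, h11, h12, h33, h0, h30]
  · change k x 2 = k' x 2
    rw [hF.k2, hF'.k2, funext h20, h20, (hI x).e21, (hI' x).e21, (hI x).e22, (hI' x).e22,
      h11, h12, h33]

end NormalForm

/-! ### The gauge action and its infinitesimal form. -/

section GaugeCalculus

variable {T : ℝ} {E : Type} [NormedAddCommGroup E] [NormedSpace ℝ E]

theorem SmoothPeriodic.lorentz_inv {g : E → ℝ → Mat} (hg : SmoothPeriodic T g)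
    (hJ : ∀ s x, (g s x)ᵀ * J * g s x = J) : SmoothPeriodic T (fun s x => (g s x)⁻¹) := by
  simp only [LightCone.lorentz_inv (hJ _ _)]
  exact ((SmoothPeriodic.const J).mat_mul hg.mat_transpose).mat_mul (.const J)

theorem SmoothPeriodic.gauge {g K : E → ℝ → Mat} (hg : SmoothPeriodic T g)
    (hJ : ∀ s x, (g s x)ᵀ * J * g s x = J) (hK : SmoothPeriodic T K) :
    SmoothPeriodic T (fun s => gauge (g s) (K s)) :=
  ((hg.lorentz_inv hJ).mat_mul hg.mat_deriv).add (((hg.lorentz_inv hJ).mat_mul hK).mat_mul hg)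

theorem deriv_mat_eq {A : ℝ → Mat} {A' : Mat} {x : ℝ} (hA : HasDerivAt A A' x) :
    deriv A x = A' :=
  hA.deriv

theorem deriv_mat_mul {A B : ℝ → Mat} {A' B' : Mat} {x : ℝ} (hA : HasDerivAt A A' x)
    (hB : HasDerivAt B B' x) : deriv (fun y => A y * B y) x = A' * B x + A x * B' :=
  (hasDerivAt_mat_mul hA hB).deriv

/-- The derivative of a curve `g⁻¹ g_x + g⁻¹ K g` is `g⁻¹ (ξ_x + K̇ + [K, ξ]) g` with
`ξ = ġ g⁻¹`. -/
theorem deriv_gauge {g K : ℝ → ℝ → Mat} (hg : SmoothPeriodic T g)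
    (hJ : ∀ s x, (g s x)ᵀ * J * g s x = J) (hK : SmoothPeriodic T K) (s x : ℝ) :
    deriv (fun r => gauge (g r) (K r) x) s =
      (g s x)⁻¹ * (deriv (fun y => deriv (fun r => g r y) s * (g s y)⁻¹) x
        + deriv (fun r => K r x) s + ⁅K s x, deriv (fun r => g r x) s * (g s x)⁻¹⁆) * g s x := by
  have hinv := hg.lorentz_inv hJ
  have hξ : SmoothPeriodic T (fun s y => deriv (fun r => g r y) s * (g s y)⁻¹) :=
    hg.mat_derivParam.mat_mul hinv
  set ξ : ℝ → Mat := fun y => deriv (fun r => g r y) s * (g s y)⁻¹ with hξd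
  have hγ := hg.gauge hJ hK
  have eξ : ∀ y, deriv (fun r => g r y) s = ξ y * g s y := fun y => by
    rw [hξd, Matrix.mul_assoc, lorentz_inv_mul (hJ s y), Matrix.mul_one]
  have dξ : deriv (fun r => deriv (g r) x) s = deriv ξ x * g s x + ξ x * deriv (g s) x := by
    rw [hg.mat_deriv_comm, funext eξ]
    exact deriv_mat_mul (hξ.mat_hasDerivAt_loop s x) (hg.mat_hasDerivAt_loop s x)
  have h1 : (fun r => g r x * gauge (g r) (K r) x) = fun r => deriv (g r) x + K r x * g r x :=
    funext fun r => mul_gauge (hJ r x)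
  have h2 := deriv_mat_mul (hg.mat_hasDerivAt s x) (hγ.mat_hasDerivAt s x)
  have h3 := deriv_mat_eq (hasDerivAt_mat_add (hg.mat_deriv.mat_hasDerivAt s x)
    (hasDerivAt_mat_mul (hK.mat_hasDerivAt s x) (hg.mat_hasDerivAt s x)))
  rw [h1, h3, dξ, eξ x, Matrix.mul_assoc (ξ x) (g s x) (gauge (g s) (K s) x),
    mul_gauge (hJ s x)] at h2
  have h4 : g s x * deriv (fun r => gauge (g r) (K r) x) s =
      (deriv ξ x + deriv (fun r => K r x) s + ⁅K s x, ξ x⁆) * g s x := by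
    rw [← sub_eq_iff_eq_add'] at h2
    rw [← h2, Ring.lie_def]
    noncomm_ring
  have h5 := congrArg (fun A => (g s x)⁻¹ * A) h4
  simpa only [← Matrix.mul_assoc, lorentz_inv_mul (hJ s x), Matrix.one_mul] using h5

theorem trace_conj_mul_conj {g A B : Mat} (hJ : gᵀ * J * g = J) :
    ((g⁻¹ * A * g) * (g⁻¹ * B * g)).trace = (A * B).trace := by
  have : (g⁻¹ * A * g) * (g⁻¹ * B * g) = g⁻¹ * (A * (g * g⁻¹) * B * g) := by
    simp only [Matrix.mul_assoc]
  rw [this, lorentz_mul_inv hJ, Matrix.mul_one, Matrix.trace_mul_comm, Matrix.mul_assoc,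
    lorentz_mul_inv hJ, Matrix.mul_one]

theorem trace_mul_lie (Q K X : Mat) : (Q * ⁅K, X⁆).trace = -(⁅K, Q⁆ * X).trace := by
  rw [Ring.lie_def, Ring.lie_def, Matrix.mul_sub, Matrix.sub_mul, Matrix.trace_sub,
    Matrix.trace_sub, Matrix.mul_assoc Q K X, ← Matrix.mul_assoc Q X K, Matrix.trace_mul_comm (Q * X),
    Matrix.mul_assoc K Q X]
  ring

theorem gauge_gauge {g g' K : ℝ → Mat} {x : ℝ} (hd : DifferentiableAt ℝ g x)
    (hd' : DifferentiableAt ℝ g' x) (hJ : (g x)ᵀ * J * g x = J) (hJ' : (g' x)ᵀ * J * g' x = J) :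
    gauge g' (gauge g K) x = gauge (fun y => g y * g' y) K x := by
  have hgg : (g x * g' x)ᵀ * J * (g x * g' x) = J := by
    rw [Matrix.transpose_mul, Matrix.mul_assoc, Matrix.mul_assoc, ← Matrix.mul_assoc J,
      ← Matrix.mul_assoc (g x)ᵀ, ← Matrix.mul_assoc (g x)ᵀ, hJ, ← Matrix.mul_assoc, hJ']
  refine eq_gauge (g := fun y => g y * g' y) (K := K) (L := gauge g' (gauge g K)) hgg ?_
  rw [Matrix.mul_assoc, mul_gauge hJ', Matrix.mul_add, ← Matrix.mul_assoc (g x) (gauge g K x),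
    mul_gauge hJ, deriv_mat_mul (A' := deriv g x) (B' := deriv g' x) hd.hasDerivAt hd'.hasDerivAt]
  rw [Matrix.add_mul, Matrix.mul_assoc (K x)]
  ext i j
  simp only [Matrix.add_apply]
  ring

theorem gauge_one (K : ℝ → Mat) : gauge (fun _ => 1) K = K := by
  funext x
  have h : deriv (fun _ : ℝ => (1 : Mat)) x = 0 := deriv_const x _
  simp [gauge, h]

end GaugeCalculus

/-! ### Leafwise constant extensions over a general section. -/

section Extension

variable {m : ℕ} {T : ℝ} {S : Set (Fin m → ℝ)} {H : Set Mat} {K : (Fin m → ℝ) → Mat} {𝔥 : Set Mat}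

/-- A section `K` of the gauge action of a group `H` with Lie algebra `𝔥`: the invariants `k` of
`g⁻¹ g_x + g⁻¹ K(k) g` are unique, and `g` and `k` depend smoothly on this loop. -/
structure IsSection (T : ℝ) (H : Set Mat) (S : Set (Fin m → ℝ)) (K : (Fin m → ℝ) → Mat)
    (𝔥 : Set Mat) : Prop where
  lorentz : ∀ g ∈ H, gᵀ * J * g = J
  mul_mem : ∀ g ∈ H, ∀ g' ∈ H, g * g' ∈ H
  one_mem : (1 : Mat) ∈ H
  smooth : ∀ {E : Type} [NormedAddCommGroup E] [NormedSpace ℝ E] (k : E → ℝ → Fin m → ℝ),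
    SmoothPeriodic T k → SmoothPeriodic T (fun s x => K (k s x))
  unique : ∀ k ∈ loops T S, ∀ k' ∈ loops T S, ∀ g ∈ loops T H, ∀ g' ∈ loops T H,
    gauge g (fun x => K (k x)) = gauge g' (fun x => K (k' x)) → k = k'
  frame : ∀ {E : Type} [NormedAddCommGroup E] [NormedSpace ℝ E] (L g : E → ℝ → Mat)
    (k : E → ℝ → Fin m → ℝ), SmoothPeriodic T L → (∀ s, k s ∈ loops T S) → (∀ s, g s ∈ loops T H) →
    (∀ s, L s = gauge (g s) (fun x => K (k s x))) → SmoothPeriodic T g ∧ SmoothPeriodic T k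
  lie : ∀ (g : ℝ → Mat) (g' : Mat) (s : ℝ), HasDerivAt g g' s → (∀ r, g r ∈ H) →
    g' * (g s)⁻¹ ∈ 𝔥

/-- The extension is `L ↦ h (k(L))`, with `k(L)` the invariants of `L`. `Q k d` is a covector at the
section: `hQK` says that it pairs with section directions like the gradient `d`, and `hQX`, after
integration by parts, that it annihilates the gauge directions `ξ_x + [K, ξ]`. Invariance carries it
to the covector `g⁻¹ Q g` elsewhere on the leaf. -/
theorem IsSection.exists_gaugeExtension (hK : IsSection T H S K 𝔥)
    (Q : (ℝ → Fin m → ℝ) → (ℝ → Fin m → ℝ) → ℝ → Mat)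
    (hQ : ∀ {E : Type} [NormedAddCommGroup E] [NormedSpace ℝ E] (k d : E → ℝ → Fin m → ℝ),
      SmoothPeriodic T k → (∀ s x, k s x ∈ S) → SmoothPeriodic T d →
      SmoothPeriodic T (fun s => Q (k s) (d s)))
    (hQo : ∀ k d x, Q k d x ∈ o31)
    (hQK : ∀ (k : ℝ → ℝ → Fin m → ℝ), SmoothPeriodic T k → ∀ (d : ℝ → Fin m → ℝ) (s x : ℝ),
      (Q (k s) d x * deriv (fun r => K (k r x)) s).trace = d x ⬝ᵥ deriv (fun r => k r x) s)
    (hQX : ∀ k ∈ loops T S, ∀ d ∈ loops T Set.univ, ∀ X ∈ 𝔥, ∀ x,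
      ((deriv (Q k d) x + ⁅K (k x), Q k d x⁆) * X).trace = 0)
    {h : (ℝ → Fin m → ℝ) → ℝ} (hh : (dotLoopSpace T S).IsSmooth h) :
    ∃ Hext, IsGaugeExtension H (dotLoopSpace T S) (fun k x => K (k x)) h Hext := by
  classical
  set U := gaugeDomain H (dotLoopSpace T S) (fun k x => K (k x)) with hU
  -- A pair `(k, g)` is chosen for each `L` separately; `unique` makes `k` independent of the choice
  -- and `frame` makes the chosen pairs smooth in families. Off the domain the value is irrelevant.
  have hex : ∀ L : ℝ → Mat, ∃ q : (ℝ → Fin m → ℝ) × (ℝ → Mat), L ∈ U.carrier →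
      q.1 ∈ loops T S ∧ q.2 ∈ loops T H ∧ L = gauge q.2 (fun x => K (q.1 x)) := by
    intro L
    by_cases hL : L ∈ U.carrier
    · obtain ⟨k, hk, g, hg, e⟩ := hL
      exact ⟨(k, g), fun _ => ⟨hk, hg, e⟩⟩
    · exact ⟨(0, 0), fun h => absurd h hL⟩
  choose q hq using hex
  have hδ := hh.hasVarDeriv
  set δ := (dotLoopSpace T S).varDeriv h with hδd
  have fam : ∀ {E : Type} [NormedAddCommGroup E] [NormedSpace ℝ E] {p : E → ℝ → Mat},
      IsSmoothFamily U.carrier p → SmoothPeriodic T p ∧ SmoothPeriodic T (fun s => (q (p s)).2) ∧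
        SmoothPeriodic T (fun s => (q (p s)).1) := by
    intro E _ _ p hp
    have hpT : SmoothPeriodic T p := by
      refine ⟨hp.1, fun s => ?_⟩
      obtain ⟨h1, h2, h3⟩ := hq _ (hp.2 s)
      have := (SmoothPeriodic.of_loop (E := ℝ) h2).gauge (fun _ x => hK.lorentz _ (h2.2.2 x))
        (hK.smooth _ (SmoothPeriodic.of_loop (E := ℝ) h1))
      rw [h3]
      exact this.periodic 0
    exact ⟨hpT, hK.frame p _ _ hpT (fun s => (hq _ (hp.2 s)).1) (fun s => (hq _ (hp.2 s)).2.1)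
      fun s => (hq _ (hp.2 s)).2.2⟩
  refine ⟨fun L => h (q L).1, ⟨fun L x => ((q L).2 x)⁻¹ * Q (q L).1 (δ (q L).1) x * (q L).2 x,
    ?_, ?_⟩, ?_, ?_⟩
  · intro n p hp
    obtain ⟨_, hg, hk⟩ := fam hp
    have hkS : ∀ s x, (q (p s)).1 x ∈ S := fun s => (hq _ (hp.2 s)).1.2.2
    have hJ : ∀ s x, ((q (p s)).2 x)ᵀ * J * (q (p s)).2 x = J :=
      fun s x => hK.lorentz _ ((hq _ (hp.2 s)).2.1.2.2 x)
    refine isSmoothFamily_loops_iff.2 ⟨?_, fun s x => conj_mem_o31 (hJ s x) (hQo _ _ _)⟩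
    exact ((hg.lorentz_inv hJ).mat_mul
      (hQ _ _ hk hkS (smoothPeriodic_varDeriv hδ hk hkS))).mat_mul hg
  · intro γ hγ s
    obtain ⟨hγT, hg, hk⟩ := fam hγ
    have hkS : ∀ s x, (q (γ s)).1 x ∈ S := fun s => (hq _ (hγ.2 s)).1.2.2
    have hH : ∀ s x, (q (γ s)).2 x ∈ H := fun s => (hq _ (hγ.2 s)).2.1.2.2
    have hJ : ∀ s x, ((q (γ s)).2 x)ᵀ * J * (q (γ s)).2 x = J := fun s x => hK.lorentz _ (hH s x)
    have hks := (hq _ (hγ.2 s)).1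
    have hds := varDeriv_mem_loops hδ hks
    refine (hasDerivAt_functional hδ hk hkS s).congr_deriv ?_
    have hQs := (hQ _ _ (SmoothPeriodic.of_loop (E := ℝ) hks) (fun _ => hks.2.2)
      (SmoothPeriodic.of_loop hds))
    have hinv := hg.lorentz_inv hJ
    have hξ := hg.mat_derivParam.mat_mul hinv
    -- With `ξ = ġ g⁻¹`, the function `tr (Q ξ)` is the periodic antiderivative: `hQX` applied to
    -- `ξ` gives `tr (Q [K, ξ]) = tr (Q_x ξ)`.
    have hF := hQs.mat_mul (SmoothPeriodic.of_loop (E := ℝ) (hξ.mem_loops s))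
    symm
    have i1 := (((SmoothPeriodic.of_loop (E := ℝ) (hinv.mem_loops s)).mat_mul hQs).mat_mul
      (SmoothPeriodic.of_loop (hg.mem_loops s))).mat_mul
      (SmoothPeriodic.of_loop (hγT.mat_derivParam.mem_loops s))
    refine integral_eq_of_hasDerivAt_sub (i1.mat_trace.intervalIntegrable 0 _ _)
      (intervalIntegrable_dot hds (hk.derivParam.mem_loops s) _ _) (hF.mat_trace.periodic 0)
      fun x => ?_
    refine (hasDerivAt_mat_trace (hasDerivAt_mat_mul (hQs.mat_hasDerivAt_loop 0 x)
      (hξ.mat_hasDerivAt_loop s x))).congr_deriv ?_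
    have eγ : (fun r => γ r x) = fun r => gauge (q (γ r)).2 (fun x => K ((q (γ r)).1 x)) x :=
      funext fun r => congrFun (hq _ (hγ.2 r)).2.2 x
    have hX := hQX _ hks _ hds _ (hK.lie (fun r => (q (γ r)).2 x) _ s (hg.mat_hasDerivAt s x)
      fun r => hH r x) x
    rw [Matrix.add_mul, Matrix.trace_add] at hX
    change _ = (_ * deriv (fun r => γ r x) s).trace - _
    rw [eγ, deriv_gauge hg hJ (hK.smooth _ hk), trace_conj_mul_conj (hJ s x),
      ← hQK _ hk, Matrix.mul_add, Matrix.mul_add, Matrix.trace_add, Matrix.trace_add,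
      trace_mul_lie, Matrix.trace_add]
    linarith
  · intro L hL g hg
    obtain ⟨h1, h2, h3⟩ := hq L hL
    have e : gauge g L = gauge (fun y => (q L).2 y * g y) (fun x => K ((q L).1 x)) := by
      conv_lhs => rw [h3]
      funext x
      exact gauge_gauge (h2.1.differentiable (by simp) x) (hg.1.differentiable (by simp) x)
        (hK.lorentz _ (h2.2.2 x)) (hK.lorentz _ (hg.2.2 x))
    have hm := (SmoothPeriodic.of_loop (E := ℝ) h2).mat_mul (SmoothPeriodic.of_loop hg)
    have hgg : (fun y => (q L).2 y * g y) ∈ loops T H :=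
      ⟨hm.loop 0, hm.periodic 0, fun x => hK.mul_mem _ (h2.2.2 x) _ (hg.2.2 x)⟩
    obtain ⟨h1', h2', h3'⟩ := hq (gauge g L) ⟨_, h1, _, hgg, e⟩
    exact congrArg h (hK.unique _ h1' _ h1 _ h2' _ hgg (h3'.symm.trans e))
  · intro k hk
    have h1 : (fun _ : ℝ => (1 : Mat)) ∈ loops T H := ⟨contDiff_const, fun _ => rfl, fun _ => hK.one_mem⟩
    obtain ⟨h1', h2', h3'⟩ := hq (fun x => K (k x)) ⟨k, hk, _, h1, (gauge_one _).symm⟩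
    refine congrArg h (hK.unique _ h1' _ hk _ h2' _ h1 ?_)
    rw [← h3', gauge_one]

end Extension

/-! ### The sections `K_L` and `K_M`. -/

section Sections

variable {T : ℝ} {E : Type} [NormedAddCommGroup E] [NormedSpace ℝ E]

theorem SmoothPeriodic.o31Mat {α β₁ β₂ γ₁ γ₂ ρ : E → ℝ → ℝ} (hα : SmoothPeriodic T α)
    (hβ₁ : SmoothPeriodic T β₁) (hβ₂ : SmoothPeriodic T β₂) (hγ₁ : SmoothPeriodic T γ₁)
    (hγ₂ : SmoothPeriodic T γ₂) (hρ : SmoothPeriodic T ρ) :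
    SmoothPeriodic T (fun s x => o31Mat (α s x) (β₁ s x) (β₂ s x) (γ₁ s x) (γ₂ s x) (ρ s x)) := by
  have h0 : SmoothPeriodic T (fun (_ : E) (_ : ℝ) => (0 : ℝ)) := .const 0
  refine SmoothPeriodic.mat fun i j => ?_
  fin_cases i <;> fin_cases j
  exacts [hα, hβ₁, hβ₂, h0, hγ₁, h0, hρ.neg, hβ₁, hγ₂, hρ, h0, hβ₂, h0, hγ₁, hγ₂, hα.neg]

theorem hasDerivAt_o31Mat {α β₁ β₂ γ₁ γ₂ ρ : ℝ → ℝ} {α' β₁' β₂' γ₁' γ₂' ρ' x : ℝ}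
    (hα : HasDerivAt α α' x) (hβ₁ : HasDerivAt β₁ β₁' x) (hβ₂ : HasDerivAt β₂ β₂' x)
    (hγ₁ : HasDerivAt γ₁ γ₁' x) (hγ₂ : HasDerivAt γ₂ γ₂' x) (hρ : HasDerivAt ρ ρ' x) :
    HasDerivAt (fun y => o31Mat (α y) (β₁ y) (β₂ y) (γ₁ y) (γ₂ y) (ρ y))
      (o31Mat α' β₁' β₂' γ₁' γ₂' ρ') x := by
  have h0 : HasDerivAt (fun _ : ℝ => (0 : ℝ)) 0 x := hasDerivAt_const x 0
  rw [hasDerivAt_mat]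
  intro i j
  fin_cases i <;> fin_cases j
  exacts [hα, hβ₁, hβ₂, h0, hγ₁, h0, hρ.fun_neg, hβ₁, hγ₂, hρ, h0, hβ₂, h0, hγ₁, hγ₂, hα.fun_neg]

theorem SmoothPeriodic.smul_KL (ε : ℝ) {k : E → ℝ → Fin 3 → ℝ} (hk : SmoothPeriodic T k) :
    SmoothPeriodic T (fun s x => ε • KL (k s x)) := by
  simp only [LightCone.smul_KL]
  exact (SmoothPeriodic.const 0).o31Mat ((hk.apply 0).const_mul ε).neg (.const 0)
    ((hk.apply 1).const_mul ε).neg ((hk.apply 2).const_mul ε).neg (.const 0)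

/-- The Lie algebra of `H_M`. -/
def lieM : Set Mat := {X | ∃ α γ₁ γ₂ ρ, X = o31Mat α 0 0 γ₁ γ₂ ρ}

/-- The Lie algebra of `H_L`. -/
def lieL : Set Mat := {X | ∃ γ₁ γ₂ ρ, X = o31Mat 0 0 0 γ₁ γ₂ ρ}

theorem logDeriv_mem_o31 {g : ℝ → Mat} {g' : Mat} {s : ℝ} (hd : HasDerivAt g g' s)
    (hJ : ∀ r, (g r)ᵀ * J * g r = J) : g' * (g s)⁻¹ ∈ o31 := by
  have h1 := deriv_mat_mul (hasDerivAt_mat_mul (hasDerivAt_mat_transpose hd)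
    (hasDerivAt_const s J)) hd
  have h2 : deriv (fun _ : ℝ => J) s = 0 := deriv_const s _
  rw [funext hJ, h2] at h1
  have e : g' = g' * (g s)⁻¹ * g s := by
    rw [Matrix.mul_assoc, lorentz_inv_mul (hJ s), Matrix.mul_one]
  set X := g' * (g s)⁻¹ with hX
  have eT : g'ᵀ = (g s)ᵀ * Xᵀ := (congrArg Matrix.transpose e).trans (Matrix.transpose_mul _ _)
  have h0 : g'ᵀ * J + (g s)ᵀ * (0 : Mat) = g'ᵀ * J := by
    rw [show (g s)ᵀ * (0 : Mat) = 0 from Matrix.mul_zero _, add_zero]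
  have h1' : 0 = g'ᵀ * J * g s + (g s)ᵀ * J * g' :=
    h1.trans (congrArg (fun Z : Mat => Z * g s + (g s)ᵀ * J * g') h0)
  have h3 : (g s)ᵀ * (Xᵀ * J + J * X) * g s = 0 :=
    calc (g s)ᵀ * (Xᵀ * J + J * X) * g s
        = ((g s)ᵀ * Xᵀ) * J * g s + (g s)ᵀ * J * (X * g s) := by
          simp only [Matrix.mul_add, Matrix.add_mul, Matrix.mul_assoc]
      _ = g'ᵀ * J * g s + (g s)ᵀ * J * g' := by rw [← eT, ← e]
      _ = 0 := h1'.symm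
  rw [mem_o31_iff]
  have hT : ((g s)⁻¹)ᵀ * (g s)ᵀ = 1 := by
    rw [← Matrix.transpose_mul, lorentz_mul_inv (hJ s), Matrix.transpose_one]
  calc Xᵀ * J + J * X = (((g s)⁻¹)ᵀ * (g s)ᵀ) * (Xᵀ * J + J * X) * (g s * (g s)⁻¹) := by
        rw [hT, lorentz_mul_inv (hJ s), Matrix.one_mul, Matrix.mul_one]
    _ = ((g s)⁻¹)ᵀ * ((g s)ᵀ * (Xᵀ * J + J * X) * g s) * (g s)⁻¹ := by
        simp only [Matrix.mul_assoc]
    _ = 0 := by rw [h3, Matrix.mul_zero, Matrix.zero_mul]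

/-- The last column of `g` stays a multiple of `e₄`, so the same holds for that of `g' g⁻¹`. In
`𝔬(3,1)` this kills `β₁, β₂`, and the corner entry is `-α`. -/
theorem logDeriv_entries {g : ℝ → Mat} {g' : Mat} {s : ℝ} (hd : HasDerivAt g g' s)
    (hg : ∀ r, g r ∈ HM) : ∃ γ₁ γ₂ ρ : ℝ,
      g' * (g s)⁻¹ = o31Mat (-(g' 3 3 / g s 3 3)) 0 0 γ₁ γ₂ ρ := by
  have hJ : ∀ r, (g r)ᵀ * J * g r = J := fun r => (hg r).1
  have hI := fun r => isIsotropy_of_mem (hg r)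
  have hX := eq_o31Mat (logDeriv_mem_o31 hd hJ)
  have e : g' * (g s)⁻¹ * g s = g' := by
    rw [Matrix.mul_assoc, lorentz_inv_mul (hJ s), Matrix.mul_one]
  set X := g' * (g s)⁻¹ with hXd
  have hc : ∀ i, X i 3 * g s 3 3 = g' i 3 := by
    intro i
    have := congrFun (congrFun e i) 3
    simp only [Matrix.mul_apply, Fin.sum_univ_four, (hI s).e03, (hI s).e13, (hI s).e23, mul_zero,
      zero_add] at this
    exact this
  have hz : ∀ i, (∀ r, g r i 3 = 0) → X i 3 = 0 := by
    intro i hi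
    have h1 := hasDerivAt_mat.1 hd i 3
    simp only [hi] at h1
    have h2 := h1.unique (hasDerivAt_const s 0)
    have h3 := hc i
    rw [h2] at h3
    exact (mul_eq_zero.1 h3).resolve_right (hI s).pos.ne'
  have x1 : X 0 1 = 0 := by
    have := hz 1 fun r => (hI r).e13
    rw [hX] at this
    exact this
  have x2 : X 0 2 = 0 := by
    have := hz 2 fun r => (hI r).e23
    rw [hX] at this
    exact this
  have x0 : X 0 0 = -(g' 3 3 / g s 3 3) := by
    have h3 : X 3 3 = g' 3 3 / g s 3 3 := by rw [eq_div_iff (hI s).pos.ne', hc]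
    have h4 : X 3 3 = -X 0 0 := by
      conv_lhs => rw [hX]
      rfl
    linarith
  refine ⟨X 1 0, X 2 0, X 2 1, hX.trans ?_⟩
  rw [x0, x1, x2]

theorem HL_apply {g : Mat} (hg : g ∈ HL) : g 3 3 = 1 :=
  (mulVec_e4 g 3).symm.trans (by rw [hg.2.2]; rfl)

/-- On `H_L` one has `g₃₃ = 1`, so the norm relation of the frame reads off `k₀`, and everything
else follows from it. -/
theorem isSection_cone (T : ℝ) {ε : ℝ} (hε : ε * ε = 1) :
    IsSection T HL {v : Fin 3 → ℝ | 0 < v 0} (fun v => ε • KL v) lieL where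
  lorentz g hg := hg.1
  mul_mem g hg g' hg' := HL_mul_mem hg hg'
  one_mem := one_mem_HL
  smooth k hk := hk.smul_KL ε
  unique k hk k' hk' g hg g' hg' h := by
    have hd := hg.1.differentiable (by simp)
    have hd' := hg'.1.differentiable (by simp)
    have f := isFrame_gauge hε (fun x => HL_subset_HM (hg.2.2 x)) hd hk.2.2
    have f' := isFrame_gauge hε (fun x => HL_subset_HM (hg'.2.2 x)) hd' hk'.2.2
    rw [← h] at f'
    refine f.unique f' (fun x => HL_subset_HM (hg.2.2 x)) (fun x => HL_subset_HM (hg'.2.2 x))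
      (fun x => ?_) fun x => ?_
    · rw [HL_apply (hg.2.2 x), HL_apply (hg'.2.2 x)]
    · have h1 := f.norm x
      have h2 := f'.norm x
      rw [HL_apply (hg.2.2 x), one_mul] at h1
      rw [HL_apply (hg'.2.2 x), one_mul] at h2
      rw [h1, h2]
  frame L g k hL hk hg e := by
    have f : ∀ s, IsFrame ε (g s) (k s) (L s) := fun s => by
      rw [e]
      exact isFrame_gauge hε (fun x => HL_subset_HM ((hg s).2.2 x))
        ((hg s).1.differentiable (by simp)) (hk s).2.2
    have h33 : ∀ s x, g s x 3 3 = 1 := fun s x => HL_apply ((hg s).2.2 x)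
    have hn : ∀ s x, k s x 0 = Real.sqrt (L s x 0 1 ^ 2 + L s x 0 2 ^ 2) := fun s x => by
      rw [← (f s).norm, h33, one_mul]
    refine SmoothPeriodic.of_isFrame f (fun s x => HL_subset_HM ((hg s).2.2 x))
      (fun s => (hk s).2.2) hL (by simpa only [h33] using SmoothPeriodic.const (1 : ℝ)) ?_
    simp only [hn, pow_two]
    -- The root is smooth since its argument cannot vanish: otherwise `k₀` would be zero.
    refine (((hL.entry 0 1).mul (hL.entry 0 1)).add ((hL.entry 0 2).mul (hL.entry 0 2))).sqrt
      fun s x h0 => ?_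
    have h1 := hn s x
    rw [pow_two, pow_two, h0, Real.sqrt_zero] at h1
    exact ((hk s).2.2 x).ne' h1
  lie g g' s hd hg := by
    obtain ⟨γ₁, γ₂, ρ, h⟩ := logDeriv_entries hd fun r => HL_subset_HM (hg r)
    have h1 := hasDerivAt_mat.1 hd 3 3
    simp only [HL_apply (hg _)] at h1
    have h2 := h1.unique (hasDerivAt_const s 1)
    rw [h2, zero_div, neg_zero] at h
    exact ⟨_, _, _, h⟩

/-- Here `k₀ = 1`, and the norm relation reads off the scaling `g₃₃` of the ray instead. -/
theorem isSection_sphere (T : ℝ) {ε : ℝ} (hε : ε * ε = 1) :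
    IsSection T HM (Set.univ : Set (Fin 2 → ℝ)) (fun κ => ε • KM κ) lieM where
  lorentz g hg := hg.1
  mul_mem g hg g' hg' := HM_mul_mem hg hg'
  one_mem := HL_subset_HM one_mem_HL
  smooth k hk := by
    simp only [KM_eq_KL]
    exact ((SmoothPeriodic.const 1).vec3 (hk.apply 0) (hk.apply 1)).smul_KL ε
  unique k hk k' hk' g hg g' hg' h := by
    have hd := hg.1.differentiable (by simp)
    have hd' := hg'.1.differentiable (by simp)
    simp only [KM_eq_KL] at h
    have f := isFrame_gauge hε (k := fun x => ![1, k x 0, k x 1]) hg.2.2 hd fun _ => one_pos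
    have f' := isFrame_gauge hε (k := fun x => ![1, k' x 0, k' x 1]) hg'.2.2 hd' fun _ => one_pos
    rw [← h] at f'
    have hu := f.unique f' hg.2.2 hg'.2.2 (fun x => ?_) fun x => rfl
    · funext x
      ext i
      fin_cases i
      exacts [congrFun (congrFun hu x) 1, congrFun (congrFun hu x) 2]
    · have h1 := f.norm x
      have h2 := f'.norm x
      simp only [Matrix.cons_val_zero, mul_one] at h1 h2
      rw [h1, h2]
  frame L g k hL hk hg e := by
    simp only [KM_eq_KL] at e
    have f : ∀ s, IsFrame ε (g s) (fun x => ![1, k s x 0, k s x 1]) (L s) := fun s => by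
      rw [e]
      exact isFrame_gauge hε (k := fun x => ![1, k s x 0, k s x 1]) (hg s).2.2
        ((hg s).1.differentiable (by simp)) fun _ => one_pos
    have hn : ∀ s x, g s x 3 3 = Real.sqrt (L s x 0 1 ^ 2 + L s x 0 2 ^ 2) := fun s x => by
      have := (f s).norm x
      simpa only [Matrix.cons_val_zero, mul_one] using this
    have h33 : SmoothPeriodic T fun s x => g s x 3 3 := by
      simp only [hn, pow_two]
      refine (((hL.entry 0 1).mul (hL.entry 0 1)).add ((hL.entry 0 2).mul (hL.entry 0 2))).sqrt
        fun s x h0 => ?_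
      have h1 := hn s x
      rw [pow_two, pow_two, h0, Real.sqrt_zero] at h1
      exact (isIsotropy_of_mem ((hg s).2.2 x)).pos.ne' h1
    have h := SmoothPeriodic.of_isFrame f (fun s => (hg s).2.2) (fun _ _ => one_pos) hL h33
      (.const 1)
    exact ⟨h.1, SmoothPeriodic.pi fun i => by
      fin_cases i
      exacts [h.2.apply 1, h.2.apply 2]⟩
  lie g g' s hd hg := by
    obtain ⟨γ₁, γ₂, ρ, h⟩ := logDeriv_entries hd hg
    exact ⟨_, _, _, _, h⟩

end Sections

/-! ### Existence of extensions on the cone and the sphere. -/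

section ExistenceOfExtensions

variable {T : ℝ}

/-- The element of `𝔬(3,1)` with first row `(·, β₁, β₂, 0)` and given `γ₁` for which
`Q_x + [ε K_L(k), Q]` has trivial `β` and `ρ` components. -/
def coAdj (ε : ℝ) (k₀ k₁ k₂ β₁ β₂ γ₁ : ℝ → ℝ) (x : ℝ) : Mat :=
  o31Mat (-(ε * (deriv β₁ x / k₀ x))) (β₁ x) (β₂ x) (γ₁ x)
    ((ε * deriv (fun y => ε * (deriv β₂ y / k₀ y)) x + k₂ x * β₁ x - k₁ x * β₂ x) / k₀ x)
    (-(ε * (deriv β₂ x / k₀ x)))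

theorem SmoothPeriodic.coAdj {E : Type} [NormedAddCommGroup E] [NormedSpace ℝ E] (ε : ℝ)
    {k₀ k₁ k₂ β₁ β₂ γ₁ : E → ℝ → ℝ} (hk₀ : SmoothPeriodic T k₀) (hk₁ : SmoothPeriodic T k₁)
    (hk₂ : SmoothPeriodic T k₂) (hβ₁ : SmoothPeriodic T β₁) (hβ₂ : SmoothPeriodic T β₂)
    (hγ₁ : SmoothPeriodic T γ₁) (h0 : ∀ s x, k₀ s x ≠ 0) :
    SmoothPeriodic T (fun s => coAdj ε (k₀ s) (k₁ s) (k₂ s) (β₁ s) (β₂ s) (γ₁ s)) := by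
  have hρ := (hβ₂.deriv.div hk₀ h0).const_mul ε
  exact ((hβ₁.deriv.div hk₀ h0).const_mul ε).neg.o31Mat hβ₁ hβ₂ hγ₁
    ((((hρ.deriv.const_mul ε).add (hk₂.mul hβ₁)).sub (hk₁.mul hβ₂)).div hk₀ h0) hρ.neg

theorem trace_coAdj_mul (ε : ℝ) (k₀ k₁ k₂ β₁ β₂ γ₁ : ℝ → ℝ) (x : ℝ) (v : Fin 3 → ℝ) :
    (coAdj ε k₀ k₁ k₂ β₁ β₂ γ₁ x * (ε • KL v)).trace =
      -2 * ε * (γ₁ x * v 0 + β₁ x * v 1 + β₂ x * v 2) := by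
  rw [coAdj, smul_KL, trace_o31Mat_mul]
  ring

/-- Under the trace form the directions `γ, ρ, α` of `𝔥_M` pair with the components `β, ρ, α`.
`coAdj` makes the first two kinds vanish, so only the `α` component survives. It is harmless for
`H_L`, where `α' = 0`; for `H_M` it is removed by the choice of `γ₁`. -/
theorem trace_deriv_coAdj_add_lie {ε : ℝ} (hε : ε * ε = 1) {k₀ k₁ k₂ β₁ β₂ γ₁ : ℝ → ℝ}
    (hk₀ : IsLoop T k₀) (hk₁ : IsLoop T k₁) (hk₂ : IsLoop T k₂) (hβ₁ : IsLoop T β₁)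
    (hβ₂ : IsLoop T β₂) (hγ₁ : IsLoop T γ₁) (h0 : ∀ x, k₀ x ≠ 0) (α' γ₁' γ₂' ρ' x : ℝ) :
    ((deriv (coAdj ε k₀ k₁ k₂ β₁ β₂ γ₁) x +
        ⁅ε • KL ![k₀ x, k₁ x, k₂ x], coAdj ε k₀ k₁ k₂ β₁ β₂ γ₁ x⁆) *
      o31Mat α' 0 0 γ₁' γ₂' ρ').trace =
      2 * (-(ε * deriv (fun y => deriv β₁ y / k₀ y) x) +
        ε * (k₁ x * β₁ x + k₂ x * β₂ x - k₀ x * γ₁ x)) * α' := by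
  have hd : ∀ {u : ℝ → ℝ}, IsLoop T u → IsLoop T (fun y => u y / k₀ y) := fun hu => by
    simpa only [mul_one_div] using hu.mul (hk₀.inv h0)
  have hα := hd hβ₁.deriv
  have hρ := (hd hβ₂.deriv).const_mul ε
  have hγ₂ := hd ((((hρ.deriv.const_mul ε).add (hk₂.mul hβ₁)).sub (hk₁.mul hβ₂)))
  have h := hasDerivAt_o31Mat ((hα.hasDerivAt x).const_mul ε).fun_neg (hβ₁.hasDerivAt x)
    (hβ₂.hasDerivAt x) (hγ₁.hasDerivAt x) (hγ₂.hasDerivAt x) (hρ.hasDerivAt x).fun_neg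
  rw [show deriv (coAdj ε k₀ k₁ k₂ β₁ β₂ γ₁) x = _ from deriv_mat_eq h, coAdj, smul_KL, lie_o31Mat, o31Mat_add, trace_o31Mat_mul]
  simp only [Matrix.cons_val]
  have h0x := h0 x
  generalize deriv (fun y => ε * (deriv β₂ y / k₀ y)) x = R
  field_simp
  linear_combination -k₀ x * (R * ρ' + deriv β₁ x * γ₁' + deriv β₂ x * γ₂') * hε

theorem exists_gaugeExtension_cone {ε : ℝ} (hε : ε * ε = 1) {h : (ℝ → Fin 3 → ℝ) → ℝ}
    (hh : (coneInvariants T).IsSmooth h) :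
    ∃ Hext, IsGaugeExtension HL (coneInvariants T) (fun k x => ε • KL (k x)) h Hext := by
  -- The factor `-ε/2` inverts the factor `-2ε` of `trace_coAdj_mul`; the free component `γ₁`
  -- carries the gradient in `k₀`.
  refine (isSection_cone T hε).exists_gaugeExtension
    (fun k d => coAdj ε (fun x => k x 0) (fun x => k x 1) (fun x => k x 2)
      (fun x => -(ε / 2) * d x 1) (fun x => -(ε / 2) * d x 2) (fun x => -(ε / 2) * d x 0))
    (fun k d hk hS hd => ?_) (fun k d x => o31Mat_mem _ _ _ _ _ _) (fun k hk d s x => ?_)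
    (fun k hk d hd X hX x => ?_) hh
  · exact SmoothPeriodic.coAdj ε (hk.apply 0) (hk.apply 1) (hk.apply 2) ((hd.apply 1).const_mul _)
      ((hd.apply 2).const_mul _) ((hd.apply 0).const_mul _) fun s x => (hS s x).ne'
  · have h1 := hk.hasDerivAt s x
    have h2 : deriv (fun r => ε • KL (k r x)) s = ε • KL (deriv (fun r => k r x) s) := by
      refine deriv_mat_eq ?_
      simp only [smul_KL]
      have h0 := fun i => (hasDerivAt_pi.1 h1 i).const_mul ε
      exact hasDerivAt_o31Mat (hasDerivAt_const s 0) (h0 0).neg (hasDerivAt_const s 0) (h0 1).neg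
        (h0 2).neg (hasDerivAt_const s 0)
    rw [h2, trace_coAdj_mul, dotProduct, Fin.sum_univ_three]
    linear_combination (d x 0 * deriv (fun r => k r x) s 0 + d x 1 * deriv (fun r => k r x) s 1 +
      d x 2 * deriv (fun r => k r x) s 2) * hε
  · obtain ⟨γ₁, γ₂, ρ, rfl⟩ := hX
    have e : k x = ![k x 0, k x 1, k x 2] := by
      ext i
      fin_cases i <;> rfl
    have := trace_deriv_coAdj_add_lie hε (IsLoop.apply hk 0) (IsLoop.apply hk 1)
      (IsLoop.apply hk 2) ((IsLoop.apply hd 1).const_mul (-(ε / 2)))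
      ((IsLoop.apply hd 2).const_mul (-(ε / 2))) ((IsLoop.apply hd 0).const_mul (-(ε / 2)))
      (fun y => (hk.2.2 y).ne') 0 γ₁ γ₂ ρ x
    rw [mul_zero, ← e] at this
    exact this

theorem exists_gaugeExtension_sphere {ε : ℝ} (hε : ε * ε = 1) {h : (ℝ → Fin 2 → ℝ) → ℝ}
    (hh : (sphereInvariants T).IsSmooth h) :
    ∃ Hext, IsGaugeExtension HM (sphereInvariants T) (fun κ x => ε • KM (κ x)) h Hext := by
  -- There is no gradient in `k₀` here, so `γ₁` need not carry one; it is `-β₁'' + κ₀ β₁ + κ₁ β₂`,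
  -- which makes the `α` component of `Q_x + [K, Q]` vanish.
  refine (isSection_sphere T hε).exists_gaugeExtension
    (fun κ d => coAdj ε (fun _ => 1) (fun x => κ x 0) (fun x => κ x 1)
      (fun x => -(ε / 2) * d x 0) (fun x => -(ε / 2) * d x 1)
      (fun x => -deriv (fun y => deriv (fun z => -(ε / 2) * d z 0) y / 1) x
        + (κ x 0 * (-(ε / 2) * d x 0) + κ x 1 * (-(ε / 2) * d x 1))))
    (fun k d hk hS hd => ?_) (fun k d x => o31Mat_mem _ _ _ _ _ _) (fun k hk d s x => ?_)
    (fun k hk d hd X hX x => ?_) hh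
  · have h0 := (hd.apply 0).const_mul (-(ε / 2))
    have h1 := (hd.apply 1).const_mul (-(ε / 2))
    exact SmoothPeriodic.coAdj ε (.const 1) (hk.apply 0) (hk.apply 1) h0 h1
      ((h0.deriv.div (.const 1) fun _ _ => one_ne_zero).deriv.neg.add
        (((hk.apply 0).mul h0).add ((hk.apply 1).mul h1))) fun s x => one_ne_zero
  · have h1 := hk.hasDerivAt s x
    have h2 : deriv (fun r => ε • KM (k r x)) s =
        ε • KL ![0, deriv (fun r => k r x) s 0, deriv (fun r => k r x) s 1] := by
      refine deriv_mat_eq ?_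
      simp only [KM_eq_KL, smul_KL]
      have h0 := fun i => (hasDerivAt_pi.1 h1 i).const_mul ε
      exact hasDerivAt_o31Mat (hasDerivAt_const s 0)
        ((hasDerivAt_const s (1 : ℝ)).const_mul ε).neg (hasDerivAt_const s 0) (h0 0).neg
        (h0 1).neg (hasDerivAt_const s 0)
    rw [h2, trace_coAdj_mul, dotProduct, Fin.sum_univ_two]
    simp only [Matrix.cons_val]
    linear_combination (d x 0 * deriv (fun r => k r x) s 0 +
      d x 1 * deriv (fun r => k r x) s 1) * hε
  · obtain ⟨α, γ₁, γ₂, ρ, rfl⟩ := hX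
    have l0 := (IsLoop.apply hd 0).const_mul (-(ε / 2))
    have l1 := (IsLoop.apply hd 1).const_mul (-(ε / 2))
    have l2 : IsLoop T (fun x => -deriv (fun y => deriv (fun z => -(ε / 2) * d z 0) y / 1) x
        + (k x 0 * (-(ε / 2) * d x 0) + k x 1 * (-(ε / 2) * d x 1))) := by
      simpa only [div_one, neg_one_mul] using (l0.deriv.deriv.const_mul (-1)).add
        (((IsLoop.apply hk 0).mul l0).add ((IsLoop.apply hk 1).mul l1))
    have := trace_deriv_coAdj_add_lie hε (T := T) (k₀ := fun _ => 1) ⟨contDiff_const, fun _ => rfl⟩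
      (IsLoop.apply hk 0) (IsLoop.apply hk 1) l0 l1 l2 (fun _ => one_ne_zero) α γ₁ γ₂ ρ x
    rw [KM_eq_KL]
    refine this.trans ?_
    ring

end ExistenceOfExtensions

/-! ### Constraints on the gradient of an arbitrary extension. -/

section RestrictionOfExtensions

variable {m : ℕ} {T : ℝ} {S : Set (Fin m → ℝ)} {H : Set Mat} {K : (Fin m → ℝ) → Mat} {𝔥 : Set Mat}
  {h : (ℝ → Fin m → ℝ) → ℝ} {Hext : (ℝ → Mat) → ℝ}

/-- The variational derivative of an extension along the section. -/
def extDeriv (H : Set Mat) (T : ℝ) (S : Set (Fin m → ℝ)) (K : (Fin m → ℝ) → Mat)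
    (Hext : (ℝ → Mat) → ℝ) (k : ℝ → Fin m → ℝ) : ℝ → Mat :=
  (gaugeDomain H (dotLoopSpace T S) fun k x => K (k x)).varDeriv Hext fun x => K (k x)

theorem IsSection.isSmoothFamily (hK : IsSection T H S K 𝔥) {p : ℝ → ℝ → Fin m → ℝ}
    (hp : SmoothPeriodic T p) (hS : ∀ s x, p s x ∈ S) :
    IsSmoothFamily (gaugeDomain H (dotLoopSpace T S) fun k x => K (k x)).carrier
      (fun s x => K (p s x)) :=
  ⟨(hK.smooth p hp).contDiff, fun s => ⟨p s, (isSmoothFamily_loops_iff.2 ⟨hp, hS⟩).2 s,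
    fun _ => 1, ⟨contDiff_const, fun _ => rfl, fun _ => hK.one_mem⟩, (gauge_one _).symm⟩⟩

theorem IsSection.extDeriv_mem (hK : IsSection T H S K 𝔥)
    (he : IsGaugeExtension H (dotLoopSpace T S) (fun k x => K (k x)) h Hext)
    {k : ℝ → Fin m → ℝ} (hk : k ∈ loops T S) : extDeriv H T S K Hext k ∈ loops T o31 :=
  (he.smooth.hasVarDeriv.isSmoothFamily
    (hK.isSmoothFamily (SmoothPeriodic.of_loop (E := ℝ) hk) fun _ => hk.2.2)).2 0

theorem IsSection.integral_extDeriv_section (hK : IsSection T H S K 𝔥)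
    (hh : (dotLoopSpace T S).IsSmooth h)
    (he : IsGaugeExtension H (dotLoopSpace T S) (fun k x => K (k x)) h Hext)
    {p : ℝ → ℝ → Fin m → ℝ} (hp : SmoothPeriodic T p) (hS : ∀ s x, p s x ∈ S) (s : ℝ) :
    ∫ x in (0 : ℝ)..T, (extDeriv H T S K Hext (p s) x * deriv (fun r => K (p r x)) s).trace =
      ∫ x in (0 : ℝ)..T, (dotLoopSpace T S).varDeriv h (p s) x ⬝ᵥ deriv (fun r => p r x) s := by
  have h1 := he.smooth.hasVarDeriv.hasDerivAt _ (hK.isSmoothFamily hp hS) s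
  have h2 := hasDerivAt_functional hh.hasVarDeriv hp hS s
  have e : (fun r => Hext fun x => K (p r x)) = fun r => h (p r) :=
    funext fun r => he.extend (p r) ((isSmoothFamily_loops_iff.2 ⟨hp, hS⟩).2 r)
  rw [e] at h1
  exact h1.unique h2

/-- The extension is constant along the gauge orbit `s ↦ gauge (g s) K`, whose velocity at the
identity is `ξ_x + [K, ξ]`. -/
theorem IsSection.integral_extDeriv_gauge (hK : IsSection T H S K 𝔥)
    (he : IsGaugeExtension H (dotLoopSpace T S) (fun k x => K (k x)) h Hext)
    {k : ℝ → Fin m → ℝ} (hk : k ∈ loops T S) {g : ℝ → ℝ → Mat} (hg : SmoothPeriodic T g)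
    (hH : ∀ s x, g s x ∈ H) (h1 : ∀ x, g 0 x = 1) {ξ : ℝ → Mat}
    (hξ : ∀ x, deriv (fun r => g r x) 0 = ξ x) :
    ∫ x in (0 : ℝ)..T, (extDeriv H T S K Hext k x * (deriv ξ x + ⁅K (k x), ξ x⁆)).trace = 0 := by
  have hkp := SmoothPeriodic.of_loop (E := ℝ) hk
  have hJ : ∀ s x, (g s x)ᵀ * J * g s x = J := fun s x => hK.lorentz _ (hH s x)
  have hKk := hK.smooth _ hkp
  have hgl : ∀ s, g s ∈ loops T H := fun s => ⟨hg.loop s, hg.periodic s, hH s⟩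
  have hfam : IsSmoothFamily (gaugeDomain H (dotLoopSpace T S) fun k x => K (k x)).carrier
      (fun s => gauge (g s) fun x => K (k x)) :=
    ⟨(hg.gauge hJ hKk).contDiff, fun s => ⟨k, hk, g s, hgl s, rfl⟩⟩
  have d := he.smooth.hasVarDeriv.hasDerivAt _ hfam 0
  have hm : (fun x => K (k x)) ∈
      (gaugeDomain H (dotLoopSpace T S) fun k x => K (k x)).carrier :=
    ⟨k, hk, fun _ => 1, ⟨contDiff_const, fun _ => rfl, fun _ => hK.one_mem⟩, (gauge_one _).symm⟩
  simp only [he.const _ hm _ (hgl _)] at d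
  have d0 := d.unique (hasDerivAt_const 0 _)
  rw [show g 0 = fun _ => 1 from funext h1, gauge_one] at d0
  refine Eq.trans ?_ d0
  refine intervalIntegral.integral_congr fun x _ => ?_
  have e := deriv_gauge hg hJ hKk 0 x
  have hc : deriv (fun _ : ℝ => K (k x)) 0 = 0 := deriv_const 0 _
  simp only [h1, hξ, inv_one, Matrix.mul_one, Matrix.one_mul, hc, add_zero] at e
  change _ = (_ * deriv (fun r => gauge (g r) (fun x => K (k x)) x) 0).trace
  rw [e]
  rfl

/-- A one-parameter family of elements of `H_L`. -/
def nilMat (a b : ℝ) : Mat :=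
  !![1, 0, 0, 0; a, 1, 0, 0; b, 0, 1, 0; (a * a + b * b) / 2, a, b, 1]

theorem nilMat_mem_HL (a b : ℝ) : nilMat a b ∈ HL := by
  refine ⟨?_, ?_, ?_⟩
  · ext i j
    fin_cases i <;> fin_cases j <;>
      simp [nilMat, J, Matrix.mul_apply, Fin.sum_univ_four]; ring
  · simp [nilMat, Matrix.det_succ_row_zero, Fin.sum_univ_succ]
  · ext i
    rw [mulVec_e4]
    fin_cases i <;> rfl

theorem SmoothPeriodic.nilMat {a b : ℝ → ℝ → ℝ} (ha : SmoothPeriodic T a)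
    (hb : SmoothPeriodic T b) : SmoothPeriodic T (fun s x => nilMat (a s x) (b s x)) := by
  have h0 : SmoothPeriodic T (fun (_ : ℝ) (_ : ℝ) => (0 : ℝ)) := .const 0
  have h1 : SmoothPeriodic T (fun (_ : ℝ) (_ : ℝ) => (1 : ℝ)) := .const 1
  refine SmoothPeriodic.mat fun i j => ?_
  fin_cases i <;> fin_cases j
  exacts [h1, h0, h0, h0, ha, h1, h0, h0, hb, h0, h1, h0,
    ((ha.mul ha).add (hb.mul hb)).div (.const 2) fun _ _ => two_ne_zero, ha, hb, h1]

theorem hasDerivAt_nilMat (a b : ℝ) :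
    HasDerivAt (fun r => LightCone.nilMat (r * a) (r * b)) (o31Mat 0 0 0 a b 0) 0 := by
  have h0 : HasDerivAt (fun _ : ℝ => (0 : ℝ)) 0 0 := hasDerivAt_const _ _
  have h0' : HasDerivAt (fun _ : ℝ => (0 : ℝ)) (-0) 0 := by simpa using h0
  have h1 : HasDerivAt (fun _ : ℝ => (1 : ℝ)) 0 0 := hasDerivAt_const _ _
  have h1' : HasDerivAt (fun _ : ℝ => (1 : ℝ)) (-0) 0 := by simpa using h1
  have hl : ∀ c : ℝ, HasDerivAt (fun r : ℝ => r * c) c 0 := fun c => hasDerivAt_mul_const c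
  have hq : HasDerivAt (fun r : ℝ => (r * a * (r * a) + r * b * (r * b)) / 2) 0 0 := by
    refine ((((hl a).fun_mul (hl a)).fun_add ((hl b).fun_mul (hl b))).div_const 2).congr_deriv ?_
    ring
  rw [hasDerivAt_mat]
  intro i j
  fin_cases i <;> fin_cases j
  exacts [h1, h0, h0, h0, hl a, h1, h0', h0, hl b, h0, h1, h0, hq, hl a, hl b, h1']

end RestrictionOfExtensions

/-! ### The value of the reduced bracket. -/

section ReducedBracket

variable {T : ℝ}

/-- The components of `D` determined by its pairings with the directions of the section and of the
gauge leaf at `ε K_L(k)`. -/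
structure IsRestriction (ε : ℝ) (k₀ : ℝ → ℝ) (d : ℝ → Fin 2 → ℝ) (D : ℝ → Mat) : Prop where
  mem : ∀ x, D x ∈ o31
  b1 : ∀ x, D x 0 1 = -(ε / 2) * d x 0
  b2 : ∀ x, D x 0 2 = -(ε / 2) * d x 1
  a : ∀ x, D x 0 0 = deriv (fun y => d y 0) x / (2 * k₀ x)
  r : ∀ x, D x 2 1 = deriv (fun y => d y 1) x / (2 * k₀ x)

/-- Tests only against variations of `k₁, k₂` and gauge directions `γ₁, γ₂`, which lie in both
isotropy algebras, so cone and sphere are treated together. The first give `β₁, β₂`, the second `α,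
ρ`; the remaining components of `D` do not enter the bracket. -/
theorem isRestriction_of {ε : ℝ} (hε : ε * ε = 1) (hT : 0 < T) {k₀ k₁ k₂ : ℝ → ℝ}
    (hk₀ : IsLoop T k₀) (h0 : ∀ x, k₀ x ≠ 0) {d : ℝ → Fin 2 → ℝ} (hd : d ∈ loops T Set.univ)
    {D : ℝ → Mat} (hD : D ∈ loops T o31)
    (h1 : ∀ w ∈ loops T (Set.univ : Set (Fin 2 → ℝ)),
      ∫ x in (0 : ℝ)..T, (D x * o31Mat 0 0 0 (-(ε * w x 0)) (-(ε * w x 1)) 0).trace =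
        ∫ x in (0 : ℝ)..T, d x ⬝ᵥ w x)
    (h2 : ∀ w ∈ loops T (Set.univ : Set (Fin 2 → ℝ)),
      ∫ x in (0 : ℝ)..T, (D x * (deriv (fun y => o31Mat 0 0 0 (w y 0) (w y 1) 0) x +
        ⁅ε • KL ![k₀ x, k₁ x, k₂ x], o31Mat 0 0 0 (w x 0) (w x 1) 0⁆)).trace = 0) :
    IsRestriction ε k₀ d D := by
  have hDp : SmoothPeriodic T (fun _ : ℝ => D) := .of_loop hD
  have hDe : ∀ i j, IsLoop T (fun x => D x i j) := fun i j => .of_smoothPeriodic (hDp.entry i j) 0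
  have hDo := fun x => eq_o31Mat (hD.2.2 x)
  have vec : ∀ {u v : ℝ → ℝ}, IsLoop T u → IsLoop T v →
      (fun x => ![u x, v x]) ∈ loops T (Set.univ : Set (Fin 2 → ℝ)) := fun hu hv =>
    (hu.smoothPeriodic.vec2 (E := ℝ) hv.smoothPeriodic).mem_loops 0
  have e1 : (fun x => ![-2 * ε * D x 0 1, -2 * ε * D x 0 2]) = d := by
    have hu := vec ((hDe 0 1).const_mul (-2 * ε)) ((hDe 0 2).const_mul (-2 * ε))
    refine eq_of_integral_dot_sub_eq hT hu hd ?_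
    have hw := ((SmoothPeriodic.of_loop (E := ℝ) hu).sub (SmoothPeriodic.of_loop hd)).mem_loops 0
    rw [← h1 _ hw]
    refine intervalIntegral.integral_congr fun x _ => ?_
    have ht : ∀ a b, (D x * o31Mat 0 0 0 a b 0).trace = 2 * (D x 0 1 * a + D x 0 2 * b) := by
      intro a b
      conv_lhs => rw [hDo x, trace_o31Mat_mul]
      ring
    refine Eq.trans ?_ (ht _ _).symm
    rw [dotProduct, Fin.sum_univ_two]
    simp only [Matrix.cons_val]
    ring
  have b1 : ∀ x, D x 0 1 = -(ε / 2) * d x 0 := fun x => by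
    have := congrFun (congrFun e1 x) 0
    simp only [Matrix.cons_val] at this
    linear_combination (-ε / 2) * this - D x 0 1 * hε
  have b2 : ∀ x, D x 0 2 = -(ε / 2) * d x 1 := fun x => by
    have := congrFun (congrFun e1 x) 1
    simp only [Matrix.cons_val] at this
    linear_combination (-ε / 2) * this - D x 0 2 * hε
  -- Gauge invariance after integration by parts: `β₁' = -ε k₀ α` and `β₂' = -ε k₀ ρ`.
  have e2 : (fun x => ![deriv (fun y => D y 0 1) x, deriv (fun y => D y 0 2) x]) =
      fun x => ![-ε * (k₀ x * D x 0 0), -ε * (k₀ x * D x 2 1)] := by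
    have hu := vec (hDe 0 1).deriv (hDe 0 2).deriv
    have hv := vec ((hk₀.mul (hDe 0 0)).const_mul (-ε)) ((hk₀.mul (hDe 2 1)).const_mul (-ε))
    refine eq_of_integral_dot_sub_eq hT hu hv ?_
    have hw := ((SmoothPeriodic.of_loop (E := ℝ) hu).sub (SmoothPeriodic.of_loop hv)).mem_loops 0
    set u : ℝ → Fin 2 → ℝ := fun x => ![deriv (fun y => D y 0 1) x, deriv (fun y => D y 0 2) x]
    set v : ℝ → Fin 2 → ℝ := fun x => ![-ε * (k₀ x * D x 0 0), -ε * (k₀ x * D x 2 1)]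
    set w : ℝ → Fin 2 → ℝ := fun x => u x - v x
    have w0 := IsLoop.apply hw 0
    have w1 := IsLoop.apply hw 1
    have tr : ∀ x, (D x * (deriv (fun y => o31Mat 0 0 0 (w y 0) (w y 1) 0) x +
        ⁅ε • KL ![k₀ x, k₁ x, k₂ x], o31Mat 0 0 0 (w x 0) (w x 1) 0⁆)).trace =
        2 * (D x 0 1 * deriv (fun y => w y 0) x + D x 0 2 * deriv (fun y => w y 1) x +
          v x ⬝ᵥ w x) := fun x => by
      have hc := hasDerivAt_const x (0 : ℝ)
      rw [deriv_mat_eq (hasDerivAt_o31Mat hc hc hc (w0.hasDerivAt x) (w1.hasDerivAt x) hc),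
        smul_KL, lie_o31Mat, o31Mat_add, hDo x, trace_o31Mat_mul, dotProduct, Fin.sum_univ_two]
      simp only [v, Matrix.cons_val]
      simp only [o31Mat, Matrix.of_apply, Matrix.cons_val]
      ring
    have h3 := h2 w hw
    rw [intervalIntegral.integral_congr fun x _ => tr x, intervalIntegral.integral_const_mul,
      mul_eq_zero, or_iff_right two_ne_zero] at h3
    have iD := ((hDe 0 1).mul w0.deriv).add ((hDe 0 2).mul w1.deriv)
    rw [intervalIntegral.integral_add (iD.intervalIntegrable 0 T)
      (intervalIntegrable_dot hv hw 0 T)] at h3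
    rw [eq_neg_of_add_eq_zero_right h3, ← intervalIntegral.integral_neg]
    have hF := ((hDe 0 1).mul w0).add ((hDe 0 2).mul w1)
    refine integral_eq_of_hasDerivAt_sub (intervalIntegrable_dot hu hw _ _)
      (iD.intervalIntegrable 0 T).neg hF.periodic fun x => ?_
    refine ((((hDe 0 1).hasDerivAt x).fun_mul (w0.hasDerivAt x)).fun_add
      (((hDe 0 2).hasDerivAt x).fun_mul (w1.hasDerivAt x))).congr_deriv ?_
    change _ = u x ⬝ᵥ w x - _
    rw [dotProduct, Fin.sum_univ_two]
    simp only [u, Matrix.cons_val]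
    ring
  have dd : ∀ i j (l : Fin 2), (∀ x, D x i j = -(ε / 2) * d x l) → ∀ x,
      deriv (fun y => D y i j) x = -(ε / 2) * deriv (fun y => d y l) x := fun i j l h x => by
    rw [funext h]
    exact (((IsLoop.apply hd l).hasDerivAt x).const_mul _).deriv
  refine ⟨hD.2.2, b1, b2, fun x => ?_, fun x => ?_⟩
  · have := congrFun (congrFun e2 x) 0
    simp only [Matrix.cons_val] at this
    rw [dd 0 1 0 b1] at this
    have h0x := h0 x
    field_simp
    linear_combination 2 * ε * this + (deriv (fun y => d y 0) x - 2 * k₀ x * D x 0 0) * hε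
  · have := congrFun (congrFun e2 x) 1
    simp only [Matrix.cons_val] at this
    rw [dd 0 2 1 b2] at this
    have h0x := h0 x
    field_simp
    linear_combination 2 * ε * this + (deriv (fun y => d y 1) x - 2 * k₀ x * D x 2 1) * hε

/-- Since `L0` is the unit vector of `γ₁`, the trace involves only the components fixed by
`IsRestriction`. It is a Wronskian of the gradients weighted by `1/k₀`, with opposite signs in the
two slots; integrating the derivatives of `d'` by parts gives the operator. -/
theorem integral_lie_L0 {ε : ℝ} {k₀ : ℝ → ℝ} (hk₀ : IsLoop T k₀) (h0 : ∀ x, k₀ x ≠ 0)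
    {d d' : ℝ → Fin 2 → ℝ} (hd : d ∈ loops T Set.univ) (hd' : d' ∈ loops T Set.univ)
    {D D' : ℝ → Mat} (hD : IsRestriction ε k₀ d D) (hD' : IsRestriction ε k₀ d' D') :
    ∫ x in (0 : ℝ)..T, (⁅L0, D x⁆ * D' x).trace =
      ∫ x in (0 : ℝ)..T, d' x ⬝ᵥ ((ε / 2) • leafOp k₀ d) x := by
  have ha := hk₀.inv h0
  have l := fun i => IsLoop.apply hd i
  have l' := fun i => IsLoop.apply hd' i
  have hL : ∀ x, (⁅L0, D x⁆ * D' x).trace = ε / 2 * (1 / k₀ x * (d x 0 * deriv (fun y => d' y 0) x)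
      - 1 / k₀ x * (deriv (fun y => d y 0) x * d' x 0)
      + 1 / k₀ x * (deriv (fun y => d y 1) x * d' x 1)
      - 1 / k₀ x * (d x 1 * deriv (fun y => d' y 1) x)) := fun x => by
    rw [eq_o31Mat (hD.mem x), eq_o31Mat (hD'.mem x), L0_eq, lie_o31Mat, trace_o31Mat_mul,
      hD.a, hD.b1, hD.b2, hD.r, hD'.a, hD'.b1, hD'.b2, hD'.r]
    have h0x := h0 x
    field_simp
    ring
  have hR : ∀ x, d' x ⬝ᵥ ((ε / 2) • leafOp k₀ d) x = ε / 2 *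
      (d' x 1 * symOp (fun y => 1 / k₀ y) (fun y => d y 1) x
        - d' x 0 * symOp (fun y => 1 / k₀ y) (fun y => d y 0) x) := fun x => by
    rw [Pi.smul_apply, leafOp_eq, dotProduct, Fin.sum_univ_two]
    simp only [Pi.smul_apply, smul_eq_mul, Matrix.cons_val]
    ring
  simp only [hL, hR, intervalIntegral.integral_const_mul]
  congr 1
  have hs : ∀ i, IsLoop T (symOp (fun y => 1 / k₀ y) (fun y => d y i)) := fun i =>
    .of_smoothPeriodic ((ha.smoothPeriodic (E := ℝ)).symOp (l i).smoothPeriodic) 0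
  have hF := (ha.mul ((l 0).mul (l' 0))).sub (ha.mul ((l 1).mul (l' 1)))
  refine integral_eq_of_hasDerivAt_sub
    (((((ha.mul ((l 0).mul (l' 0).deriv)).sub (ha.mul ((l 0).deriv.mul (l' 0)))).add
      (ha.mul ((l 1).deriv.mul (l' 1)))).sub (ha.mul ((l 1).mul (l' 1).deriv))).intervalIntegrable
      0 T) ((((l' 1).mul (hs 1)).sub ((l' 0).mul (hs 0))).intervalIntegrable 0 T)
    hF.periodic fun x => ?_
  refine (((ha.hasDerivAt x).fun_mul (((l 0).hasDerivAt x).fun_mul ((l' 0).hasDerivAt x))).fun_sub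
    ((ha.hasDerivAt x).fun_mul
      (((l 1).hasDerivAt x).fun_mul ((l' 1).hasDerivAt x)))).congr_deriv ?_
  rw [symOp_apply ha (l 0), symOp_apply ha (l 1)]
  ring

end ReducedBracket

/-! ### The two reductions. -/

section Reductions

variable {T : ℝ}

theorem isRestriction_cone {ε : ℝ} (hε : ε * ε = 1) (hT : 0 < T) {h : (ℝ → Fin 3 → ℝ) → ℝ}
    (hh : (coneInvariants T).IsSmooth h) {Hext : (ℝ → Mat) → ℝ}
    (he : IsGaugeExtension HL (coneInvariants T) (fun k x => ε • KL (k x)) h Hext)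
    {k : ℝ → Fin 3 → ℝ} (hk : k ∈ (coneInvariants T).carrier) :
    IsRestriction ε (fun x => k x 0)
      (fun x => ![(coneInvariants T).varDeriv h k x 1, (coneInvariants T).varDeriv h k x 2])
      (extDeriv HL T {v : Fin 3 → ℝ | 0 < v 0} (fun v => ε • KL v) Hext k) := by
  have hK := isSection_cone T hε
  have hd := varDeriv_mem_loops hh.hasVarDeriv hk
  have hkp := SmoothPeriodic.of_loop (E := ℝ) hk
  refine isRestriction_of (T := T) (k₁ := fun x => k x 1) (k₂ := fun x => k x 2) hε hT
    (IsLoop.apply hk 0) (fun x => (hk.2.2 x).ne')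
    (((IsLoop.apply hd 1).smoothPeriodic.vec2 (E := ℝ) (IsLoop.apply hd 2).smoothPeriodic).mem_loops
      0) (hK.extDeriv_mem he hk) (fun w hw => ?_) fun w hw => ?_
  · have hwp := SmoothPeriodic.of_loop (E := ℝ) hw
    have hs : SmoothPeriodic T (fun (s _ : ℝ) => s) := .param contDiff_id
    -- Only `k₁, k₂` are varied; with `k₀` fixed the family stays in the domain for all parameter
    -- values.
    have hp := (hkp.apply 0).vec3 ((hkp.apply 1).add (hs.mul (hwp.apply 0)))
      ((hkp.apply 2).add (hs.mul (hwp.apply 1)))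
    have h1 := hK.integral_extDeriv_section hh he hp (fun _ x => hk.2.2 x) 0
    have e : (fun x => ![k x 0, k x 1 + 0 * w x 0, k x 2 + 0 * w x 1]) = k := by
      funext x
      ext i
      fin_cases i <;> simp
    have hl : ∀ a b, HasDerivAt (fun r : ℝ => a + r * b) b 0 := fun a b =>
      (hasDerivAt_mul_const b).const_add a
    have d1 : ∀ x, deriv (fun r => ![k x 0, k x 1 + r * w x 0, k x 2 + r * w x 1]) 0 =
        ![0, w x 0, w x 1] := fun x =>
      (hasDerivAt_vec3 (hasDerivAt_const 0 _) (hl _ _) (hl _ _)).deriv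
    have d2 : ∀ x, deriv (fun r => ε • KL ![k x 0, k x 1 + r * w x 0, k x 2 + r * w x 1]) 0 =
        o31Mat 0 0 0 (-(ε * w x 0)) (-(ε * w x 1)) 0 := fun x => by
      refine deriv_mat_eq ?_
      simp only [smul_KL]
      have h0 := hasDerivAt_const (0 : ℝ) (0 : ℝ)
      exact hasDerivAt_o31Mat h0 (hasDerivAt_const (0 : ℝ) (-(ε * k x 0))) h0 ((hl _ _).const_mul ε).fun_neg
        ((hl _ _).const_mul ε).fun_neg h0
    simp only [d1, d2, e] at h1
    rw [h1]
    refine intervalIntegral.integral_congr fun x _ => ?_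
    simp only [dotProduct, Fin.sum_univ_three, Fin.sum_univ_two, Matrix.cons_val, mul_zero, zero_add]
    rfl
  · have hwp := SmoothPeriodic.of_loop (E := ℝ) hw
    have hs : SmoothPeriodic T (fun (s _ : ℝ) => s) := .param contDiff_id
    have e : ∀ x, k x = ![k x 0, k x 1, k x 2] := fun x => by
      ext i
      fin_cases i <;> rfl
    simp only [← e]
    exact hK.integral_extDeriv_gauge he hk
      ((hs.mul (hwp.apply 0)).nilMat (hs.mul (hwp.apply 1))) (fun s x => nilMat_mem_HL _ _)
      (fun x => by
        ext i j
        fin_cases i <;> fin_cases j <;> simp [nilMat])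
      fun x => deriv_mat_eq (hasDerivAt_nilMat _ _)

theorem isRestriction_sphere {ε : ℝ} (hε : ε * ε = 1) (hT : 0 < T) {h : (ℝ → Fin 2 → ℝ) → ℝ}
    (hh : (sphereInvariants T).IsSmooth h) {Hext : (ℝ → Mat) → ℝ}
    (he : IsGaugeExtension HM (sphereInvariants T) (fun κ x => ε • KM (κ x)) h Hext)
    {κ : ℝ → Fin 2 → ℝ} (hκ : κ ∈ (sphereInvariants T).carrier) :
    IsRestriction ε (fun _ => 1) ((sphereInvariants T).varDeriv h κ)
      (extDeriv HM T (Set.univ : Set (Fin 2 → ℝ)) (fun v => ε • KM v) Hext κ) := by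
  have hK := isSection_sphere T hε
  have hd := varDeriv_mem_loops hh.hasVarDeriv hκ
  have hkp := SmoothPeriodic.of_loop (E := ℝ) hκ
  refine isRestriction_of (T := T) (k₁ := fun x => κ x 0) (k₂ := fun x => κ x 1) hε hT
    ⟨contDiff_const, fun _ => rfl⟩ (fun _ => one_ne_zero) hd (hK.extDeriv_mem he hκ)
    (fun w hw => ?_) fun w hw => ?_
  · have hwp := SmoothPeriodic.of_loop (E := ℝ) hw
    have hs : SmoothPeriodic T (fun (s _ : ℝ) => s) := .param contDiff_id
    have hp := ((hkp.apply 0).add (hs.mul (hwp.apply 0))).vec2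
      ((hkp.apply 1).add (hs.mul (hwp.apply 1)))
    have h1 := hK.integral_extDeriv_section hh he hp (fun _ _ => trivial) 0
    have e : (fun x => ![κ x 0 + 0 * w x 0, κ x 1 + 0 * w x 1]) = κ := by
      funext x
      ext i
      fin_cases i <;> simp
    have hl : ∀ a b, HasDerivAt (fun r : ℝ => a + r * b) b 0 := fun a b =>
      (hasDerivAt_mul_const b).const_add a
    have d1 : ∀ x, deriv (fun r => ![κ x 0 + r * w x 0, κ x 1 + r * w x 1]) 0 = w x := fun x => by
      refine (hasDerivAt_vec2 (hl _ _) (hl _ _)).deriv.trans ?_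
      ext i
      fin_cases i <;> rfl
    have d2 : ∀ x, deriv (fun r => ε • KM ![κ x 0 + r * w x 0, κ x 1 + r * w x 1]) 0 =
        o31Mat 0 0 0 (-(ε * w x 0)) (-(ε * w x 1)) 0 := fun x => by
      refine deriv_mat_eq ?_
      simp only [KM_eq_KL, smul_KL]
      have h0 := hasDerivAt_const (0 : ℝ) (0 : ℝ)
      exact hasDerivAt_o31Mat h0 (hasDerivAt_const (0 : ℝ) (-(ε * 1))) h0 ((hl _ _).const_mul ε).fun_neg
        ((hl _ _).const_mul ε).fun_neg h0
    simp only [d1, d2, e] at h1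
    exact h1
  · have hwp := SmoothPeriodic.of_loop (E := ℝ) hw
    have hs : SmoothPeriodic T (fun (s _ : ℝ) => s) := .param contDiff_id
    have h1 := hK.integral_extDeriv_gauge he hκ
      ((hs.mul (hwp.apply 0)).nilMat (hs.mul (hwp.apply 1)))
      (fun s x => HL_subset_HM (nilMat_mem_HL _ _))
      (fun x => by
        ext i j
        fin_cases i <;> fin_cases j <;> simp [nilMat])
      fun x => deriv_mat_eq (hasDerivAt_nilMat _ _)
    simpa only [KM_eq_KL] using h1

theorem reducesTo_cone {ε : ℝ} (hε : ε * ε = 1) (hT : 0 < T) :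
    ReducesTo L0 HL (coneInvariants T) (fun k x => ε • KL (k x))
      ((coneInvariants T).opBracket (fun k v => (ε / 2) • P0 k v)) where
  exists_extension _ hh := exists_gaugeExtension_cone hε hh
  bracket_eq h f hh hf Hext Fext hH hF k hk := by
    have l : ∀ {h}, (coneInvariants T).IsSmooth h →
        (fun x => ![(coneInvariants T).varDeriv h k x 1, (coneInvariants T).varDeriv h k x 2]) ∈
          loops T (Set.univ : Set (Fin 2 → ℝ)) := fun hh => by
      have hd := varDeriv_mem_loops (LoopSpace.IsSmooth.hasVarDeriv hh) hk
      exact ((IsLoop.apply hd 1).smoothPeriodic.vec2 (E := ℝ)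
        (IsLoop.apply hd 2).smoothPeriodic).mem_loops 0
    refine (integral_lie_L0 (IsLoop.apply hk 0) (fun x => (hk.2.2 x).ne') (l hh) (l hf)
      (isRestriction_cone hε hT hh hH hk) (isRestriction_cone hε hT hf hF hk)).trans ?_
    refine intervalIntegral.integral_congr fun x _ => ?_
    change _ = (coneInvariants T).varDeriv f k x ⬝ᵥ ((ε / 2) • P0 k _) x
    simp only [Pi.smul_apply, leafOp_eq, P0_eq, dotProduct, Fin.sum_univ_three, Fin.sum_univ_two,
      Matrix.cons_val, smul_eq_mul, mul_zero, zero_add]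
  poisson := (isHamiltonian_P0 T (ε / 2)).isPoisson

theorem half_smul_leafOp_one (ε : ℝ) (v : ℝ → Fin 2 → ℝ) :
    (ε / 2) • leafOp (fun _ => 1) v = ε • diagD v := by
  rw [leafOp_one, smul_smul, div_mul_cancel₀ _ two_ne_zero]

theorem reducesTo_sphere {ε : ℝ} (hε : ε * ε = 1) (hT : 0 < T) :
    ReducesTo L0 HM (sphereInvariants T) (fun κ x => ε • KM (κ x))
      ((sphereInvariants T).opBracket (fun _ v => ε • diagD v)) where
  exists_extension _ hh := exists_gaugeExtension_sphere hε hh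
  bracket_eq h f hh hf Hext Fext hH hF κ hκ := by
    have l : ∀ {h}, (sphereInvariants T).IsSmooth h →
        (sphereInvariants T).varDeriv h κ ∈ loops T (Set.univ : Set (Fin 2 → ℝ)) := fun hh =>
      varDeriv_mem_loops (LoopSpace.IsSmooth.hasVarDeriv hh) hκ
    refine (integral_lie_L0 ⟨contDiff_const, fun _ => rfl⟩ (fun _ => one_ne_zero) (l hh) (l hf)
      (isRestriction_sphere hε hT hh hH hκ) (isRestriction_sphere hε hT hf hF hκ)).trans ?_
    rw [half_smul_leafOp_one]
    rfl
  poisson := by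
    -- `ε diag(-D, D)` is the member `a = 0`, `b = ε` of the KdV pencil.
    have h := (isHamiltonian_kdv T 0 ε).isPoisson
    simp only [zero_smul, zero_add] at h
    exact h

end Reductions

end LightCone

end

theorem mainTheorem4 (T : ℝ) (hT : 0 < T) (ε : ℝ) (hε : ε = 1 ∨ ε = -1) :
    -- reduction to the invariants of curves in the cone, with operator `½ ε P₀`
    LightCone.ReducesTo LightCone.L0 LightCone.HL (LightCone.coneInvariants T)
      (fun k x => ε • LightCone.KL (k x))
      ((LightCone.coneInvariants T).opBracket (fun k v => (ε / 2) • LightCone.P0 k v)) ∧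
    -- reduction to the invariants of curves in the sphere, with operator `ε diag(-D, D)`
    LightCone.ReducesTo LightCone.L0 LightCone.HM (LightCone.sphereInvariants T)
      (fun κ x => ε • LightCone.KM (κ x))
      ((LightCone.sphereInvariants T).opBracket (fun _ v => ε • LightCone.diagD v)) ∧
    -- the level sets of `k₀` are Poisson submanifolds
    (∀ c ∈ LightCone.loops T (Set.Ioi (0 : ℝ)),
      LightCone.leaf c '' (LightCone.sphereInvariants T).carrier =
        {k ∈ (LightCone.coneInvariants T).carrier | ∀ x, k x 0 = c x} ∧
      LightCone.IsPoissonSubmanifold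
        (LightCone.coneInvariants T)
        ((LightCone.coneInvariants T).opBracket (fun k v => (ε / 2) • LightCone.P0 k v))
        (LightCone.sphereInvariants T)
        ((LightCone.sphereInvariants T).opBracket (fun _ v => (ε / 2) • LightCone.leafOp c v))
        (LightCone.leaf c)) ∧
    -- the leaf `k₀ = 1` is the space of invariants of the sphere with its reduced bracket
    (∀ κ : Fin 2 → ℝ, LightCone.KL ![1, κ 0, κ 1] = LightCone.KM κ) ∧
    LightCone.IsPoissonSubmanifold
      (LightCone.coneInvariants T)
      ((LightCone.coneInvariants T).opBracket (fun k v => (ε / 2) • LightCone.P0 k v))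
      (LightCone.sphereInvariants T)
      ((LightCone.sphereInvariants T).opBracket (fun _ v => ε • LightCone.diagD v))
      (LightCone.leaf (fun _ => 1)) ∧
    -- `diag(-D, D)` is the second Hamiltonian structure of the complexly coupled KdV system
    (LightCone.sphereInvariants T).IsSmooth (LightCone.kdvH1 T) ∧
    (LightCone.sphereInvariants T).IsSmooth (LightCone.kdvH2 T) ∧
    (∀ κ ∈ (LightCone.sphereInvariants T).carrier,
      LightCone.coupledKdV κ = LightCone.kdvP κ
        ((LightCone.sphereInvariants T).varDeriv (LightCone.kdvH1 T) κ) ∧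
      LightCone.coupledKdV κ = LightCone.diagD
        ((LightCone.sphereInvariants T).varDeriv (LightCone.kdvH2 T) κ)) ∧
    (∀ a b : ℝ, (LightCone.sphereInvariants T).IsPoisson
      ((LightCone.sphereInvariants T).opBracket
        (fun κ v => a • LightCone.kdvP κ v + b • LightCone.diagD v))) := by
  have hε2 : ε * ε = 1 := by rcases hε with rfl | rfl <;> norm_num
  have h1 : (fun _ : ℝ => (1 : ℝ)) ∈ LightCone.loops T (Set.Ioi (0 : ℝ)) :=
    ⟨contDiff_const, fun _ => rfl, fun _ => Set.mem_Ioi.2 one_pos⟩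
  have d1 := LightCone.hasVarDeriv_kdvH1 T
  have d2 := LightCone.hasVarDeriv_kdvH2 T
  refine ⟨LightCone.reducesTo_cone hε2 hT, LightCone.reducesTo_sphere hε2 hT,
    fun c hc => ⟨LightCone.image_leaf hc, LightCone.isPoissonSubmanifold_leaf hT hc (ε / 2)⟩,
    fun κ => (LightCone.KM_eq_KL κ).symm, ?_, ⟨_, d1⟩, ⟨_, d2⟩, fun κ hκ => ⟨?_, ?_⟩,
    fun a b => (LightCone.isHamiltonian_kdv T a b).isPoisson⟩
  · simpa only [LightCone.half_smul_leafOp_one] using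
      LightCone.isPoissonSubmanifold_leaf hT h1 (ε / 2)
  · exact (LightCone.coupledKdV_eq_kdvP hκ).trans (congrArg (LightCone.kdvP κ)
      (LightCone.varDeriv_unique hT d1 (LightCone.LoopSpace.IsSmooth.hasVarDeriv ⟨_, d1⟩) hκ))
  · exact (LightCone.coupledKdV_eq_diagD hκ).trans (congrArg LightCone.diagD
      (LightCone.varDeriv_unique hT d2 (LightCone.LoopSpace.IsSmooth.hasVarDeriv ⟨_, d2⟩) hκ))
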